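/- **Corollary (partially dynamic unit-square set cover, unit-square hitting set and quadrant hitting set).** An instance $(S,\mathcal R)$ consists of a finite set $S$ of points of $\mathbb R^2$ and a finite set $\mathcal R$ of ranges, which are either closed axis-parallel unit squares or closed axis-parallel quadrants (of any of the four types NE, NW, SE, SW); its size is $|S|+|\mathcal R|$. A *set cover* is a multiset of ranges of $\mathcal R$ that together contain every point of $S$; a *hitting set* is a multiset of points of $S$ that meets every range of $\mathcal R$; sizes are counted with multiplicity. In the *partially dynamic* set cover problem, points are inserted into and deleted from $S$ while $\mathcal R$ is fixed; in the partially dynamic hitting set problem, ranges are inserted into and deleted from $\mathcal R$ while $S$ is fixed. A *$c$-approximate data structure* for such a problem is built from the initial instance and processes the updates one by one. After the construction and after each update, it decides whether the current instance has a feasible solution and, if so, stores (implicitly) a feasible multiset solution $M$ with $|M|\le c\cdot\mathsf{opt}$, where $\mathsf{opt}$ is the minimum size of a feasible solution; it answers the *size query* (report $|M|$, or that there is no solution) in $O(1)$ time, the *membership query* (report the multiplicity in $M$ of a given range of $\mathcal R$, resp. point of $S$) in $O(1+\log|M|)$ time, and the *reporting query* (list all elements of $M$) in $O(1+|M|)$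 time. Time is counted in a real-valued pointer machine (constant-time allocation and traversal of constant-size records, and addition, subtraction and comparison of reals), $\widetilde O$ hides factors polylogarithmic in the instance size, $n_0$ is the size of the initial instance, and amortized update time $\widetilde O(1)$ means that for some absolute constants $C,k$ the first $m$ updates take at most $\sum_{i=1}^m C\log^k(n_i+2)$ time in total, for every $m$ and every sequence of updates, where $n_i$ is the size of the instance after the $i$-th update. There exist $O(1)$-approximate data structures for (1) partially dynamic unit-square set cover, (2) partially dynamic unit-square hitting set, and (3) partially dynamic quadrant hitting set, each with $\widetilde O(1)$ amortized update time and $\widetilde O(n_0)$ construction time. -/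

import Mathlib

/-!
# Partially dynamic geometric set cover and hitting set

The model of computation is a pointer machine over the reals.  Its values are pointers to immutable
records: the empty record, a record holding one real number, or a cell holding two pointers.
In constant time a program can allocate a record, follow a pointer, inspect the tag of a record,
add, subtract or compare two reals, bind a local variable, or call one of its (finitely many,
mutually recursive) functions.  Records are never overwritten, there is no random access, no
rounding, and no comparison of pointers.  Every counted step is a constant number of steps of a
(mutable) pointer machine or of a real RAM, so time bounds in this model hold in those models too.
-/

namespace GeomCover

/-! ### The machine -/

/-- Machine values. Passing a value around means passing a pointer. -/
inductive Val : Type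
  | nil : Val
  | num (x : ℝ) : Val
  | cell (a b : Val) : Val

/-- Program text. Local variables are de Bruijn indices into the current environment. -/
inductive Code : Type
  /-- the `i`-th local variable -/
  | var (i : ℕ) : Code
  /-- the empty record -/
  | nil : Code
  /-- a rational constant -/
  | lit (q : ℚ) : Code
  /-- addition of reals -/
  | add (e₁ e₂ : Code) : Code
  /-- subtraction of reals -/
  | sub (e₁ e₂ : Code) : Code
  /-- allocation of a cell -/
  | cons (e₁ e₂ : Code) : Code
  /-- `let x := e; body`, where `x` is variable `0` of `body` -/
  | letIn (e body : Code) : Code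
  /-- `if e₁ ≤ e₂ then e₃ else e₄`, for real `e₁`, `e₂` -/
  | ifLe (e₁ e₂ e₃ e₄ : Code) : Code
  /-- branch on the tag of `e`; in the last branch, variables `0` and `1` are the two
  components of the cell -/
  | branch (e onNil onNum onCell : Code) : Code
  /-- call of the `f`-th function of the program; its body sees the argument as variable `0` -/
  | call (f : ℕ) (e : Code) : Code

/-- `Runs P env e v t`: in the program with function bodies `P`, the code `e`, started in the
environment `env`, halts with value `v` after exactly `t` steps.  Ill-typed code (for example the
addition of a cell) does not halt with any value. -/
inductive Runs (P : List Code) : List Val → Code → Val → ℕ → Prop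
  | var {env : List Val} {i : ℕ} {v : Val} (h : env[i]? = some v) : Runs P env (.var i) v 1
  | nil {env : List Val} : Runs P env .nil .nil 1
  | lit {env : List Val} {q : ℚ} : Runs P env (.lit q) (.num (q : ℝ)) 1
  | add {env : List Val} {e₁ e₂ : Code} {x y : ℝ} {s t : ℕ}
      (h₁ : Runs P env e₁ (.num x) s) (h₂ : Runs P env e₂ (.num y) t) :
      Runs P env (.add e₁ e₂) (.num (x + y)) (s + t + 1)
  | sub {env : List Val} {e₁ e₂ : Code} {x y : ℝ} {s t : ℕ}
      (h₁ : Runs P env e₁ (.num x) s) (h₂ : Runs P env e₂ (.num y) t) :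
      Runs P env (.sub e₁ e₂) (.num (x - y)) (s + t + 1)
  | cons {env : List Val} {e₁ e₂ : Code} {a b : Val} {s t : ℕ}
      (h₁ : Runs P env e₁ a s) (h₂ : Runs P env e₂ b t) :
      Runs P env (.cons e₁ e₂) (.cell a b) (s + t + 1)
  | letIn {env : List Val} {e body : Code} {a v : Val} {s t : ℕ}
      (h₁ : Runs P env e a s) (h₂ : Runs P (a :: env) body v t) :
      Runs P env (.letIn e body) v (s + t + 1)
  | ifLe_true {env : List Val} {e₁ e₂ e₃ e₄ : Code} {x y : ℝ} {v : Val} {r s t : ℕ}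
      (h₁ : Runs P env e₁ (.num x) r) (h₂ : Runs P env e₂ (.num y) s) (hxy : x ≤ y)
      (h₃ : Runs P env e₃ v t) :
      Runs P env (.ifLe e₁ e₂ e₃ e₄) v (r + s + t + 1)
  | ifLe_false {env : List Val} {e₁ e₂ e₃ e₄ : Code} {x y : ℝ} {v : Val} {r s t : ℕ}
      (h₁ : Runs P env e₁ (.num x) r) (h₂ : Runs P env e₂ (.num y) s) (hxy : ¬ x ≤ y)
      (h₃ : Runs P env e₄ v t) :
      Runs P env (.ifLe e₁ e₂ e₃ e₄) v (r + s + t + 1)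
  | branch_nil {env : List Val} {e e₁ e₂ e₃ : Code} {v : Val} {s t : ℕ}
      (h₁ : Runs P env e .nil s) (h₂ : Runs P env e₁ v t) :
      Runs P env (.branch e e₁ e₂ e₃) v (s + t + 1)
  | branch_num {env : List Val} {e e₁ e₂ e₃ : Code} {x : ℝ} {v : Val} {s t : ℕ}
      (h₁ : Runs P env e (.num x) s) (h₂ : Runs P env e₂ v t) :
      Runs P env (.branch e e₁ e₂ e₃) v (s + t + 1)
  | branch_cell {env : List Val} {e e₁ e₂ e₃ : Code} {a b : Val} {v : Val} {s t : ℕ}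
      (h₁ : Runs P env e (.cell a b) s) (h₂ : Runs P (a :: b :: env) e₃ v t) :
      Runs P env (.branch e e₁ e₂ e₃) v (s + t + 1)
  | call {env : List Val} {f : ℕ} {e body : Code} {a v : Val} {s t : ℕ}
      (hf : P[f]? = some body) (h₁ : Runs P env e a s) (h₂ : Runs P [a] body v t) :
      Runs P env (.call f e) v (s + t + 1)

/-- Computations are deterministic: both the result and the number of steps are determined. -/
theorem Runs.det {P : List Code} {env : List Val} {e : Code} {v w : Val} {s t : ℕ}
    (h : Runs P env e v s) (h' : Runs P env e w t) : v = w ∧ s = t := by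
  induction h generalizing w t <;> cases h' <;> grind

/-- The linked list of the given values. -/
def Val.ofList : List Val → Val
  | [] => .nil
  | v :: l => .cell v (Val.ofList l)

/-! ### Points, quadrants and unit squares -/

/-- Points of the plane. -/
abbrev Point : Type := ℝ × ℝ

/-- The four types of quadrants. -/
inductive Direction : Type
  | northeast : Direction
  | northwest : Direction
  | southeast : Direction
  | southwest : Direction

/-- A (closed, axis-parallel) quadrant, given by its type and its vertex. -/
structure Quadrant : Type where
  dir : Direction
  vertex : Point

/-- The region of a quadrant. -/
def Quadrant.region (Q : Quadrant) : Set Point :=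
  match Q.dir with
  | .northeast => {p | Q.vertex.1 ≤ p.1 ∧ Q.vertex.2 ≤ p.2}
  | .northwest => {p | p.1 ≤ Q.vertex.1 ∧ Q.vertex.2 ≤ p.2}
  | .southeast => {p | Q.vertex.1 ≤ p.1 ∧ p.2 ≤ Q.vertex.2}
  | .southwest => {p | p.1 ≤ Q.vertex.1 ∧ p.2 ≤ Q.vertex.2}

/-- A (closed, axis-parallel) square of side length `1`, given by its center. -/
structure UnitSquare : Type where
  center : Point

/-- The region of a unit square. -/
def UnitSquare.region (Z : UnitSquare) : Set Point :=
  {p | |p.1 - Z.center.1| ≤ 1 / 2 ∧ |p.2 - Z.center.2| ≤ 1 / 2}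

/-- Machine representation of a point: a cell with its two coordinates. -/
def encodePoint (p : Point) : Val := .cell (.num p.1) (.num p.2)

/-- Machine representation of a type of quadrants: the signs of the two unbounded directions. -/
def encodeDirection : Direction → Val
  | .northeast => .cell (.num 1) (.num 1)
  | .northwest => .cell (.num (-1)) (.num 1)
  | .southeast => .cell (.num 1) (.num (-1))
  | .southwest => .cell (.num (-1)) (.num (-1))

/-- Machine representation of a quadrant: its type and its vertex. -/
def encodeQuadrant (Q : Quadrant) : Val := .cell (encodeDirection Q.dir) (encodePoint Q.vertex)

/-- Machine representation of a unit square: its center. -/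
def encodeUnitSquare (Z : UnitSquare) : Val := encodePoint Z.center

/-! ### Set covers and hitting sets -/

/-- `M` is a (multiset) set cover for `(S, 𝓡)`: a multiset of ranges of `𝓡` that cover all points
of `S`. -/
def IsSetCover {R : Type} (region : R → Set Point) (S : Finset Point) (𝓡 : Finset R)
    (M : Multiset R) : Prop :=
  (∀ r ∈ M, r ∈ 𝓡) ∧ ∀ a ∈ S, ∃ r ∈ M, a ∈ region r

/-- `M` is a (multiset) hitting set for `(S, 𝓡)`: a multiset of points of `S` that hit all ranges
of `𝓡`. -/
def IsHittingSet {R : Type} (region : R → Set Point) (S : Finset Point) (𝓡 : Finset R)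
    (M : Multiset Point) : Prop :=
  (∀ a ∈ M, a ∈ S) ∧ ∀ r ∈ 𝓡, ∃ a ∈ M, a ∈ region r

/-! ### Dynamic instances -/

/-- Insertion or deletion of one element. -/
inductive Update (D : Type) : Type
  | insert (d : D) : Update D
  | delete (d : D) : Update D

open Classical in
/-- The effect of an update on a finite set. -/
noncomputable def Update.apply {D : Type} (u : Update D) (X : Finset D) : Finset D :=
  match u with
  | .insert d => Insert.insert d X
  | .delete d => X.erase d

/-- The set after the first `i` updates of the sequence `u`, starting from `X₀`. -/
noncomputable def current {D : Type} (X₀ : Finset D) (u : ℕ → Update D) : ℕ → Finset D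
  | 0 => X₀
  | i + 1 => (u i).apply (current X₀ u i)

/-! ### Data structures -/

/-- The programs that make up a dynamic data structure; they may all call the functions `funs`. -/
structure DataStructure : Type where
  funs : List Code
  /-- construction from the linked lists of the dynamic and of the static elements -/
  build : Code
  /-- takes the present state and an element, and produces the next state -/
  insert : Code
  /-- takes the present state and an element, and produces the next state -/
  delete : Code
  /-- takes the present state -/
  size : Code
  /-- takes the present state and an element -/
  member : Code
  /-- takes the present state -/
  report : Code

/-- One update from state `σ` to state `σ'`, taking `t` steps. -/
def DataStructure.RunsUpdate (ds : DataStructure) {D : Type} (encD : D → Val)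
    (u : Update D) (σ σ' : Val) (t : ℕ) : Prop :=
  match u with
  | .insert d => Runs ds.funs [σ, encD d] ds.insert σ' t
  | .delete d => Runs ds.funs [σ, encD d] ds.delete σ' t

open Classical in
/-- In state `σ`, the data structure stores the multiset `M`: it answers the size query in time
`O(1)`, the membership query of each `a ∈ A` in time `O(log |M|)`, and the reporting query in
time `O(|M|)`. -/
def DataStructure.Stores (ds : DataStructure) {A : Type} (encA : A → Val) (A₀ : Finset A)
    (C : ℕ) (σ : Val) (M : Multiset A) : Prop :=
  (∃ t ≤ C, Runs ds.funs [σ] ds.size (.num (M.card : ℝ)) t) ∧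
  (∀ a ∈ A₀, ∃ t ≤ C * (Nat.log 2 M.card + 1),
    Runs ds.funs [σ, encA a] ds.member (.num (M.count a : ℝ)) t) ∧
  (∃ l : List A, (l : Multiset A) = M ∧ ∃ t ≤ C * (M.card + 1),
    Runs ds.funs [σ] ds.report (Val.ofList (l.map encA)) t)

/-- In state `σ`, the data structure maintains a `c`-approximate solution of an instance whose
feasible solutions are the multisets `M` with `IsSol M`.  If there is no feasible solution, the
size query says so (with the answer `nil`).  Otherwise a feasible solution is stored whose size is
at most `c` times that of every feasible solution. -/
def DataStructure.Maintains (ds : DataStructure) {A : Type} (encA : A → Val) (A₀ : Finset A)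
    (IsSol : Multiset A → Prop) (c C : ℕ) (σ : Val) : Prop :=
  ((¬ ∃ M, IsSol M) → ∃ t ≤ C, Runs ds.funs [σ] ds.size .nil t) ∧
  ((∃ M, IsSol M) → ∃ M, IsSol M ∧ (∀ M', IsSol M' → M.card ≤ c * M'.card) ∧
    ds.Stores encA A₀ C σ M)

open Classical in
/-- `ds` is a `c`-approximate data structure for the partially dynamic problem with dynamic
elements `D`, static elements `A`, and feasible solutions `IsSol X A₀ M` (`X` the dynamic set, `A₀`
the static set).  The construction takes at most `C (n₀ + 1) log ^ k (n₀ + 2)` steps, where `n₀` is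
the size of the initial instance; for every sequence of updates and every `m`, the first `m`
updates take in total at most the sum of `C log ^ k (n + 2)` over these updates, where `n` is the
size of the instance just after the update; after the construction and after each update, a
`c`-approximate solution is maintained. -/
def IsPartiallyDynamic (ds : DataStructure) {D A : Type} (encD : D → Val) (encA : A → Val)
    (IsSol : Finset D → Finset A → Multiset A → Prop) (c C k : ℕ) : Prop :=
  ∀ (l : List D) (l' : List A), l.Nodup → l'.Nodup → ∀ u : ℕ → Update D,
    ∃ (σ : ℕ → Val) (t₀ : ℕ) (t : ℕ → ℕ),
      Runs ds.funs [Val.ofList (l.map encD), Val.ofList (l'.map encA)] ds.build (σ 0) t₀ ∧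
      t₀ ≤ C * (l.length + l'.length + 1) * Nat.log 2 (l.length + l'.length + 2) ^ k ∧
      (∀ i, ds.RunsUpdate encD (u i) (σ i) (σ (i + 1)) (t i)) ∧
      (∀ m, ∑ i ∈ Finset.range m, t i ≤ ∑ i ∈ Finset.range m,
        C * Nat.log 2 ((current l.toFinset u (i + 1)).card + l'.length + 2) ^ k) ∧
      (∀ i, ds.Maintains encA l'.toFinset (IsSol (current l.toFinset u i) l'.toFinset) c C (σ i))

/-- There is an `O(1)`-approximate partially dynamic set cover data structure (only the points
change) with amortized update time `Õ(1)` and construction time `Õ(n₀)`. -/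
def HasPartiallyDynamicSetCover {R : Type} (region : R → Set Point) (encR : R → Val) : Prop :=
  ∃ (ds : DataStructure) (c C k : ℕ),
    IsPartiallyDynamic ds encodePoint encR (fun S 𝓡 M => IsSetCover region S 𝓡 M) c C k

/-- There is an `O(1)`-approximate partially dynamic hitting set data structure (only the ranges
change) with amortized update time `Õ(1)` and construction time `Õ(n₀)`. -/
def HasPartiallyDynamicHittingSet {R : Type} (region : R → Set Point) (encR : R → Val) : Prop :=
  ∃ (ds : DataStructure) (c C k : ℕ),
    IsPartiallyDynamic ds encR encodePoint (fun 𝓡 S M => IsHittingSet region S 𝓡 M) c C k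

end GeomCover

-- All three problems are instances of one covering problem: a fixed finite set `A₀` of points, a
-- changing set of elements, and a relation `cov` between them. For unit squares the relation is
-- closeness to within 1/2 in both coordinates. It is symmetric, so set cover and hitting set differ
-- only in whether the centres or the points are static.
--
-- The structure `Model` reduces `cov` to dominance. A point owns up to sixteen records `(g, c, h)`,
-- an element sits at a position `x` and has at most four probes, and a probe with sign `±` hits a
-- record of its group if `± x ≤ c` and `y ≤ h`. For quadrants this is immediate, the groups being
-- the four types. For unit squares a grid is needed, but rounding is unavailable; instead lines are
-- picked near the static coordinates, more than 1/2 apart. A static coordinate `u` is then close to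
-- one or two lines, and every `v` with `|u - v| ≤ 1/2` lies between two lines, one of which is
-- close to `u`. Once `v` is known to be on a given side of a line close to `u`, the condition `|u -
-- v| ≤ 1/2` is a single inequality (`abs_sub_le_iff_exists`). So a square becomes a quadrant when
-- viewed from a corner of its grid cell.
--
-- Dominance reduces to stabbing intervals. `scan` stretches the position of an element to the
-- farthest records that its probes hit, which gives an interval. If a position `v` in the interval
-- is chosen, then the records of largest `h` that reach `v`, one for each probe, contain one that
-- covers the element (`Model.exists_cov`). Conversely, no record serves two elements with disjoint
-- intervals in a cell, and elements of different cells share no group (`Model.not_hits`); hence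
-- pairwise disjoint intervals force many points (`Model.card_le`). Greedy stabbing by smallest
-- right end produces as many disjoint intervals as stabs (`Model.greedy_spec`), so a run with `k`
-- stabs uses at most `4k` points while the coverable elements need at least `k / 16`.
--
-- An interval depends only on the static points, so an update changes one entry of a balanced tree,
-- and a greedy run costs polylogarithmic time per stab. The solution is recomputed only after a
-- number of updates proportional to the number of stabs. In between, an inserted element brings one
-- covering point along and a deletion leaves the solution alone. The disjoint family of the last
-- run survives well enough to give the factor `144 = 9 * 16` (`Approx.card_le`,
-- `Approx.length_le`), and the cost of recomputing is charged to the updates since the previous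
-- time (`sum_le_of_updateCost`). Elements that no point covers are kept in a separate tree, which
-- is empty exactly when the instance is feasible.
--
-- The programs are verified by weakest preconditions: `ev` and `ret` evaluate code symbolically by
-- simplification, and each function has a lemma that bounds its time and identifies its result.

namespace GeomCover

/-! ### Weakest preconditions -/

/-- The code halts, and its value and number of steps satisfy `Φ`. -/
def wp (P : List Code) (env : List Val) (e : Code) (Φ : Val → ℕ → Prop) : Prop :=
  ∃ v t, Runs P env e v t ∧ Φ v t

/-- The call of the `f`-th function halts, and its value and number of steps satisfy `Φ`. -/
def wpc (P : List Code) (f : ℕ) (a : Val) (Φ : Val → ℕ → Prop) : Prop :=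
  ∃ body, P[f]? = some body ∧ wp P [a] body Φ

section wp
variable {P : List Code} {env : List Val} {Φ : Val → ℕ → Prop}

theorem wp_var {i : ℕ} : wp P env (.var i) Φ ↔ ∃ v, env[i]? = some v ∧ Φ v 1 := by
  constructor
  · rintro ⟨v, t, h, h'⟩
    cases h with | var h => exact ⟨v, h, h'⟩
  · rintro ⟨v, h, h'⟩
    exact ⟨v, 1, .var h, h'⟩

theorem wp_nil : wp P env .nil Φ ↔ Φ .nil 1 := by
  constructor
  · rintro ⟨v, t, h, h'⟩
    cases h; exact h'
  · exact fun h => ⟨_, _, .nil, h⟩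

theorem wp_lit {q : ℚ} : wp P env (.lit q) Φ ↔ Φ (.num (q : ℝ)) 1 := by
  constructor
  · rintro ⟨v, t, h, h'⟩
    cases h; exact h'
  · exact fun h => ⟨_, _, .lit, h⟩

theorem wp_add {e₁ e₂ : Code} : wp P env (.add e₁ e₂) Φ ↔
    wp P env e₁ fun v s => ∃ x, v = .num x ∧ wp P env e₂ fun w t => ∃ y, w = .num y ∧
      Φ (.num (x + y)) (s + t + 1) := by
  constructor
  · rintro ⟨v, t, h, h'⟩
    cases h with
    | add h₁ h₂ => exact ⟨_, _, h₁, _, rfl, _, _, h₂, _, rfl, h'⟩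
  · rintro ⟨_, _, h₁, _, rfl, _, _, h₂, _, rfl, h'⟩
    exact ⟨_, _, .add h₁ h₂, h'⟩

theorem wp_sub {e₁ e₂ : Code} : wp P env (.sub e₁ e₂) Φ ↔
    wp P env e₁ fun v s => ∃ x, v = .num x ∧ wp P env e₂ fun w t => ∃ y, w = .num y ∧
      Φ (.num (x - y)) (s + t + 1) := by
  constructor
  · rintro ⟨v, t, h, h'⟩
    cases h with
    | sub h₁ h₂ => exact ⟨_, _, h₁, _, rfl, _, _, h₂, _, rfl, h'⟩
  · rintro ⟨_, _, h₁, _, rfl, _, _, h₂, _, rfl, h'⟩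
    exact ⟨_, _, .sub h₁ h₂, h'⟩

theorem wp_cons {e₁ e₂ : Code} : wp P env (.cons e₁ e₂) Φ ↔
    wp P env e₁ fun v s => wp P env e₂ fun w t => Φ (.cell v w) (s + t + 1) := by
  constructor
  · rintro ⟨v, t, h, h'⟩
    cases h with
    | cons h₁ h₂ => exact ⟨_, _, h₁, _, _, h₂, h'⟩
  · rintro ⟨_, _, h₁, _, _, h₂, h'⟩
    exact ⟨_, _, .cons h₁ h₂, h'⟩

theorem wp_letIn {e body : Code} : wp P env (.letIn e body) Φ ↔
    wp P env e fun a s => wp P (a :: env) body fun v t => Φ v (s + t + 1) := by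
  constructor
  · rintro ⟨v, t, h, h'⟩
    cases h with
    | letIn h₁ h₂ => exact ⟨_, _, h₁, _, _, h₂, h'⟩
  · rintro ⟨_, _, h₁, _, _, h₂, h'⟩
    exact ⟨_, _, .letIn h₁ h₂, h'⟩

theorem wp_call {f : ℕ} {e : Code} : wp P env (.call f e) Φ ↔
    wp P env e fun a s => wpc P f a fun v t => Φ v (s + t + 1) := by
  constructor
  · rintro ⟨v, t, h, h'⟩
    cases h with
    | call hf h₁ h₂ => exact ⟨_, _, h₁, _, hf, _, _, h₂, h'⟩
  · rintro ⟨_, _, h₁, _, hf, _, _, h₂, h'⟩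
    exact ⟨_, _, .call hf h₁ h₂, h'⟩

theorem wp_ifLe {e₁ e₂ e₃ e₄ : Code} : wp P env (.ifLe e₁ e₂ e₃ e₄) Φ ↔
    wp P env e₁ fun v r => ∃ x, v = .num x ∧ wp P env e₂ fun w s => ∃ y, w = .num y ∧
      (x ≤ y → wp P env e₃ fun v t => Φ v (r + s + t + 1)) ∧
      (¬ x ≤ y → wp P env e₄ fun v t => Φ v (r + s + t + 1)) := by
  constructor
  · rintro ⟨v, t, h, h'⟩
    cases h with
    | ifLe_true h₁ h₂ hxy h₃ =>
      exact ⟨_, _, h₁, _, rfl, _, _, h₂, _, rfl, fun _ => ⟨_, _, h₃, h'⟩, fun h => absurd hxy h⟩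
    | ifLe_false h₁ h₂ hxy h₃ =>
      exact ⟨_, _, h₁, _, rfl, _, _, h₂, _, rfl, fun h => absurd h hxy, fun _ => ⟨_, _, h₃, h'⟩⟩
  · rintro ⟨_, _, h₁, x, rfl, _, _, h₂, y, rfl, h, h'⟩
    by_cases hxy : x ≤ y
    · obtain ⟨_, _, h₃, h⟩ := h hxy
      exact ⟨_, _, .ifLe_true h₁ h₂ hxy h₃, h⟩
    · obtain ⟨_, _, h₃, h⟩ := h' hxy
      exact ⟨_, _, .ifLe_false h₁ h₂ hxy h₃, h⟩

end wp

/-! ### Derived code -/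

/-- Code that does not halt. -/
def Code.stuck : Code := .add .nil .nil

/-- First component of a cell. -/
def Code.fst (e : Code) : Code := .branch e .stuck .stuck (.var 0)

/-- Second component of a cell. -/
def Code.snd (e : Code) : Code := .branch e .stuck .stuck (.var 1)

/-- Test for the empty record. -/
def Code.ifNil (e e₁ e₂ : Code) : Code :=
  .ifLe (.branch e (.lit 0) (.lit 1) (.lit 1)) (.lit 0) e₁ e₂

section wp
variable {P : List Code} {env : List Val} {Φ : Val → ℕ → Prop}

/-- Adding empty records is ill-typed. A projection from anything but a cell therefore has no run,
which is why the rules for `fst` and `snd` are equivalences. -/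
theorem not_runs_stuck {v : Val} {t : ℕ} : ¬ Runs P env .stuck v t := by
  intro h
  cases h with | add h₁ h₂ => cases h₁

theorem wp_fst {e : Code} : wp P env e.fst Φ ↔
    wp P env e fun v s => ∃ a b, v = .cell a b ∧ Φ a (s + 2) := by
  constructor
  · rintro ⟨v, t, h, h'⟩
    cases h with
    | branch_nil _ h => exact absurd h not_runs_stuck
    | branch_num _ h => exact absurd h not_runs_stuck
    | branch_cell h₁ h₂ =>
      cases h₂ with
      | var h => simp at h; subst h; exact ⟨_, _, h₁, _, _, rfl, h'⟩
  · rintro ⟨_, _, h₁, _, _, rfl, h'⟩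
    exact ⟨_, _, .branch_cell h₁ (.var rfl), h'⟩

theorem wp_snd {e : Code} : wp P env e.snd Φ ↔
    wp P env e fun v s => ∃ a b, v = .cell a b ∧ Φ b (s + 2) := by
  constructor
  · rintro ⟨v, t, h, h'⟩
    cases h with
    | branch_nil _ h => exact absurd h not_runs_stuck
    | branch_num _ h => exact absurd h not_runs_stuck
    | branch_cell h₁ h₂ =>
      cases h₂ with
      | var h => simp at h; subst h; exact ⟨_, _, h₁, _, _, rfl, h'⟩
  · rintro ⟨_, _, h₁, _, _, rfl, h'⟩
    exact ⟨_, _, .branch_cell h₁ (.var rfl), h'⟩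

theorem wp_isNil {e : Code} : wp P env (.branch e (.lit 0) (.lit 1) (.lit 1)) Φ ↔
    wp P env e fun v s => (v = .nil → Φ (.num 0) (s + 2)) ∧ (v ≠ .nil → Φ (.num 1) (s + 2)) := by
  constructor
  · rintro ⟨v, t, h, h'⟩
    cases h with
    | branch_nil h h₂ => cases h₂; exact ⟨_, _, h, by simpa using h'⟩
    | branch_num h h₂ => cases h₂; exact ⟨_, _, h, by simpa using h'⟩
    | branch_cell h h₂ => cases h₂; exact ⟨_, _, h, by simpa using h'⟩
  · rintro ⟨v, t, h, h', h''⟩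
    cases v with
    | nil => exact ⟨_, _, .branch_nil h .lit, by simpa using h'⟩
    | num x => exact ⟨_, _, .branch_num h .lit, by simpa using h''⟩
    | cell a b => exact ⟨_, _, .branch_cell h .lit, by simpa using h''⟩

/-- Passing through a comparison of numbers keeps the environment the same in both branches; the
cell case of `branch` itself would shift the de Bruijn indices. -/
theorem wp_ifNil {e e₁ e₂ : Code} : wp P env (.ifNil e e₁ e₂) Φ ↔
    wp P env e fun v s => (v = .nil → wp P env e₁ fun w t => Φ w (s + t + 4)) ∧
      (v ≠ .nil → wp P env e₂ fun w t => Φ w (s + t + 4)) := by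
  have h : ∀ s t, s + 2 + 1 + t + 1 = s + t + 4 := by intros; omega
  rw [Code.ifNil, wp_ifLe, wp_isNil]
  refine exists_congr fun v => exists_congr fun s => and_congr_right fun _ => ?_
  by_cases hv : v = .nil <;> simp [hv, h, wp_lit]

end wp

/-! ### Symbolic evaluation -/

/-- What remains to be done with the value of a subterm. -/
inductive Frame : Type
  | addL (env : List Val) (e : Code)
  | addR (x : ℝ)
  | subL (env : List Val) (e : Code)
  | subR (x : ℝ)
  | consL (env : List Val) (e : Code)
  | consR (a : Val)
  | bind (env : List Val) (e : Code)
  | leL (env : List Val) (e e₁ e₂ : Code)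
  | leR (x : ℝ) (env : List Val) (e₁ e₂ : Code)
  | call (f : ℕ)
  | fst
  | snd
  | ifNil (env : List Val) (e₁ e₂ : Code)

/-- The value `v`, obtained after `n` steps, is passed to the continuation `K`, and the final
result satisfies `Φ`. -/
def ret (P : List Code) (Φ : Val → ℕ → Prop) : List Frame → Val → ℕ → Prop
  | [], v, n => Φ v n
  | .addL env e :: K, v, n => ∃ x, v = .num x ∧
      wp P env e fun w m => ∃ y, w = .num y ∧ ret P Φ K (.num (x + y)) (n + m + 1)
  | .addR x :: K, w, n => ∃ y, w = .num y ∧ ret P Φ K (.num (x + y)) (n + 1)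
  | .subL env e :: K, v, n => ∃ x, v = .num x ∧
      wp P env e fun w m => ∃ y, w = .num y ∧ ret P Φ K (.num (x - y)) (n + m + 1)
  | .subR x :: K, w, n => ∃ y, w = .num y ∧ ret P Φ K (.num (x - y)) (n + 1)
  | .consL env e :: K, v, n => wp P env e fun w m => ret P Φ K (.cell v w) (n + m + 1)
  | .consR v :: K, w, n => ret P Φ K (.cell v w) (n + 1)
  | .bind env e :: K, v, n => wp P (v :: env) e fun w m => ret P Φ K w (n + m + 1)
  | .leL env e e₁ e₂ :: K, v, n => ∃ x, v = .num x ∧ wp P env e fun w m => ∃ y, w = .num y ∧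
      (x ≤ y → wp P env e₁ fun v t => ret P Φ K v (n + m + t + 1)) ∧
      (¬ x ≤ y → wp P env e₂ fun v t => ret P Φ K v (n + m + t + 1))
  | .leR x env e₁ e₂ :: K, w, n => ∃ y, w = .num y ∧
      (x ≤ y → wp P env e₁ fun v t => ret P Φ K v (n + t + 1)) ∧
      (¬ x ≤ y → wp P env e₂ fun v t => ret P Φ K v (n + t + 1))
  | .call f :: K, v, n => wpc P f v fun w t => ret P Φ K w (n + t + 1)
  | .fst :: K, v, n => ∃ a b, v = .cell a b ∧ ret P Φ K a (n + 2)
  | .snd :: K, v, n => ∃ a b, v = .cell a b ∧ ret P Φ K b (n + 2)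
  | .ifNil env e₁ e₂ :: K, v, n => (v = .nil → wp P env e₁ fun w t => ret P Φ K w (n + t + 4)) ∧
      (v ≠ .nil → wp P env e₂ fun w t => ret P Φ K w (n + t + 4))

/-- The code `e` is evaluated after `n` steps, its value is passed to the continuation `K`, and the
final result satisfies `Φ`. -/
def ev (P : List Code) (Φ : Val → ℕ → Prop) (env : List Val) (e : Code) (K : List Frame)
    (n : ℕ) : Prop :=
  wp P env e fun v m => ret P Φ K v (n + m)

section ev
variable {P : List Code} {Φ : Val → ℕ → Prop} {env : List Val} {K : List Frame} {n : ℕ}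

/-- Entry point of symbolic evaluation. The rules that follow are tried before subterms are visited,
so simplification executes code in order and halts at function calls, where a `wpc` lemma takes
over. -/
theorem wp_of_ev {e : Code} (h : ev P Φ env e [] 0) : wp P env e Φ := by
  simpa [ev, ret] using h

theorem wpc_of_ev {f : ℕ} {body : Code} {a : Val} (hf : P[f]? = some body)
    (h : ev P Φ [a] body [] 0) : wpc P f a Φ :=
  ⟨body, hf, wp_of_ev h⟩

@[simp ↓] theorem ev_var_zero {a : Val} :
    ev P Φ (a :: env) (.var 0) K n ↔ ret P Φ K a (n + 1) := by
  simp [ev, wp_var]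
@[simp ↓] theorem ev_var_one {a b : Val} :
    ev P Φ (a :: b :: env) (.var 1) K n ↔ ret P Φ K b (n + 1) := by
  simp [ev, wp_var]
@[simp ↓] theorem ev_var_two {a b c : Val} :
    ev P Φ (a :: b :: c :: env) (.var 2) K n ↔ ret P Φ K c (n + 1) := by
  simp [ev, wp_var]
@[simp ↓] theorem ev_nil : ev P Φ env .nil K n ↔ ret P Φ K .nil (n + 1) := wp_nil
@[simp ↓] theorem ev_lit {q : ℚ} : ev P Φ env (.lit q) K n ↔ ret P Φ K (.num (q : ℝ)) (n + 1) :=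
  wp_lit
@[simp ↓] theorem ev_add {e₁ e₂ : Code} :
    ev P Φ env (.add e₁ e₂) K n ↔ ev P Φ env e₁ (.addL env e₂ :: K) n := by
  simp only [ev, wp_add, ret, add_assoc]
@[simp ↓] theorem ev_sub {e₁ e₂ : Code} :
    ev P Φ env (.sub e₁ e₂) K n ↔ ev P Φ env e₁ (.subL env e₂ :: K) n := by
  simp only [ev, wp_sub, ret, add_assoc]
@[simp ↓] theorem ev_cons {e₁ e₂ : Code} :
    ev P Φ env (.cons e₁ e₂) K n ↔ ev P Φ env e₁ (.consL env e₂ :: K) n := by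
  simp only [ev, wp_cons, ret, add_assoc]
@[simp ↓] theorem ev_letIn {e₁ e₂ : Code} :
    ev P Φ env (.letIn e₁ e₂) K n ↔ ev P Φ env e₁ (.bind env e₂ :: K) n := by
  simp only [ev, wp_letIn, ret, add_assoc]
@[simp ↓] theorem ev_ifLe {e₁ e₂ e₃ e₄ : Code} :
    ev P Φ env (.ifLe e₁ e₂ e₃ e₄) K n ↔ ev P Φ env e₁ (.leL env e₂ e₃ e₄ :: K) n := by
  simp only [ev, wp_ifLe, ret, add_assoc]
@[simp ↓] theorem ev_call {f : ℕ} {e : Code} :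
    ev P Φ env (.call f e) K n ↔ ev P Φ env e (.call f :: K) n := by
  simp only [ev, wp_call, ret, add_assoc]
@[simp ↓] theorem ev_fst {e : Code} :
    ev P Φ env (.fst e) K n ↔ ev P Φ env e (.fst :: K) n := by
  simp only [ev, wp_fst, ret, add_assoc]
@[simp ↓] theorem ev_snd {e : Code} :
    ev P Φ env (.snd e) K n ↔ ev P Φ env e (.snd :: K) n := by
  simp only [ev, wp_snd, ret, add_assoc]
@[simp ↓] theorem ev_ifNil {e e₁ e₂ : Code} :
    ev P Φ env (.ifNil e e₁ e₂) K n ↔ ev P Φ env e (.ifNil env e₁ e₂ :: K) n := by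
  simp only [ev, wp_ifNil, ret, add_assoc]

@[simp ↓] theorem ret_empty {v : Val} : ret P Φ [] v n ↔ Φ v n := Iff.rfl
@[simp ↓] theorem ret_addL {x : ℝ} {e : Code} :
    ret P Φ (.addL env e :: K) (.num x) n ↔ ev P Φ env e (.addR x :: K) n := by
  simp [ret, ev]
@[simp ↓] theorem ret_addR {x y : ℝ} :
    ret P Φ (.addR x :: K) (.num y) n ↔ ret P Φ K (.num (x + y)) (n + 1) := by
  simp [ret]
@[simp ↓] theorem ret_subL {x : ℝ} {e : Code} :
    ret P Φ (.subL env e :: K) (.num x) n ↔ ev P Φ env e (.subR x :: K) n := by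
  simp [ret, ev]
@[simp ↓] theorem ret_subR {x y : ℝ} :
    ret P Φ (.subR x :: K) (.num y) n ↔ ret P Φ K (.num (x - y)) (n + 1) := by
  simp [ret]
@[simp ↓] theorem ret_consL {v : Val} {e : Code} :
    ret P Φ (.consL env e :: K) v n ↔ ev P Φ env e (.consR v :: K) n := Iff.rfl
@[simp ↓] theorem ret_consR {v w : Val} :
    ret P Φ (.consR v :: K) w n ↔ ret P Φ K (.cell v w) (n + 1) := Iff.rfl
@[simp ↓] theorem ret_bind {v : Val} {e : Code} :
    ret P Φ (.bind env e :: K) v n ↔ ev P Φ (v :: env) e K (n + 1) := by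
  simp [ret, ev, add_assoc, add_comm, add_left_comm]
@[simp ↓] theorem ret_leL {x : ℝ} {e e₁ e₂ : Code} :
    ret P Φ (.leL env e e₁ e₂ :: K) (.num x) n ↔ ev P Φ env e (.leR x env e₁ e₂ :: K) n := by
  simp [ret, ev]
@[simp ↓] theorem ret_leR {x y : ℝ} {e₁ e₂ : Code} :
    ret P Φ (.leR x env e₁ e₂ :: K) (.num y) n ↔
      (x ≤ y → ev P Φ env e₁ K (n + 1)) ∧ (¬ x ≤ y → ev P Φ env e₂ K (n + 1)) := by
  simp [ret, ev, add_assoc, add_comm, add_left_comm]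
@[simp ↓] theorem ret_call {f : ℕ} {v : Val} :
    ret P Φ (.call f :: K) v n ↔ wpc P f v fun w t => ret P Φ K w (n + t + 1) := Iff.rfl
@[simp ↓] theorem ret_fst {a b : Val} :
    ret P Φ (.fst :: K) (.cell a b) n ↔ ret P Φ K a (n + 2) := by
  simp [ret]
@[simp ↓] theorem ret_snd {a b : Val} :
    ret P Φ (.snd :: K) (.cell a b) n ↔ ret P Φ K b (n + 2) := by
  simp [ret]
theorem ret_ifNil {v : Val} {e₁ e₂ : Code} : ret P Φ (.ifNil env e₁ e₂ :: K) v n ↔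
    (v = .nil → ev P Φ env e₁ K (n + 4)) ∧ (v ≠ .nil → ev P Φ env e₂ K (n + 4)) := by
  simp [ret, ev, add_assoc, add_comm, add_left_comm]
@[simp ↓] theorem ret_ifNil_nil {e₁ e₂ : Code} :
    ret P Φ (.ifNil env e₁ e₂ :: K) .nil n ↔ ev P Φ env e₁ K (n + 4) := by
  simp [ret_ifNil]
@[simp ↓] theorem ret_ifNil_cell {a b : Val} {e₁ e₂ : Code} :
    ret P Φ (.ifNil env e₁ e₂ :: K) (.cell a b) n ↔ ev P Φ env e₂ K (n + 4) := by
  simp [ret_ifNil]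

end ev

/-! ### Lists of reals and truth values -/

/-- Machine representation of a list of reals. -/
def encL (l : List ℝ) : Val := Val.ofList (l.map Val.num)

@[simp] theorem encL_nil : encL [] = .nil := rfl
@[simp] theorem encL_cons (x : ℝ) (l : List ℝ) : encL (x :: l) = .cell (.num x) (encL l) := rfl

open Classical in
/-- Machine representation of a truth value. -/
noncomputable def encB (p : Prop) : Val := if p then .nil else .num 0

@[simp] theorem encB_eq_nil {p : Prop} : encB p = .nil ↔ p := by
  unfold encB; split_ifs with h <;> simp [h]

theorem encB_true {p : Prop} (h : p) : encB p = .nil := if_pos h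
theorem encB_false {p : Prop} (h : ¬ p) : encB p = .num 0 := if_neg h

theorem nil_le_list (b : List ℝ) : [] ≤ b := by
  refine not_lt.1 fun h => ?_
  simp at h

theorem not_cons_le_nil {x : ℝ} {a : List ℝ} : ¬ x :: a ≤ [] := by
  refine not_le.2 ?_
  simp

theorem cons_lt_cons {x y : ℝ} {a b : List ℝ} : x :: a < y :: b ↔ x < y ∨ x = y ∧ a < b :=
  List.cons_lt_cons_iff

theorem cons_le_cons {x y : ℝ} {a b : List ℝ} : x :: a ≤ y :: b ↔ x < y ∨ x = y ∧ a ≤ b := by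
  rw [← not_lt, cons_lt_cons, ← not_lt (b := a)]
  rcases lt_trichotomy x y with h | h | h
  · simp [h, h.ne', h.not_gt]
  · simp [h]
  · simp [h, h.ne', h.not_gt]

@[simp ↓] theorem ret_ifNil_encB {P : List Code} {Φ : Val → ℕ → Prop} {env : List Val}
    {K : List Frame} {n : ℕ} {p : Prop} {e₁ e₂ : Code} :
    ret P Φ (.ifNil env e₁ e₂ :: K) (encB p) n ↔
      (p → ev P Φ env e₁ K (n + 4)) ∧ (¬ p → ev P Φ env e₂ K (n + 4)) := by
  simp [ret_ifNil]

-- Constant-time operations on short lists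

open Code

/-- Lexicographic comparison. -/
def codeLe : Code :=
  ifNil (fst (.var 0)) .nil <| ifNil (snd (.var 0)) (.lit 0) <|
    .ifLe (fst (fst (.var 0))) (fst (snd (.var 0)))
      (.ifLe (fst (snd (.var 0))) (fst (fst (.var 0)))
        (.call 0 (.cons (snd (fst (.var 0))) (snd (snd (.var 0))))) .nil) (.lit 0)

/-- Both lists are consumed in parallel, so the shorter one bounds the time. Keys and values have
length at most eight, and `50 * 8 + 30 ≤ 500`. -/
theorem wpc_le {P : List Code} (hP : P[0]? = some codeLe) {a b : List ℝ} :
    ∀ Φ : Val → ℕ → Prop, a.length ≤ 8 ∨ b.length ≤ 8 →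
    (∀ t ≤ 500, Φ (encB (a ≤ b)) t) → wpc P 0 (.cell (encL a) (encL b)) Φ := by
  suffices h : ∀ (n : ℕ) (a b : List ℝ) (Φ : Val → ℕ → Prop), a.length ≤ n ∨ b.length ≤ n →
      (∀ t ≤ 50 * n + 30, Φ (encB (a ≤ b)) t) → wpc P 0 (.cell (encL a) (encL b)) Φ from
    fun _ hl hΦ => h 8 a b _ hl fun t ht => hΦ t (by omega)
  intro n
  induction n with
  | zero =>
    intro a b Φ hl hΦ
    refine wpc_of_ev hP ?_
    rcases a with _ | ⟨x, a⟩
    · have := encB_true (nil_le_list b)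
      simp [codeLe]
      exact this ▸ hΦ _ (by omega)
    · rcases b with _ | ⟨y, b⟩
      · have := encB_false (p := x :: a ≤ []) not_cons_le_nil
        simp [codeLe]
        exact this ▸ hΦ _ (by omega)
      · simp at hl
  | succ n ih =>
    intro a b Φ hl hΦ
    refine wpc_of_ev hP ?_
    rcases a with _ | ⟨x, a⟩
    · have := encB_true (nil_le_list b)
      simp [codeLe]
      exact this ▸ hΦ _ (by omega)
    · rcases b with _ | ⟨y, b⟩
      · have := encB_false (p := x :: a ≤ []) not_cons_le_nil
        simp [codeLe]
        exact this ▸ hΦ _ (by omega)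
      · simp [codeLe]
        refine ⟨fun h₁ => ⟨fun h₂ => ?_, fun h₂ => ?_⟩, fun h₁ => ?_⟩
        · refine ih _ _ _ (by simpa using hl) fun t ht => ?_
          have : (x :: a ≤ y :: b) = (a ≤ b) := by
            simp [cons_le_cons, le_antisymm h₁ h₂]
          exact this ▸ hΦ _ (by omega)
        · have := encB_true (p := x :: a ≤ y :: b) (cons_le_cons.2 (.inl h₂))
          exact this ▸ hΦ _ (by omega)
        · have := encB_false (p := x :: a ≤ y :: b) (by
            rw [cons_le_cons]; push Not
            exact ⟨h₁.le, fun h => absurd h h₁.ne'⟩)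
          exact this ▸ hΦ _ (by omega)

/-- Concatenation. -/
def codeAppend : Code :=
  ifNil (fst (.var 0)) (snd (.var 0))
    (.cons (fst (fst (.var 0))) (.call 9 (.cons (snd (fst (.var 0))) (snd (.var 0)))))

/-- Only the first list is copied and the second is shared, so no bound on the length of `b` is
needed. -/
theorem wpc_append {P : List Code} (hP : P[9]? = some codeAppend) {a b : List ℝ} :
    ∀ Φ : Val → ℕ → Prop, a.length ≤ 8 →
    (∀ t ≤ 500, Φ (encL (a ++ b)) t) → wpc P 9 (.cell (encL a) (encL b)) Φ := by
  suffices h : ∀ Φ : Val → ℕ → Prop, (∀ t ≤ 50 * a.length + 30, Φ (encL (a ++ b)) t) →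
      wpc P 9 (.cell (encL a) (encL b)) Φ from
    fun _ hl hΦ => h _ fun t ht => hΦ t (by omega)
  induction a with
  | nil =>
    intro Φ hΦ
    refine wpc_of_ev hP ?_
    simp [codeAppend]
    exact hΦ _ (by omega)
  | cons x a ih =>
    intro Φ hΦ
    refine wpc_of_ev hP ?_
    simp [codeAppend]
    exact ih _ fun t ht => hΦ _ (by simp; omega)

/-! ### Balanced search trees -/

/-- An entry of a search tree: a key, a value and a payload. -/
structure Entry (β : Type) : Type where
  key : List ℝ
  val : List ℝ
  pay : β
  key_le : key.length ≤ 8 := by simp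
  val_le : val.length ≤ 8 := by simp

/-- Binary trees with entries at the inner nodes. -/
inductive Tr (β : Type) : Type
  | nil : Tr β
  | node (l : Tr β) (x : Entry β) (r : Tr β) : Tr β

namespace Tr
variable {β : Type}

/-- The height of a tree. -/
def ht : Tr β → ℕ
  | nil => 0
  | node l _ r => max l.ht r.ht + 1

/-- The number of entries. -/
def size : Tr β → ℕ
  | nil => 0
  | node l _ r => l.size + r.size + 1

/-- The entries of a tree. -/
def Mem : Tr β → Entry β → Prop
  | nil, _ => False
  | node l x r, e => l.Mem e ∨ e = x ∨ r.Mem e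

instance : Membership (Entry β) (Tr β) := ⟨Mem⟩

@[simp] theorem not_mem_nil {e : Entry β} : ¬ e ∈ (nil : Tr β) := id
@[simp] theorem mem_node {e x : Entry β} {l r : Tr β} :
    e ∈ node l x r ↔ e ∈ l ∨ e = x ∨ e ∈ r := Iff.rfl

/-- The keys increase from left to right. -/
def Ordered : Tr β → Prop
  | nil => True
  | node l x r => (∀ e ∈ l, e.key < x.key) ∧ (∀ e ∈ r, x.key < e.key) ∧ l.Ordered ∧ r.Ordered

/-- Heights of siblings differ by at most one. -/
def Balanced : Tr β → Prop
  | nil => True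
  | node l _ r => l.ht ≤ r.ht + 1 ∧ r.ht ≤ l.ht + 1 ∧ l.Balanced ∧ r.Balanced

open Classical in
/-- The better (smaller value) of the given entry and the best entry of the tree. -/
noncomputable def best : Tr β → Entry β → Entry β
  | nil, e => e
  | node l x r, e => if e.val ≤ (r.best (l.best x)).val then e else r.best (l.best x)

/-- A tree with the given parts whose heights differ by at most two, rebalanced. -/
def bal (l : Tr β) (x : Entry β) (r : Tr β) : Tr β :=
  if l.ht ≤ r.ht + 1 then
    if r.ht ≤ l.ht + 1 then node l x r
    else match r with
      | nil => node l x r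
      | node rl y rr => if rl.ht ≤ rr.ht then node (node l x rl) y rr
        else match rl with
          | nil => node l x r
          | node rll z rlr => node (node l x rll) z (node rlr y rr)
  else match l with
    | nil => node l x r
    | node ll y lr => if lr.ht ≤ ll.ht then node ll y (node lr x r)
      else match lr with
        | nil => node l x r
        | node lrl z lrr => node (node ll y lrl) z (node lrr x r)

open Classical in
/-- Insertion of an entry, replacing any entry with the same key. -/
noncomputable def ins : Tr β → Entry β → Tr β
  | nil, e => node nil e nil
  | node l x r, e =>
    if e.key ≤ x.key then if x.key ≤ e.key then node l e r else bal (l.ins e) x r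
    else bal l x (r.ins e)

/-- The first entry and the rest of `node l x r`. -/
def pop : Tr β → Entry β → Tr β → Entry β × Tr β
  | nil, x, r => (x, r)
  | node l y m, x, r => ((pop l y m).1, bal (pop l y m).2 x r)

open Classical in
/-- Deletion of the entry with the given key, if there is one. -/
noncomputable def del : Tr β → List ℝ → Tr β
  | nil, _ => nil
  | node l x r, k =>
    if k ≤ x.key then
      if x.key ≤ k then
        match r with
        | nil => l
        | node rl y rr => bal l (pop rl y rr).1 (pop rl y rr).2
      else bal (l.del k) x r
    else bal l x (r.del k)

open Classical in
/-- The entry with the given key. -/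
noncomputable def find : Tr β → List ℝ → Option (Entry β)
  | nil, _ => none
  | node l x r, k =>
    if k ≤ x.key then if x.key ≤ k then some x else l.find k else r.find k

open Classical in
/-- An entry of smallest value among those with a key larger than `b`. -/
noncomputable def query : Tr β → List ℝ → Option (Entry β)
  | nil, _ => none
  | node l x r, b =>
    if x.key ≤ b then r.query b
    else match l.query b with
      | none => some (r.best x)
      | some e => some (if e.val ≤ (r.best x).val then e else r.best x)

-- Correctness of the tree operations

theorem mem_bal {l r : Tr β} {x e : Entry β} : e ∈ bal l x r ↔ e ∈ l ∨ e = x ∨ e ∈ r := by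
  unfold bal
  split_ifs
  · simp
  · rcases r with _ | ⟨rl, y, rr⟩
    · simp
    · dsimp only; split_ifs
      · simp; tauto
      · rcases rl with _ | ⟨rll, z, rlr⟩
        · simp
        · simp; tauto
  · rcases l with _ | ⟨ll, y, lr⟩
    · simp
    · dsimp only; split_ifs
      · simp; tauto
      · rcases lr with _ | ⟨lrl, z, lrr⟩
        · simp
        · simp; tauto

theorem ordered_node {l r : Tr β} {x : Entry β} : (node l x r).Ordered ↔
    (∀ e ∈ l, e.key < x.key) ∧ (∀ e ∈ r, x.key < e.key) ∧ l.Ordered ∧ r.Ordered := Iff.rfl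

theorem ordered_bal {l r : Tr β} {x : Entry β} (h : (node l x r).Ordered) :
    (bal l x r).Ordered := by
  unfold bal
  split_ifs
  · exact h
  · rcases r with _ | ⟨rl, y, rr⟩
    · exact h
    · dsimp only; split_ifs
      · simp only [ordered_node, mem_node] at h ⊢
        grind
      · rcases rl with _ | ⟨rll, z, rlr⟩
        · exact h
        · simp only [ordered_node, mem_node] at h ⊢
          grind
  · rcases l with _ | ⟨ll, y, lr⟩
    · exact h
    · dsimp only; split_ifs
      · simp only [ordered_node, mem_node] at h ⊢
        grind
      · rcases lr with _ | ⟨lrl, z, lrr⟩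
        · exact h
        · simp only [ordered_node, mem_node] at h ⊢
          grind

theorem size_bal {l r : Tr β} {x : Entry β} : (bal l x r).size = l.size + r.size + 1 := by
  unfold bal
  split_ifs
  · rfl
  · rcases r with _ | ⟨rl, y, rr⟩
    · rfl
    · dsimp only; split_ifs
      · simp only [size]; omega
      · rcases rl with _ | ⟨rll, z, rlr⟩
        · rfl
        · simp only [size]; omega
  · rcases l with _ | ⟨ll, y, lr⟩
    · rfl
    · dsimp only; split_ifs
      · simp only [size]; omega
      · rcases lr with _ | ⟨lrl, z, lrr⟩
        · rfl
        · simp only [size]; omega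

/-- A difference of two is the worst that one insertion or deletion below can cause. The height
estimates feed the inductions for `ins`, `pop` and `del`; the exact height in the unrotated case is
needed to see that an unchanged subtree height leaves the height of the whole unchanged. -/
theorem balanced_bal {l r : Tr β} {x : Entry β} (hl : l.Balanced) (hr : r.Balanced)
    (h₁ : l.ht ≤ r.ht + 2) (h₂ : r.ht ≤ l.ht + 2) :
    (bal l x r).Balanced ∧ (bal l x r).ht ≤ max l.ht r.ht + 1 ∧ max l.ht r.ht ≤ (bal l x r).ht ∧
      (l.ht ≤ r.ht + 1 → r.ht ≤ l.ht + 1 → (bal l x r).ht = max l.ht r.ht + 1) := by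
  unfold bal
  split_ifs with c₁ c₂
  · simp only [Balanced, ht]
    exact ⟨⟨c₁, c₂, hl, hr⟩, le_rfl, by omega, by simp⟩
  · rcases r with _ | ⟨rl, y, rr⟩
    · simp only [ht] at c₂; omega
    · dsimp only; split_ifs with c₃
      · simp only [Balanced, ht] at hr c₁ c₂ h₁ h₂ ⊢
        obtain ⟨a, b, c, d⟩ := hr
        refine ⟨⟨?_, ?_, ⟨?_, ?_, hl, c⟩, d⟩, ?_, ?_, ?_⟩ <;> omega
      · rcases rl with _ | ⟨rll, z, rlr⟩
        · simp only [ht] at c₃; omega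
        · simp only [Balanced, ht] at hr c₁ c₂ c₃ h₁ h₂ ⊢
          obtain ⟨a, b, ⟨c, d, e, f⟩, g⟩ := hr
          refine ⟨⟨?_, ?_, ⟨?_, ?_, hl, e⟩, ?_, ?_, f, g⟩, ?_, ?_, ?_⟩ <;> omega
  · rcases l with _ | ⟨ll, y, lr⟩
    · simp only [ht] at c₁; omega
    · dsimp only; split_ifs with c₃
      · simp only [Balanced, ht] at hl c₁ h₁ h₂ ⊢
        obtain ⟨a, b, c, d⟩ := hl
        refine ⟨⟨?_, ?_, c, ?_, ?_, d, hr⟩, ?_, ?_, ?_⟩ <;> omega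
      · rcases lr with _ | ⟨lrl, z, lrr⟩
        · simp only [ht] at c₃; omega
        · simp only [Balanced, ht] at hl c₁ c₃ h₁ h₂ ⊢
          obtain ⟨a, b, c, d, e, f, g⟩ := hl
          refine ⟨⟨?_, ?_, ⟨?_, ?_, c, f⟩, ?_, ?_, g, hr⟩, ?_, ?_, ?_⟩ <;> omega

theorem balanced_ins {t : Tr β} {e : Entry β} (h : t.Balanced) :
    (t.ins e).Balanced ∧ t.ht ≤ (t.ins e).ht ∧ (t.ins e).ht ≤ t.ht + 1 := by
  induction t with
  | nil => simp [ins, Balanced, ht]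
  | node l x r ihl ihr =>
    obtain ⟨a, b, c, d⟩ := h
    obtain ⟨l₁, l₂, l₃⟩ := ihl c
    obtain ⟨r₁, r₂, r₃⟩ := ihr d
    simp only [ins, ht]
    split_ifs
    · exact ⟨⟨a, b, c, d⟩, le_rfl, Nat.le_succ _⟩
    · obtain ⟨h₁, h₂, h₃, h₄⟩ := balanced_bal (x := x) l₁ d (by omega) (by omega)
      exact ⟨h₁, by omega, by omega⟩
    · obtain ⟨h₁, h₂, h₃, h₄⟩ := balanced_bal (x := x) c r₁ (by omega) (by omega)
      exact ⟨h₁, by omega, by omega⟩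

theorem size_ins {t : Tr β} {e : Entry β} : (t.ins e).size ≤ t.size + 1 := by
  induction t with
  | nil => simp [ins, size]
  | node l x r ihl ihr =>
    simp only [ins, size]
    split_ifs
    · simp [size]
    · rw [size_bal]; omega
    · rw [size_bal]; omega

theorem ordered_mem_ins {t : Tr β} {e : Entry β} (h : t.Ordered) :
    (t.ins e).Ordered ∧ ∀ y, y ∈ t.ins e ↔ y = e ∨ (y ∈ t ∧ y.key ≠ e.key) := by
  induction t with
  | nil => simp [ins, Ordered]
  | node l x r ihl ihr =>
    obtain ⟨a, b, c, d⟩ := h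
    obtain ⟨l₁, l₂⟩ := ihl c
    obtain ⟨r₁, r₂⟩ := ihr d
    simp only [ins]
    split_ifs with c₁ c₂
    · have := le_antisymm c₁ c₂
      refine ⟨⟨this ▸ a, this ▸ b, c, d⟩, fun y => ?_⟩
      simp only [mem_node]
      grind
    · refine ⟨ordered_bal ⟨?_, b, l₁, d⟩, fun y => ?_⟩
      · grind
      · rw [mem_bal, l₂, mem_node]; grind
    · refine ⟨ordered_bal ⟨a, ?_, c, r₁⟩, fun y => ?_⟩
      · grind
      · rw [mem_bal, r₂, mem_node]; grind

theorem pop_spec {l : Tr β} {x : Entry β} {r : Tr β} (ho : (node l x r).Ordered)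
    (hb : (node l x r).Balanced) : (pop l x r).2.Ordered ∧ (pop l x r).2.Balanced ∧
      (∀ y, y ∈ node l x r ↔ y = (pop l x r).1 ∨ y ∈ (pop l x r).2) ∧
      (∀ y ∈ (pop l x r).2, (pop l x r).1.key < y.key) ∧
      (pop l x r).2.ht ≤ (node l x r).ht ∧ (node l x r).ht ≤ (pop l x r).2.ht + 1 := by
  induction l generalizing x r with
  | nil =>
    obtain ⟨a, b, c, d⟩ := ho
    obtain ⟨a', b', c', d'⟩ := hb
    simp only [pop]
    refine ⟨d, d', fun y => by simp, b, by simp [ht], by simp [ht]⟩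
  | node l y m ih _ =>
    obtain ⟨a, b, c, d⟩ := ho
    obtain ⟨a', b', c', d'⟩ := hb
    obtain ⟨i₁, i₂, i₃, i₄, i₅, i₆⟩ := ih c c'
    simp only [pop]
    rw [show (node (node l y m) x r).ht = max (node l y m).ht r.ht + 1 from rfl]
    obtain ⟨h₁, h₂, h₃, h₄⟩ := balanced_bal (x := x) i₂ d' (by omega) (by omega)
    refine ⟨ordered_bal ⟨?_, b, i₁, d⟩, h₁, fun z => ?_, ?_, by omega, by omega⟩
    · grind
    · rw [mem_bal, mem_node, i₃]; tauto
    · intro z hz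
      rw [mem_bal] at hz
      have := a _ ((i₃ _).2 (.inl rfl))
      rcases hz with hz | rfl | hz
      · exact i₄ _ hz
      · exact this
      · exact this.trans (b _ hz)

theorem del_spec {t : Tr β} {k : List ℝ} (ho : t.Ordered) (hb : t.Balanced) :
    (t.del k).Ordered ∧ (t.del k).Balanced ∧ (∀ y, y ∈ t.del k ↔ y ∈ t ∧ y.key ≠ k) ∧
      (t.del k).ht ≤ t.ht ∧ t.ht ≤ (t.del k).ht + 1 := by
  induction t with
  | nil => simp [del, Ordered, Balanced]
  | node l x r ihl ihr =>
    obtain ⟨a, b, c, d⟩ := ho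
    obtain ⟨a', b', c', d'⟩ := hb
    obtain ⟨l₁, l₂, l₃, l₄, l₅⟩ := ihl c c'
    obtain ⟨r₁, r₂, r₃, r₄, r₅⟩ := ihr d d'
    rw [show (node l x r).ht = max l.ht r.ht + 1 from rfl]
    simp only [del]
    split_ifs with c₁ c₂
    · obtain rfl := le_antisymm c₁ c₂
      rcases r with _ | ⟨rl, y, rr⟩
      · dsimp only
        simp only [ht] at a' b' ⊢
        refine ⟨c, c', fun y => ?_, by omega, by omega⟩
        simp only [mem_node, not_mem_nil]; grind
      -- With a nonempty right subtree, the deleted root is replaced by its successor, the first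
      -- entry on the right.
      · obtain ⟨i₁, i₂, i₃, i₄, i₅, i₆⟩ := pop_spec d d'
        dsimp only
        obtain ⟨h₁, h₂, h₃, h₄⟩ :=
          balanced_bal (x := (pop rl y rr).1) c' i₂ (by omega) (by omega)
        have key := b _ ((i₃ _).2 (.inl rfl))
        refine ⟨ordered_bal ⟨fun e he => (a e he).trans key, i₄, c, i₁⟩, h₁, fun z => ?_,
          by omega, by omega⟩
        rw [mem_bal, mem_node (r := node rl y rr), i₃]
        constructor
        · rintro (h | h | h)
          · exact ⟨.inl h, (a _ h).ne⟩
          · exact ⟨.inr (.inr (.inl h)), h ▸ key.ne'⟩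
          · exact ⟨.inr (.inr (.inr h)), (key.trans (i₄ _ h)).ne'⟩
        · rintro ⟨h | h | h | h, h'⟩
          · exact .inl h
          · exact absurd (h ▸ rfl) h'
          · exact .inr (.inl h)
          · exact .inr (.inr h)
    · obtain ⟨h₁, h₂, h₃, h₄⟩ := balanced_bal (x := x) l₂ d' (by omega) (by omega)
      refine ⟨ordered_bal ⟨?_, b, l₁, d⟩, h₁, fun z => ?_, by omega, by omega⟩
      · grind
      · rw [mem_bal, l₃, mem_node]; grind
    · obtain ⟨h₁, h₂, h₃, h₄⟩ := balanced_bal (x := x) c' r₂ (by omega) (by omega)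
      refine ⟨ordered_bal ⟨a, ?_, c, r₁⟩, h₁, fun z => ?_, by omega, by omega⟩
      · grind
      · rw [mem_bal, r₃, mem_node]; grind

theorem find_eq_some {t : Tr β} (ho : t.Ordered) {k : List ℝ} {e : Entry β} :
    t.find k = some e ↔ e ∈ t ∧ e.key = k := by
  induction t with
  | nil => simp [find]
  | node l x r ihl ihr =>
    obtain ⟨a, b, c, d⟩ := ho
    simp only [find, mem_node]
    split_ifs with c₁ c₂
    · have := le_antisymm c₁ c₂
      simp only [Option.some.injEq]; grind
    · rw [ihl c]; grind
    · rw [ihr d]; grind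

theorem best_spec (t : Tr β) (e : Entry β) : (t.best e = e ∨ t.best e ∈ t) ∧
    (t.best e).val ≤ e.val ∧ ∀ y ∈ t, (t.best e).val ≤ y.val := by
  induction t generalizing e with
  | nil => simp [best]
  | node l x r ihl ihr =>
    obtain ⟨l₁, l₂, l₃⟩ := ihl x
    obtain ⟨r₁, r₂, r₃⟩ := ihr (l.best x)
    simp only [best, mem_node]
    split_ifs with c
    · refine ⟨.inl rfl, le_rfl, ?_⟩
      rintro y (h | rfl | h)
      · exact c.trans (r₂.trans (l₃ y h))
      · exact c.trans (r₂.trans l₂)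
      · exact c.trans (r₃ y h)
    · refine ⟨.inr ?_, (not_le.1 c).le, ?_⟩
      · rcases r₁ with h | h
        · rw [h]; tauto
        · exact .inr (.inr h)
      · rintro y (h | rfl | h)
        · exact r₂.trans (l₃ y h)
        · exact r₂.trans l₂
        · exact r₃ y h

/-- If the key at the root exceeds `b`, the whole right subtree is eligible and its best entry is
consulted without recursion. Thus the search follows a single path. -/
theorem query_spec {t : Tr β} (ho : t.Ordered) (b : List ℝ) :
    (t.query b = none → ∀ y ∈ t, y.key ≤ b) ∧
    ∀ e, t.query b = some e → e ∈ t ∧ b < e.key ∧ ∀ y ∈ t, b < y.key → e.val ≤ y.val := by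
  induction t with
  | nil => simp [query]
  | node l x r ihl ihr =>
    obtain ⟨a₁, a₂, a₃, a₄⟩ := ho
    obtain ⟨l₁, l₂⟩ := ihl a₃
    obtain ⟨r₁, r₂⟩ := ihr a₄
    simp only [query, mem_node]
    split_ifs with c
    · constructor
      · intro h; have := r₁ h; grind
      · intro e he; have := r₂ e he; grind
    · obtain ⟨b₁, b₂, b₃⟩ := r.best_spec x
      cases hq : l.query b with
      | none =>
        have := l₁ hq
        refine ⟨by simp, fun e he => ?_⟩
        obtain rfl := Option.some.inj he
        refine ⟨by tauto, ?_, ?_⟩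
        · rcases b₁ with h | h
          · rw [h]; exact not_le.1 c
          · exact (not_le.1 c).trans (a₂ _ h)
        · rintro y (h | rfl | h) hy
          · exact absurd hy (this y h).not_gt
          · exact b₂
          · exact b₃ y h
      | some q =>
        obtain ⟨q₁, q₂, q₃⟩ := l₂ q hq
        refine ⟨by simp, fun e he => ?_⟩
        obtain rfl := Option.some.inj he
        split_ifs with c'
        · refine ⟨.inl q₁, q₂, ?_⟩
          rintro y (h | rfl | h) hy
          · exact q₃ y h hy
          · exact c'.trans b₂
          · exact c'.trans (b₃ y h)
        · refine ⟨by tauto, ?_, ?_⟩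
          · rcases b₁ with h | h
            · rw [h]; exact not_le.1 c
            · exact (not_le.1 c).trans (a₂ _ h)
          · rintro y (h | rfl | h) hy
            · exact (not_le.1 c').le.trans (q₃ y h hy)
            · exact b₂
            · exact b₃ y h

theorem two_pow_ht_le {t : Tr β} (h : t.Balanced) : 2 ^ t.ht ≤ (t.size + 1) ^ 2 := by
  induction t with
  | nil => simp [ht, size]
  | node l x r ihl ihr =>
    obtain ⟨a, b, c, d⟩ := h
    have hl := ihl c
    have hr := ihr d
    simp only [ht, size]
    -- Put `X = 2 ^ p`, `Y = 2 ^ q`, `a = u + 1`, `b = v + 1`. From `Y ≤ X` follows `Y ^ 2 ≤ a ^ 2 *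
    -- b ^ 2`, so `Y ≤ a * b`, and `(a + b) ^ 2` is at least `X + 3 * Y`, which is at least `2 * X`
    -- because `X ≤ 2 * Y`. This replaces the Fibonacci estimate.
    have key : ∀ u v p q : ℕ, p ≤ q + 1 → q ≤ p → 2 ^ p ≤ (u + 1) ^ 2 → 2 ^ q ≤ (v + 1) ^ 2 →
        2 ^ (p + 1) ≤ (u + v + 1 + 1) ^ 2 := by
      intro u v p q h₁ h₂ h₃ h₄
      rw [pow_succ]
      have h₅ : 2 ^ p ≤ 2 * 2 ^ q := by
        rw [mul_comm, ← pow_succ]; exact Nat.pow_le_pow_right (by norm_num) h₁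
      have h₆ : 2 ^ q ≤ 2 ^ p := Nat.pow_le_pow_right (by norm_num) h₂
      generalize 2 ^ p = X at *
      generalize 2 ^ q = Y at *
      have h₇ : Y ≤ (u + 1) * (v + 1) := by
        by_contra! h
        have : ((u + 1) * (v + 1)) ^ 2 < Y ^ 2 := Nat.pow_lt_pow_left h (by norm_num)
        nlinarith [Nat.mul_le_mul h₃ h₄]
      nlinarith
    rcases le_total l.ht r.ht with h | h
    · rw [max_eq_right h, add_comm l.size]
      exact key _ _ _ _ b h hr hl
    · rw [max_eq_left h]
      exact key _ _ _ _ a h hl hr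

theorem ht_le {t : Tr β} (h : t.Balanced) : t.ht ≤ 2 * Nat.log 2 (t.size + 1) + 1 := by
  have h₁ := two_pow_ht_le h
  have h₂ : t.size + 1 < 2 ^ (Nat.log 2 (t.size + 1) + 1) := Nat.lt_pow_succ_log_self (by norm_num) _
  have h₃ : 2 ^ t.ht < 2 ^ ((Nat.log 2 (t.size + 1) + 1) * 2) := by
    rw [pow_mul]; exact h₁.trans_lt (Nat.pow_lt_pow_left h₂ (by norm_num))
  have := (Nat.pow_lt_pow_iff_right (by norm_num)).1 h₃
  omega

open Classical in
/-- The set of keys. -/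
noncomputable def keys : Tr β → Finset (List ℝ)
  | nil => ∅
  | node l x r => insert x.key (l.keys ∪ r.keys)

theorem mem_keys {t : Tr β} {k : List ℝ} : k ∈ t.keys ↔ ∃ e ∈ t, e.key = k := by
  induction t with
  | nil => simp [keys]
  | node l x r ihl ihr => simp only [keys, Finset.mem_insert, Finset.mem_union, ihl, ihr, mem_node]; grind

theorem card_keys {t : Tr β} (h : t.Ordered) : t.keys.card = t.size := by
  induction t with
  | nil => simp [keys, size]
  | node l x r ihl ihr =>
    obtain ⟨a₁, a₂, a₃, a₄⟩ := h
    rw [keys, Finset.card_insert_of_notMem, Finset.card_union_of_disjoint, ihl a₃, ihr a₄, size]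
    · rw [Finset.disjoint_left]
      simp only [mem_keys]
      rintro k ⟨e, he, rfl⟩ ⟨f, hf, h⟩
      exact ((a₁ e he).trans (a₂ f hf)).ne' h
    · simp only [Finset.mem_union, mem_keys]
      rintro (⟨e, he, h⟩ | ⟨e, he, h⟩)
      · exact (a₁ e he).ne h
      · exact (a₂ e he).ne' h

/-- Keys of an ordered tree are distinct, so the size is the number of keys; injectivity of `f` is
not required. -/
theorem size_le_of_keys {t : Tr β} (h : t.Ordered) {α : Type} (X : Finset α) (f : α → List ℝ)
    (hX : ∀ e ∈ t, ∃ a ∈ X, f a = e.key) : t.size ≤ X.card := by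
  classical
  rw [← card_keys h]
  refine (Finset.card_le_card (t := X.image f) fun k hk => ?_).trans Finset.card_image_le
  obtain ⟨e, he, rfl⟩ := mem_keys.1 hk
  simpa using hX e he

end Tr

/-! ### Programs for search trees -/

/-- The value of an entry. -/
@[simp ↓] def Code.eval (e : Code) : Code := fst (snd e)
/-- The payload of an entry. -/
@[simp ↓] def Code.pay (e : Code) : Code := snd (snd e)
/-- The best entry of a nonempty tree. -/
@[simp ↓] def Code.topBest (e : Code) : Code := fst (snd e)
/-- The entry at the root of a nonempty tree. -/
@[simp ↓] def Code.top (e : Code) : Code := fst (snd (snd e))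
/-- The left subtree of a nonempty tree. -/
@[simp ↓] def Code.left (e : Code) : Code := fst (snd (snd (snd e)))
/-- The right subtree of a nonempty tree. -/
@[simp ↓] def Code.right (e : Code) : Code := snd (snd (snd (snd e)))
/-- A triple. -/
@[simp ↓] def Code.triple (a b c : Code) : Code := .cons a (.cons b c)
/-- Call of the function that computes heights. -/
@[simp ↓] def Code.height (e : Code) : Code := .call 10 e
/-- Call of the function that makes a node. -/
@[simp ↓] def Code.mk (a b c : Code) : Code := .call 2 (triple a b c)
/-- Call of the function that makes a node and rebalances. -/
@[simp ↓] def Code.bal (a b c : Code) : Code := .call 3 (triple a b c)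
/-- Call of the function that compares lists. -/
@[simp ↓] def Code.le (a b : Code) : Code := .call 0 (.cons a b)

/-- Height of a tree. -/
def codeHeight : Code := ifNil (.var 0) (.lit 0) (fst (.var 0))

/-- The better of an entry and the best entry of a tree. -/
def codeBest : Code :=
  ifNil (snd (.var 0)) (fst (.var 0)) <|
    ifNil (le (eval (fst (.var 0))) (eval (topBest (snd (.var 0)))))
      (fst (.var 0)) (topBest (snd (.var 0)))

/-- A node with given parts. -/
def codeMk : Code :=
  let l := fst (.var 0)
  let x := fst (snd (.var 0))
  let r := snd (snd (.var 0))
  .cons (.ifLe (height l) (height r) (.add (height r) (.lit 1)) (.add (height l) (.lit 1)))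
    (.cons (.call 1 (.cons (.call 1 (.cons x l)) r)) (triple x l r))

/-- Rebalancing. -/
def codeBal : Code :=
  let l := fst (.var 0)
  let x := fst (snd (.var 0))
  let r := snd (snd (.var 0))
  .ifLe (height l) (.add (height r) (.lit 1))
    (.ifLe (height r) (.add (height l) (.lit 1)) (mk l x r)
      (.ifLe (height (left r)) (height (right r)) (mk (mk l x (left r)) (top r) (right r))
        (mk (mk l x (left (left r))) (top (left r)) (mk (right (left r)) (top r) (right r)))))
    (.ifLe (height (right l)) (height (left l)) (mk (left l) (top l) (mk (right l) x r))
      (mk (mk (left l) (top l) (left (right l))) (top (right l)) (mk (right (right l)) x r)))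

/-- Insertion of an entry. -/
def codeIns : Code :=
  let t := fst (.var 0)
  let e := snd (.var 0)
  ifNil t (mk .nil e .nil) <|
    ifNil (le (fst e) (fst (top t)))
      (ifNil (le (fst (top t)) (fst e)) (mk (left t) e (right t))
        (bal (.call 4 (.cons (left t) e)) (top t) (right t)))
      (bal (left t) (top t) (.call 4 (.cons (right t) e)))

/-- First entry and rest of a nonempty tree. -/
def codePop : Code :=
  let t : Code := .var 0
  ifNil (left t) (.cons (top t) (right t)) <|
    .letIn (.call 5 (left t))
      (.cons (fst (.var 0)) (bal (snd (.var 0)) (top (.var 1)) (right (.var 1))))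

/-- Deletion of the entry with a given key. -/
def codeDel : Code :=
  let t := fst (.var 0)
  let k := snd (.var 0)
  ifNil t .nil <|
    ifNil (le k (fst (top t)))
      (ifNil (le (fst (top t)) k)
        (ifNil (right t) (left t)
          (.letIn (.call 5 (right t)) (bal (left (fst (.var 1))) (fst (.var 0)) (snd (.var 0)))))
        (bal (.call 6 (.cons (left t) k)) (top t) (right t)))
      (bal (left t) (top t) (.call 6 (.cons (right t) k)))

/-- The entry with a given key. -/
def codeFind : Code :=
  let t := fst (.var 0)
  let k := snd (.var 0)
  ifNil t .nil <|
    ifNil (le k (fst (top t)))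
      (ifNil (le (fst (top t)) k) (top t) (.call 7 (.cons (left t) k)))
      (.call 7 (.cons (right t) k))

/-- The best entry whose key exceeds a given bound. -/
def codeQuery : Code :=
  let t := fst (.var 0)
  let b := snd (.var 0)
  ifNil t .nil <|
    ifNil (le (fst (top t)) b) (.call 8 (.cons (right t) b))
      (.letIn (.call 8 (.cons (left t) b))
        (.letIn (.call 1 (.cons (top (fst (.var 1))) (right (fst (.var 1)))))
          (ifNil (.var 1) (.var 0)
            (ifNil (le (eval (.var 1)) (eval (.var 0))) (.var 1) (.var 0)))))

/-- The functions on lists and trees. -/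
def treeFuns : List Code :=
  [codeLe, codeBest, codeMk, codeBal, codeIns, codePop, codeDel, codeFind, codeQuery, codeAppend,
    codeHeight]

/-- Functions are called by index. Every timing lemma is proved for all programs that extend a fixed
list, so the functions of a concrete problem can be appended later. -/
theorem getElem?_of_prefix {P Q : List Code} (h : Q <+: P) {i : ℕ} {c : Code}
    (hc : Q[i]? = some c) : P[i]? = some c := by
  obtain ⟨R, rfl⟩ := h
  rw [List.getElem?_append_left (List.getElem?_eq_some_iff.1 hc).1, hc]

variable {β : Type} (encP : β → Val)

/-- Machine representation of an entry. -/
def encE (e : Entry β) : Val := .cell (encL e.key) (.cell (encL e.val) (encP e.pay))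

/-- Machine representation of an optional entry. -/
def encO : Option (Entry β) → Val
  | none => .nil
  | some e => encE encP e

/-- Machine representation of a tree; every node stores its height and its best entry. -/
noncomputable def encT : Tr β → Val
  | .nil => .nil
  | .node l x r => .cell (.num ((Tr.node l x r).ht : ℝ))
      (.cell (encE encP (r.best (l.best x))) (.cell (encE encP x) (.cell (encT l) (encT r))))

@[simp] theorem encT_nil : encT encP .nil = .nil := rfl
@[simp] theorem encT_node (l : Tr β) (x : Entry β) (r : Tr β) : encT encP (.node l x r) =
    .cell (.num ((Tr.node l x r).ht : ℝ)) (.cell (encE encP (r.best (l.best x)))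
      (.cell (encE encP x) (.cell (encT encP l) (encT encP r)))) := rfl
@[simp] theorem encO_none : encO encP none = .nil := rfl
@[simp] theorem encO_some (e : Entry β) : encO encP (some e) = encE encP e := rfl

section
variable {P : List Code} {Φ : Val → ℕ → Prop} {env : List Val} {K : List Frame} {n : ℕ}

@[simp ↓] theorem ret_fst_encE {x : Entry β} :
    ret P Φ (.fst :: K) (encE encP x) n ↔ ret P Φ K (encL x.key) (n + 2) := ret_fst
@[simp ↓] theorem ret_snd_encE {x : Entry β} : ret P Φ (.snd :: K) (encE encP x) n ↔
    ret P Φ K (.cell (encL x.val) (encP x.pay)) (n + 2) := ret_snd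
@[simp ↓] theorem ret_ifNil_encE {x : Entry β} {e₁ e₂ : Code} :
    ret P Φ (.ifNil env e₁ e₂ :: K) (encE encP x) n ↔ ev P Φ env e₂ K (n + 4) := ret_ifNil_cell

end

-- Running times of the tree programs

section
variable {P : List Code} (hP : treeFuns <+: P)
include hP

/-- As in the timing lemmas below, the postcondition is arbitrary and has to hold for all times up
to a bound. In this form the lemma applies directly to the goal left by symbolic evaluation, and
exact step counts need not be known. -/
theorem wpc_height {t : Tr β} {Φ : Val → ℕ → Prop} (h : ∀ s ≤ 10, Φ (.num (t.ht : ℝ)) s) :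
    wpc P 10 (encT encP t) Φ := by
  refine wpc_of_ev (getElem?_of_prefix hP (i := 10) rfl) ?_
  cases t with
  | nil => simp [codeHeight]; simpa [Tr.ht] using h 6 (by norm_num)
  | node l x r => simp [codeHeight]; exact h _ (by norm_num)

theorem wpc_leKey {x : Entry β} {k : List ℝ} {Φ : Val → ℕ → Prop}
    (h : ∀ s ≤ 500, Φ (encB (x.key ≤ k)) s) : wpc P 0 (.cell (encL x.key) (encL k)) Φ :=
  wpc_le (getElem?_of_prefix hP (i := 0) rfl) _ (.inl x.key_le) h

theorem wpc_leKey' {x : Entry β} {k : List ℝ} {Φ : Val → ℕ → Prop}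
    (h : ∀ s ≤ 500, Φ (encB (k ≤ x.key)) s) : wpc P 0 (.cell (encL k) (encL x.key)) Φ :=
  wpc_le (getElem?_of_prefix hP (i := 0) rfl) _ (.inr x.key_le) h

theorem wpc_leVal {x : Entry β} {k : List ℝ} {Φ : Val → ℕ → Prop}
    (h : ∀ s ≤ 500, Φ (encB (x.val ≤ k)) s) : wpc P 0 (.cell (encL x.val) (encL k)) Φ :=
  wpc_le (getElem?_of_prefix hP (i := 0) rfl) _ (.inl x.val_le) h

/-- Constant time, because the root of a nonempty tree stores the best entry. -/
theorem wpc_best {t : Tr β} {x : Entry β} {Φ : Val → ℕ → Prop}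
    (h : ∀ s ≤ 600, Φ (encE encP (t.best x)) s) :
    wpc P 1 (.cell (encE encP x) (encT encP t)) Φ := by
  refine wpc_of_ev (getElem?_of_prefix hP (i := 1) rfl) ?_
  cases t with
  | nil => simp [codeBest]; exact h _ (by norm_num)
  | node l y r =>
    simp [codeBest]
    refine wpc_leVal hP fun s hs => ?_
    simp only [Tr.best] at h
    simp
    refine ⟨fun h' => ?_, fun h' => ?_⟩
    · rw [if_pos h'] at h; exact h _ (by omega)
    · rw [if_neg (not_le.2 h')] at h; exact h _ (by omega)

theorem wpc_mk {l r : Tr β} {x : Entry β} {Φ : Val → ℕ → Prop}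
    (h : ∀ s ≤ 2000, Φ (encT encP (.node l x r)) s) :
    wpc P 2 (.cell (encT encP l) (.cell (encE encP x) (encT encP r))) Φ := by
  refine wpc_of_ev (getElem?_of_prefix hP (i := 2) rfl) ?_
  simp [codeMk]
  refine wpc_height encP hP fun s₁ h₁ => ?_
  simp
  refine wpc_height encP hP fun s₂ h₂ => ?_
  simp
  refine ⟨fun hle => ?_, fun hle => ?_⟩
  · refine wpc_height encP hP fun s₃ h₃ => ?_
    simp
    refine wpc_best encP hP fun s₄ h₄ => ?_
    refine wpc_best encP hP fun s₅ h₅ => ?_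
    have : ((Tr.node l x r).ht : ℝ) = r.ht + 1 := by
      rw [Tr.ht, max_eq_right (by exact_mod_cast hle)]; simp
    rw [encT_node, this] at h
    exact h _ (by omega)
  · refine wpc_height encP hP fun s₃ h₃ => ?_
    simp
    refine wpc_best encP hP fun s₄ h₄ => ?_
    refine wpc_best encP hP fun s₅ h₅ => ?_
    have : ((Tr.node l x r).ht : ℝ) = l.ht + 1 := by
      rw [Tr.ht, max_eq_left (by exact_mod_cast hle.le)]; simp
    rw [encT_node, this] at h
    exact h _ (by omega)

theorem wpc_bal {l r : Tr β} {x : Entry β} {Φ : Val → ℕ → Prop}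
    (h : ∀ s ≤ 10000, Φ (encT encP (Tr.bal l x r)) s) :
    wpc P 3 (.cell (encT encP l) (.cell (encE encP x) (encT encP r))) Φ := by
  refine wpc_of_ev (getElem?_of_prefix hP (i := 3) rfl) ?_
  simp only [Tr.bal] at h
  simp [codeBal]
  refine wpc_height encP hP fun s₁ h₁ => ?_
  simp
  refine wpc_height encP hP fun s₂ h₂ => ?_
  simp
  refine ⟨fun c₁ => ?_, fun c₁ => ?_⟩
  · rw [if_pos (by exact_mod_cast c₁)] at h
    refine wpc_height encP hP fun s₃ h₃ => ?_
    simp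
    refine wpc_height encP hP fun s₄ h₄ => ?_
    simp
    refine ⟨fun c₂ => ?_, fun c₂ => ?_⟩
    · rw [if_pos (by exact_mod_cast c₂)] at h
      exact wpc_mk encP hP fun s₅ h₅ => h _ (by omega)
    · have c₂' : l.ht + 1 < r.ht := by exact_mod_cast c₂
      rw [if_neg (not_le.2 c₂')] at h
      rcases r with _ | ⟨rl, y, rr⟩
      · simp [Tr.ht] at c₂'
      simp
      refine wpc_height encP hP fun s₅ h₅ => ?_
      simp
      refine wpc_height encP hP fun s₆ h₆ => ?_
      simp
      dsimp only at h
      refine ⟨fun c₃ => ?_, fun c₃ => ?_⟩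
      · rw [if_pos c₃] at h
        refine wpc_mk encP hP fun s₇ h₇ => ?_
        exact wpc_mk encP hP fun s₈ h₈ => h _ (by omega)
      · rw [if_neg (not_le.2 c₃)] at h
        rcases rl with _ | ⟨rll, z, rlr⟩
        · simp [Tr.ht] at c₃
        simp
        refine wpc_mk encP hP fun s₇ h₇ => ?_
        simp
        refine wpc_mk encP hP fun s₈ h₈ => ?_
        exact wpc_mk encP hP (l := .node l x rll) fun s₉ h₉ => h _ (by omega)
  · have c₁' : r.ht + 1 < l.ht := by exact_mod_cast c₁
    rw [if_neg (not_le.2 c₁')] at h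
    rcases l with _ | ⟨ll, y, lr⟩
    · simp [Tr.ht] at c₁'
    simp
    refine wpc_height encP hP fun s₅ h₅ => ?_
    simp
    refine wpc_height encP hP fun s₆ h₆ => ?_
    simp
    dsimp only at h
    refine ⟨fun c₃ => ?_, fun c₃ => ?_⟩
    · rw [if_pos c₃] at h
      refine wpc_mk encP hP fun s₇ h₇ => ?_
      exact wpc_mk encP hP fun s₈ h₈ => h _ (by omega)
    · rw [if_neg (not_le.2 c₃)] at h
      rcases lr with _ | ⟨lrl, z, lrr⟩
      · simp [Tr.ht] at c₃
      simp
      refine wpc_mk encP hP fun s₇ h₇ => ?_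
      simp
      refine wpc_mk encP hP fun s₈ h₈ => ?_
      exact wpc_mk encP hP (l := .node ll y lrl) fun s₉ h₉ => h _ (by omega)

theorem wpc_ins {t : Tr β} {e : Entry β} {Φ : Val → ℕ → Prop}
    (h : ∀ s ≤ 20000 * (t.ht + 1), Φ (encT encP (t.ins e)) s) :
    wpc P 4 (.cell (encT encP t) (encE encP e)) Φ := by
  induction t generalizing Φ with
  | nil =>
    refine wpc_of_ev (getElem?_of_prefix hP (i := 4) rfl) ?_
    simp [codeIns]
    exact wpc_mk encP hP (l := .nil) (r := .nil) fun s hs => h _ (by omega)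
  | node l x r ihl ihr =>
    refine wpc_of_ev (getElem?_of_prefix hP (i := 4) rfl) ?_
    have hl := le_max_left l.ht r.ht
    have hr := le_max_right l.ht r.ht
    simp only [Tr.ins, Tr.ht] at h
    simp [codeIns]
    refine wpc_leKey hP fun s₁ h₁ => ?_
    simp only [ret_ifNil_encB]
    refine ⟨fun c₁ => ?_, fun c₁ => ?_⟩
    · rw [if_pos c₁] at h
      simp
      refine wpc_leKey hP fun s₂ h₂ => ?_
      simp only [ret_ifNil_encB]
      refine ⟨fun c₂ => ?_, fun c₂ => ?_⟩
      · rw [if_pos c₂] at h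
        simp
        exact wpc_mk encP hP fun s₃ h₃ => h _ (by omega)
      · rw [if_neg c₂] at h
        simp
        refine ihl fun s₃ h₃ => ?_
        exact wpc_bal encP hP fun s₄ h₄ => h _ (by omega)
    · rw [if_neg c₁] at h
      simp
      refine ihr fun s₃ h₃ => ?_
      exact wpc_bal encP hP fun s₄ h₄ => h _ (by omega)

theorem wpc_pop {l r : Tr β} {x : Entry β} {Φ : Val → ℕ → Prop}
    (h : ∀ s ≤ 20000 * (l.ht + 1),
      Φ (.cell (encE encP (Tr.pop l x r).1) (encT encP (Tr.pop l x r).2)) s) :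
    wpc P 5 (encT encP (.node l x r)) Φ := by
  induction l generalizing Φ x r with
  | nil =>
    refine wpc_of_ev (getElem?_of_prefix hP (i := 5) rfl) ?_
    simp [codePop]
    exact h _ (by omega)
  | node l y m ihl ihr =>
    refine wpc_of_ev (getElem?_of_prefix hP (i := 5) rfl) ?_
    have hl := le_max_left l.ht m.ht
    simp only [Tr.pop, Tr.ht] at h
    simp [codePop]
    refine ihl fun s₁ h₁ => ?_
    simp
    exact wpc_bal encP hP fun s₄ h₄ => by simpa using h _ (by omega)

theorem wpc_del {t : Tr β} {k : List ℝ} {Φ : Val → ℕ → Prop}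
    (h : ∀ s ≤ 20000 * (t.ht + 2), Φ (encT encP (t.del k)) s) :
    wpc P 6 (.cell (encT encP t) (encL k)) Φ := by
  induction t generalizing Φ with
  | nil =>
    refine wpc_of_ev (getElem?_of_prefix hP (i := 6) rfl) ?_
    simp [codeDel]
    exact h _ (by omega)
  | node l x r ihl ihr =>
    refine wpc_of_ev (getElem?_of_prefix hP (i := 6) rfl) ?_
    have hl := le_max_left l.ht r.ht
    have hr := le_max_right l.ht r.ht
    simp only [Tr.del, Tr.ht] at h
    simp [codeDel]
    refine wpc_leKey' hP fun s₁ h₁ => ?_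
    simp only [ret_ifNil_encB]
    refine ⟨fun c₁ => ?_, fun c₁ => ?_⟩
    · rw [if_pos c₁] at h
      simp
      refine wpc_leKey hP fun s₂ h₂ => ?_
      simp only [ret_ifNil_encB]
      refine ⟨fun c₂ => ?_, fun c₂ => ?_⟩
      · rw [if_pos c₂] at h
        rcases r with _ | ⟨rl, y, rr⟩
        · simp
          exact h _ (by omega)
        · have := le_max_left rl.ht rr.ht
          simp only [Tr.ht] at hr h
          simp
          refine wpc_pop encP hP fun s₃ h₃ => ?_
          simp
          exact wpc_bal encP hP fun s₄ h₄ => h _ (by omega)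
      · rw [if_neg c₂] at h
        simp
        refine ihl fun s₃ h₃ => ?_
        exact wpc_bal encP hP fun s₄ h₄ => h _ (by omega)
    · rw [if_neg c₁] at h
      simp
      refine ihr fun s₃ h₃ => ?_
      exact wpc_bal encP hP fun s₄ h₄ => h _ (by omega)

theorem wpc_find {t : Tr β} {k : List ℝ} {Φ : Val → ℕ → Prop}
    (h : ∀ s ≤ 2000 * (t.ht + 1), Φ (encO encP (t.find k)) s) :
    wpc P 7 (.cell (encT encP t) (encL k)) Φ := by
  induction t generalizing Φ with
  | nil =>
    refine wpc_of_ev (getElem?_of_prefix hP (i := 7) rfl) ?_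
    simp [codeFind]
    exact h _ (by omega)
  | node l x r ihl ihr =>
    refine wpc_of_ev (getElem?_of_prefix hP (i := 7) rfl) ?_
    have hl := le_max_left l.ht r.ht
    have hr := le_max_right l.ht r.ht
    simp only [Tr.find, Tr.ht] at h
    simp [codeFind]
    refine wpc_leKey' hP fun s₁ h₁ => ?_
    simp only [ret_ifNil_encB]
    refine ⟨fun c₁ => ?_, fun c₁ => ?_⟩
    · rw [if_pos c₁] at h
      simp
      refine wpc_leKey hP fun s₂ h₂ => ?_
      simp only [ret_ifNil_encB]
      refine ⟨fun c₂ => ?_, fun c₂ => ?_⟩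
      · rw [if_pos c₂] at h
        simp
        exact h _ (by omega)
      · rw [if_neg c₂] at h
        simp
        exact ihl fun s₃ h₃ => h _ (by omega)
    · rw [if_neg c₁] at h
      simp
      exact ihr fun s₃ h₃ => h _ (by omega)

theorem wpc_query {t : Tr β} {b : List ℝ} {Φ : Val → ℕ → Prop}
    (h : ∀ s ≤ 4000 * (t.ht + 1), Φ (encO encP (t.query b)) s) :
    wpc P 8 (.cell (encT encP t) (encL b)) Φ := by
  induction t generalizing Φ with
  | nil =>
    refine wpc_of_ev (getElem?_of_prefix hP (i := 8) rfl) ?_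
    simp [codeQuery]
    exact h _ (by omega)
  | node l x r ihl ihr =>
    refine wpc_of_ev (getElem?_of_prefix hP (i := 8) rfl) ?_
    have hl := le_max_left l.ht r.ht
    have hr := le_max_right l.ht r.ht
    simp only [Tr.query, Tr.ht] at h
    simp [codeQuery]
    refine wpc_leKey hP fun s₁ h₁ => ?_
    simp only [ret_ifNil_encB]
    refine ⟨fun c₁ => ?_, fun c₁ => ?_⟩
    · rw [if_pos c₁] at h
      simp
      exact ihr fun s₃ h₃ => h _ (by omega)
    · rw [if_neg c₁] at h
      simp
      refine ihl fun s₂ h₂ => ?_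
      refine wpc_best encP hP fun s₃ h₃ => ?_
      cases hq : l.query b with
      | none =>
        simp [hq] at h ⊢
        exact h _ (by omega)
      | some q =>
        simp [hq] at h ⊢
        refine wpc_leVal hP fun s₄ h₄ => ?_
        simp only [ret_ifNil_encB]
        refine ⟨fun c₂ => ?_, fun c₂ => ?_⟩
        · rw [if_pos c₂] at h
          simp
          exact h _ (by omega)
        · rw [if_neg c₂] at h
          simp
          exact h _ (by omega)

end

/-! ### Elements, probes and records -/

/-- A dynamic element is covered by the records `(g, c, h)` with `g = grp`, `± x ≤ c` and `y ≤ h`,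
for one of its probes. -/
structure Probe : Type where
  pos : Bool
  grp : List ℝ
  y : ℝ
  grp_le : grp.length ≤ 4 := by simp

/-- The signed value of a position. -/
def Probe.sgn (p : Probe) (x : ℝ) : ℝ := if p.pos then x else -x

/-- The description of a dynamic element. -/
structure Elem : Type where
  cell : List ℝ
  x : ℝ
  id : List ℝ
  probes : List Probe
  len_le : cell.length + id.length ≤ 6 := by simp
  probes_le : probes.length ≤ 4 := by simp

/-- A static element occurs in up to sixteen records. -/
structure Rec : Type where
  grp : List ℝ
  c : ℝ
  h : ℝ
  a : Point
  grp_le : grp.length ≤ 4 := by simp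

/-- The probe `p` of an element at position `x` finds the record `r`. -/
def Probe.Hits (p : Probe) (x : ℝ) (r : Rec) : Prop :=
  r.grp = p.grp ∧ p.sgn x ≤ r.c ∧ p.y ≤ r.h

/-- The record as an entry of a tree in the order of `h`. -/
def Rec.entryH (r : Rec) : Entry (ℝ × Point) where
  key := r.grp ++ [r.h, r.a.1, r.a.2]
  val := r.grp ++ [-r.c]
  pay := (r.c, r.a)
  key_le := by have := r.grp_le; simp; omega
  val_le := by have := r.grp_le; simp; omega

/-- The record as an entry of a tree in the order of `c`. -/
def Rec.entryC (r : Rec) : Entry (ℝ × Point) where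
  key := r.grp ++ [r.c, r.a.1, r.a.2]
  val := r.grp ++ [-r.h]
  pay := (r.c, r.a)
  key_le := by have := r.grp_le; simp; omega
  val_le := by have := r.grp_le; simp; omega

/-- Machine representation of the payload of a record. -/
def encR (p : ℝ × Point) : Val := .cell (.num p.1) (encodePoint p.2)

/-- Machine representation of a probe. -/
def encProbe (p : Probe) : Val :=
  .cell (.num (if p.pos then 1 else -1)) (.cell (encL p.grp) (.num p.y))

/-- Machine representation of a list of probes. -/
def encProbes (l : List Probe) : Val := Val.ofList (l.map encProbe)

@[simp] theorem encProbes_nil : encProbes [] = .nil := rfl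
@[simp] theorem encProbes_cons (p : Probe) (l : List Probe) :
    encProbes (p :: l) = .cell (encProbe p) (encProbes l) := rfl

/-- Machine representation of an element. -/
def encElem (e : Elem) : Val :=
  .cell (encL e.cell) (.cell (.num e.x) (.cell (encL e.id) (encProbes e.probes)))

/-- The state of a scan over the probes: the interval, and a record that was found. -/
structure Scan : Type where
  lo : ℝ
  hi : ℝ
  found : Option Point

/-- Machine representation of an optional point. -/
def encOP : Option Point → Val
  | none => .nil
  | some a => encodePoint a

/-- Machine representation of the state of a scan. -/
def encScan (s : Scan) : Val := .cell (.num s.lo) (.cell (.num s.hi) (encOP s.found))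

open Classical in
/-- The effect of one probe on the scan. -/
noncomputable def scanStep (G : Tr (ℝ × Point)) (x : ℝ) (s : Scan) (p : Probe) : Scan :=
  match G.query (p.grp ++ [p.y]) with
  | none => s
  | some e =>
    if e.val ≤ p.grp ++ [-p.sgn x] then
      if p.pos then ⟨s.lo, max s.hi e.pay.1, some e.pay.2⟩
      else ⟨min s.lo (-e.pay.1), s.hi, some e.pay.2⟩
    else s

/-- The interval of positions that serve the element, and some point that covers it. -/
noncomputable def scan (G : Tr (ℝ × Point)) (e : Elem) : Scan :=
  e.probes.foldl (scanStep G e.x) ⟨e.x, e.x, none⟩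

/-- What is stored with a coverable element. -/
structure Stab : Type where
  bound : List ℝ
  hi : ℝ
  probes : List Probe

/-- Machine representation of a payload of the interval tree. -/
def encStab (s : Stab) : Val := .cell (encL s.bound) (.cell (.num s.hi) (encProbes s.probes))

/-- The entry of a coverable element in the interval tree. -/
noncomputable def stabEntry (G : Tr (ℝ × Point)) (e : Elem) : Entry Stab where
  key := e.cell ++ (scan G e).lo :: 0 :: e.id
  val := e.cell ++ [(scan G e).hi]
  pay := ⟨e.cell ++ [(scan G e).hi, 1], (scan G e).hi, e.probes⟩
  key_le := by have := e.len_le; simp; omega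
  val_le := by have := e.len_le; simp; omega

/-- The entry of an element that cannot be covered. -/
def badEntry (e : Elem) : Entry Unit where
  key := e.id
  val := []
  pay := ()
  key_le := by have := e.len_le; omega

/-- Machine representation of an empty payload. -/
def encU (_ : Unit) : Val := .nil

/-- Machine representation of a multiplicity. -/
def encN (n : ℕ) : Val := .num (n : ℝ)

/-! ### Multisets of points -/

/-- The key of a point. -/
def ptKey (a : Point) : List ℝ := [a.1, a.2]

theorem ptKey_injective : Function.Injective ptKey := by
  rintro ⟨a, b⟩ ⟨c, d⟩ h; simpa [ptKey] using h

open Classical in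
/-- The tree `t` stores the multiplicities of the points in the list `l`. -/
structure Counts (t : Tr ℕ) (l : List Point) : Prop where
  ordered : t.Ordered
  balanced : t.Balanced
  size_le : t.size ≤ l.length
  count : ∀ a, ((t.find (ptKey a)).elim 0 fun e => e.pay) = l.count a

theorem Counts.nil : Counts .nil [] := by
  constructor <;> simp [Tr.Ordered, Tr.Balanced, Tr.size, Tr.find]

theorem Counts.ht_le {t : Tr ℕ} {l : List Point} (h : Counts t l) :
    t.ht ≤ 2 * Nat.log 2 (l.length + 1) + 1 := by
  have h₁ := Tr.ht_le h.balanced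
  have h₂ := Nat.log_mono_right (b := 2) (Nat.succ_le_succ h.size_le)
  simp only [Nat.succ_eq_add_one] at h₂
  omega

/-- The entry for one more copy of a point. -/
noncomputable def countEntry (t : Tr ℕ) (a : Point) : Entry ℕ where
  key := ptKey a
  val := []
  pay := ((t.find (ptKey a)).elim 0 fun e => e.pay) + 1
  key_le := by simp [ptKey]

theorem Counts.cons {t : Tr ℕ} {l : List Point} (h : Counts t l) (a : Point) :
    Counts (t.ins (countEntry t a)) (a :: l) := by
  obtain ⟨h₁, h₂⟩ := Tr.ordered_mem_ins (e := countEntry t a) h.ordered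
  refine ⟨h₁, (Tr.balanced_ins h.balanced).1, ?_, fun b => ?_⟩
  · have := Tr.size_ins (t := t) (e := countEntry t a)
    have := h.size_le
    simp; omega
  · by_cases hb : b = a
    · subst hb
      have : (t.ins (countEntry t b)).find (ptKey b) = some (countEntry t b) :=
        (Tr.find_eq_some h₁).2 ⟨(h₂ _).2 (.inl rfl), rfl⟩
      rw [this, List.count_cons_self, ← h.count]
      rfl
    · have key : ptKey b ≠ ptKey a := fun h => hb (ptKey_injective h)
      have : (t.ins (countEntry t a)).find (ptKey b) = t.find (ptKey b) := by
        refine Option.ext fun e => ?_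
        rw [Tr.find_eq_some h₁, Tr.find_eq_some h.ordered, h₂]
        constructor
        · rintro ⟨rfl | h, h'⟩
          · exact absurd h'.symm key
          · exact ⟨h.1, h'⟩
        · rintro ⟨h, h'⟩
          exact ⟨.inr ⟨h, h' ▸ key⟩, h'⟩
      rw [this, h.count, List.count_cons_of_ne (Ne.symm hb)]

/-- Machine representation of a multiset. -/
noncomputable def encM (l : List Point) (t : Tr ℕ) : Val :=
  .cell (.num (l.length : ℝ)) (.cell (Val.ofList (l.map encodePoint)) (encT encN t))

/-! ### Programs -/

/-- The key of a point. -/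
@[simp ↓] def Code.key (a : Code) : Code := .cons (fst a) (.cons (snd a) .nil)

/-- One more copy of a point. -/
def codePush : Code :=
  .letIn (key (snd (.var 0)))
    (.cons (.add (fst (fst (.var 1))) (.lit 1))
      (.cons (.cons (snd (.var 1)) (fst (snd (fst (.var 1)))))
        (.call 4 (.cons (snd (snd (fst (.var 1))))
          (triple (.var 0) .nil
            (.letIn (.call 7 (.cons (snd (snd (fst (.var 1)))) (.var 0)))
              (ifNil (.var 0) (.lit 1) (.add (pay (.var 0)) (.lit 1)))))))))

/-- Scan over a list of probes. -/
def codeScan : Code :=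
  let ps := fst (.var 0)
  let ctx := fst (snd (.var 0))
  let acc := snd (snd (.var 0))
  ifNil ps acc (.call 12 (triple (snd ps) ctx (.call 13 (triple (fst ps) ctx acc))))

/-- One step of the scan. -/
def codeScanStep : Code :=
  let sg := fst (fst (.var 1))
  let grp := fst (snd (fst (.var 1)))
  let x := snd (fst (snd (.var 1)))
  let acc := snd (snd (.var 1))
  let c := fst (pay (.var 0))
  .letIn (.call 8 (.cons (fst (fst (snd (.var 0))))
      (.call 9 (.cons (fst (snd (fst (.var 0)))) (.cons (snd (snd (fst (.var 0)))) .nil)))))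
    (ifNil (.var 0) acc
      (ifNil (le (eval (.var 0)) (.call 9 (.cons grp
          (.cons (.ifLe sg (.lit 0) x (.sub (.lit 0) x)) .nil))))
        (.ifLe sg (.lit 0)
          (triple (.ifLe (fst acc) (.sub (.lit 0) c) (fst acc) (.sub (.lit 0) c))
            (fst (snd acc)) (snd (pay (.var 0))))
          (triple (fst acc) (.ifLe (fst (snd acc)) c c (fst (snd acc))) (snd (pay (.var 0)))))
        acc))

/-- Addition of the best records for a position. -/
def codeStab : Code :=
  let p := fst (fst (.var 0))
  let v := snd (fst (snd (.var 0)))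
  ifNil (fst (.var 0)) (snd (snd (.var 0)))
    (.letIn (.call 8 (.cons (fst (fst (snd (.var 0))))
        (.call 9 (.cons (fst (snd p))
          (.cons (.call 22 (.cons p v)) .nil)))))
      (.call 14 (triple (snd (fst (.var 1))) (fst (snd (.var 1)))
        (ifNil (.var 0) (snd (snd (.var 1)))
          (.call 11 (.cons (snd (snd (.var 1))) (snd (pay (.var 0)))))))))

/-- Greedy stabbing. -/
def codeGreedy : Code :=
  let T := fst (.var 1)
  let G := fst (snd (.var 1))
  let M := fst (snd (snd (snd (.var 1))))
  let s := snd (snd (snd (snd (.var 1))))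
  .letIn (.call 8 (.cons (fst (.var 0)) (fst (snd (snd (.var 0))))))
    (ifNil (.var 0) (.cons M s)
      (.call 15 (.cons T (triple G (fst (pay (.var 0)))
        (.cons (.call 14 (triple (snd (snd (pay (.var 0))))
          (.cons G (fst (snd (pay (.var 0))))) M)) (.add s (.lit 1)))))))

/-- A covering point (or `nil`) and the entry of an element. -/
def codeEntry : Code :=
  let e := snd (.var 1)
  let lo := fst (.var 0)
  let hi := fst (snd (.var 0))
  let a := snd (snd (.var 0))
  .letIn (.call 12 (triple (snd (snd (snd (snd (.var 0)))))
      (.cons (fst (.var 0)) (fst (snd (snd (.var 0)))))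
      (triple (fst (snd (snd (.var 0)))) (fst (snd (snd (.var 0)))) .nil)))
    (ifNil a (.cons .nil (triple (fst (snd (snd e))) .nil .nil))
      (.cons a (triple (.call 9 (.cons (fst e) (triple lo (.lit 0) (fst (snd (snd e))))))
        (.call 9 (.cons (fst e) (.cons hi .nil)))
        (triple (.call 9 (.cons (fst e) (triple hi (.lit 1) .nil))) hi (snd (snd (snd e)))))))

/-- The static part of a state. -/
@[simp ↓] def Code.stStatic (s : Code) : Code := fst s
/-- The interval tree of a state. -/
@[simp ↓] def Code.stTree (s : Code) : Code := fst (snd s)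
/-- The tree of the elements that cannot be covered. -/
@[simp ↓] def Code.stBad (s : Code) : Code := fst (snd (snd s))
/-- The stored multiset. -/
@[simp ↓] def Code.stSol (s : Code) : Code := fst (snd (snd (snd s)))
/-- The counter of a state. -/
@[simp ↓] def Code.stCount (s : Code) : Code := snd (snd (snd (snd s)))
/-- A state. -/
@[simp ↓] def Code.state (S T B M c : Code) : Code := .cons S (triple T B (.cons M c))

/-- Insertion of an element into a state. -/
def codeInsElem : Code :=
  let s := fst (.var 1)
  .letIn (.call 16 (.cons (fst (fst (stStatic (fst (.var 0)))))
      (.call 23 (.cons (stStatic (fst (.var 0))) (snd (.var 0))))))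
    (ifNil (fst (.var 0))
      (state (stStatic s) (stTree s) (.call 4 (.cons (stBad s) (snd (.var 0)))) (stSol s)
        (stCount s))
      (state (stStatic s) (.call 4 (.cons (stTree s) (snd (.var 0)))) (stBad s)
        (.call 11 (.cons (stSol s) (fst (.var 0)))) (stCount s)))

/-- Deletion of an element from a state. -/
def codeDelElem : Code :=
  let s := fst (.var 1)
  .letIn (.call 16 (.cons (fst (fst (stStatic (fst (.var 0)))))
      (.call 23 (.cons (stStatic (fst (.var 0))) (snd (.var 0))))))
    (ifNil (fst (.var 0))
      (state (stStatic s) (stTree s) (.call 6 (.cons (stBad s) (fst (snd (.var 0))))) (stSol s)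
        (stCount s))
      (state (stStatic s) (.call 6 (.cons (stTree s) (fst (snd (.var 0))))) (stBad s)
        (stSol s) (stCount s)))

/-- Computation of a new solution. -/
def codeRebuild : Code :=
  .letIn (.call 15 (.cons (stTree (.var 0)) (triple (snd (fst (stStatic (.var 0)))) .nil
      (.cons (triple (.lit 0) .nil .nil) (.lit 0)))))
    (.cons (stStatic (.var 1)) (triple (stTree (.var 1)) (stBad (.var 1)) (.var 0)))

/-- The `f`-th function, when it folds the `g`-th function over a list. -/
def codeFold (f g : ℕ) : Code :=
  ifNil (fst (.var 0)) (snd (.var 0))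
    (.call f (.cons (snd (fst (.var 0))) (.call g (.cons (snd (.var 0)) (fst (fst (.var 0)))))))

/-- Addition of a record to the two static trees. -/
def codeAddRec : Code :=
  let grp := fst (fst (.var 0))
  let c := fst (snd (fst (.var 0)))
  let h := snd (snd (fst (.var 0)))
  let a := fst (snd (.var 0))
  let G₁ := fst (snd (snd (.var 0)))
  let G₂ := snd (snd (snd (.var 0)))
  .cons
    (.call 4 (.cons G₁ (triple (.call 9 (.cons grp (.cons h (key a))))
      (.call 9 (.cons grp (.cons (.sub (.lit 0) c) .nil))) (.cons c a))))
    (.call 4 (.cons G₂ (triple (.call 9 (.cons grp (.cons c (key a))))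
      (.call 9 (.cons grp (.cons (.sub (.lit 0) h) .nil))) (.cons c a))))

/-- The signed value of a position. -/
def codeSigned : Code :=
  .ifLe (fst (fst (.var 0))) (.lit 0) (.sub (.lit 0) (snd (.var 0))) (snd (.var 0))

/-- The functions shared by all data structures. -/
def coreFuns : List Code := treeFuns ++
  [codePush, codeScan, codeScanStep, codeStab, codeGreedy, codeEntry, codeInsElem, codeDelElem,
    codeRebuild, codeFold 20 17, codeAddRec, codeSigned]

-- Running times of scanning, stabbing and updating

theorem treeFuns_prefix {P : List Code} (hP : coreFuns <+: P) : treeFuns <+: P :=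
  (List.prefix_append _ _).trans hP

@[simp ↓] theorem ret_snd_encProbe {P : List Code} {Φ : Val → ℕ → Prop} {K : List Frame} {n : ℕ}
    {p : Probe} : ret P Φ (.snd :: K) (encProbe p) n ↔
      ret P Φ K (.cell (encL p.grp) (.num p.y)) (n + 2) := ret_snd

section
variable {P : List Code} (hP : coreFuns <+: P)
include hP

theorem wpc_push {l : List Point} {t : Tr ℕ} {a : Point} {Φ : Val → ℕ → Prop} (hc : Counts t l)
    (h : ∀ s ≤ 30000 * (t.ht + 1), ∀ t', Counts t' (a :: l) → Φ (encM (a :: l) t') s) :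
    wpc P 11 (.cell (encM l t) (encodePoint a)) Φ := by
  refine wpc_of_ev (getElem?_of_prefix hP (i := 11) rfl) ?_
  replace h := fun s hs => h s hs _ (hc.cons a)
  simp [encM] at h
  simp [codePush, encM, encodePoint]
  refine wpc_find encN (treeFuns_prefix hP) (k := ptKey a) fun s₁ h₁ => ?_
  cases hf : t.find (ptKey a) with
  | none =>
    have he : encE encN (countEntry t a) = .cell (.cell (.num a.1) (.cell (.num a.2) .nil))
      (.cell .nil (.num 1)) := by rw [encE, countEntry, hf]; simp [encN, ptKey]
    simp
    rw [← he]
    exact wpc_ins encN (treeFuns_prefix hP) fun s₂ h₂ => h _ (by omega)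
  | some e =>
    have he : encE encN (countEntry t a) = .cell (.cell (.num a.1) (.cell (.num a.2) .nil))
      (.cell .nil (.num (e.pay + 1))) := by rw [encE, countEntry, hf]; simp [encN, ptKey]
    simp
    simp only [encN]
    simp
    rw [← he]
    exact wpc_ins encN (treeFuns_prefix hP) fun s₂ h₂ => h _ (by omega)

theorem wpc_scanStep {G : Tr (ℝ × Point)} {x : ℝ} {s : Scan} {p : Probe} {Φ : Val → ℕ → Prop}
    (h : ∀ t ≤ 6000 * (G.ht + 1), Φ (encScan (scanStep G x s p)) t) :
    wpc P 13 (.cell (encProbe p) (.cell (.cell (encT encR G) (.num x)) (encScan s))) Φ := by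
  refine wpc_of_ev (getElem?_of_prefix hP (i := 13) rfl) ?_
  have hp := p.grp_le
  simp [codeScanStep, encProbe]
  refine wpc_append (getElem?_of_prefix hP (i := 9) rfl) (b := [p.y]) _ (by omega) fun t₁ h₁ => ?_
  refine wpc_query encR (treeFuns_prefix hP) fun t₂ h₂ => ?_
  simp only [scanStep] at h
  cases hq : G.query (p.grp ++ [p.y]) with
  | none =>
    simp [hq] at h ⊢
    exact h _ (by omega)
  | some e =>
    simp only [hq] at h
    cases hs : p.pos with
    | true =>
      simp
      simp only [hs, Probe.sgn, if_true] at h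
      refine wpc_append (getElem?_of_prefix hP (i := 9) rfl) (b := [-x]) _ (by omega)
        fun t₃ h₃ => ?_
      refine wpc_leVal (treeFuns_prefix hP) fun t₄ h₄ => ?_
      simp only [ret_ifNil_encB]
      refine ⟨fun hle => ?_, fun hle => ?_⟩
      · rw [if_pos hle] at h
        simp [encScan, encR, encOP] at h ⊢
        refine ⟨fun hc => ?_, fun hc => ?_⟩
        · rw [max_eq_right hc] at h; exact h _ (by omega)
        · rw [max_eq_left hc.le] at h; exact h _ (by omega)
      · rw [if_neg hle] at h
        simp
        exact h _ (by omega)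
    | false =>
      simp
      simp only [hs, Probe.sgn, Bool.false_eq_true, if_false, neg_neg] at h
      refine wpc_append (getElem?_of_prefix hP (i := 9) rfl) (b := [x]) _ (by omega)
        fun t₃ h₃ => ?_
      refine wpc_leVal (treeFuns_prefix hP) fun t₄ h₄ => ?_
      simp only [ret_ifNil_encB]
      refine ⟨fun hle => ?_, fun hle => ?_⟩
      · rw [if_pos hle] at h
        simp [encScan, encR, encOP] at h ⊢
        refine ⟨fun hc => ?_, fun hc => ?_⟩
        · rw [min_eq_left hc] at h; exact h _ (by omega)
        · rw [min_eq_right hc.le] at h; exact h _ (by omega)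
      · rw [if_neg hle] at h
        simp
        exact h _ (by omega)

theorem wpc_scan {G : Tr (ℝ × Point)} {x : ℝ} {s : Scan} {l : List Probe} {Φ : Val → ℕ → Prop}
    (h : ∀ t ≤ 7000 * (l.length + 1) * (G.ht + 1), Φ (encScan (l.foldl (scanStep G x) s)) t) :
    wpc P 12 (.cell (encProbes l) (.cell (.cell (encT encR G) (.num x)) (encScan s))) Φ := by
  induction l generalizing s Φ with
  | nil =>
    refine wpc_of_ev (getElem?_of_prefix hP (i := 12) rfl) ?_
    simp [codeScan]
    exact h _ (by simp; omega)
  | cons p l ih =>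
    refine wpc_of_ev (getElem?_of_prefix hP (i := 12) rfl) ?_
    simp [codeScan]
    refine wpc_scanStep hP fun t₁ h₁ => ih fun t₂ h₂ => h _ ?_
    rw [List.length_cons]
    have : 7000 * (l.length + 1 + 1) * (G.ht + 1) =
      7000 * (l.length + 1) * (G.ht + 1) + 7000 * (G.ht + 1) := by ring
    omega

/-- The points that serve the position `v` for the given probes. -/
noncomputable def stabPoints (G : Tr (ℝ × Point)) (v : ℝ) (l : List Probe) : List Point :=
  l.filterMap fun p => (G.query (p.grp ++ [p.sgn v])).map fun e => e.pay.2

theorem wpc_signed {p : Probe} {v : ℝ} {Φ : Val → ℕ → Prop}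
    (h : ∀ t ≤ 20, Φ (.num (p.sgn v)) t) : wpc P 22 (.cell (encProbe p) (.num v)) Φ := by
  refine wpc_of_ev (getElem?_of_prefix hP (i := 22) rfl) ?_
  unfold Probe.sgn at h
  simp [codeSigned, encProbe]
  cases hs : p.pos with
  | true =>
    rw [hs] at h
    norm_num
    exact h _ (by omega)
  | false =>
    rw [hs] at h
    norm_num
    exact h _ (by omega)

/-- The single number `h` bounds the heights of all trees that occur: the static one, and the tree
of multiplicities, to which each probe adds at most one point. -/
theorem wpc_stab {G : Tr (ℝ × Point)} {v : ℝ} {l : List Probe} {m : List Point} {t : Tr ℕ}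
    {h : ℕ} (hG : G.ht ≤ h) (hc : Counts t m)
    (hh : 2 * Nat.log 2 (m.length + l.length + 1) + 1 ≤ h) {Φ : Val → ℕ → Prop}
    (hΦ : ∀ s ≤ 40000 * (l.length + 1) * (h + 1), ∀ t',
      Counts t' ((stabPoints G v l).reverse ++ m) →
        Φ (encM ((stabPoints G v l).reverse ++ m) t') s) :
    wpc P 14 (.cell (encProbes l) (.cell (.cell (encT encR G) (.num v)) (encM m t))) Φ := by
  induction l generalizing m t Φ with
  | nil =>
    refine wpc_of_ev (getElem?_of_prefix hP (i := 14) rfl) ?_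
    simp [codeStab]
    exact hΦ _ (by simp; omega) t hc
  | cons p l ih =>
    refine wpc_of_ev (getElem?_of_prefix hP (i := 14) rfl) ?_
    have hp := p.grp_le
    have hl : 40000 * ((p :: l).length + 1) * (h + 1) =
        40000 * (l.length + 1) * (h + 1) + 40000 * (h + 1) := by rw [List.length_cons]; ring
    have hm : t.ht ≤ h := by
      have := hc.ht_le
      have := Nat.log_mono_right (b := 2) (show m.length + 1 ≤ m.length + (p :: l).length + 1 by omega)
      omega
    have hh' : 2 * Nat.log 2 (m.length + l.length + 1) + 1 ≤ h := by
      have := Nat.log_mono_right (b := 2)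
        (show m.length + l.length + 1 ≤ m.length + (p :: l).length + 1 by simp)
      omega
    simp [codeStab]
    refine wpc_signed hP fun t₁ h₁ => ?_
    refine wpc_append (getElem?_of_prefix hP (i := 9) rfl) (b := [p.sgn v]) _ (by omega)
      fun t₂ h₂ => ?_
    refine wpc_query encR (treeFuns_prefix hP) fun t₃ h₃ => ?_
    cases hq : G.query (p.grp ++ [p.sgn v]) with
    | none =>
      have hsp : stabPoints G v (p :: l) = stabPoints G v l := by simp [stabPoints, hq]
      rw [hsp] at hΦ
      simp
      exact ih hc hh' fun s₁ h₁ t' ht' => hΦ _ (by omega) t' ht'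
    | some e =>
      have hsp : stabPoints G v (p :: l) = e.pay.2 :: stabPoints G v l := by
        simp [stabPoints, hq]
      rw [hsp, List.reverse_cons, List.append_assoc, List.singleton_append] at hΦ
      simp [encR]
      refine wpc_push hP hc fun s₁ h₁ t₁ ht₁ => ?_
      refine ih ht₁ (by convert hh using 4; simp; omega) fun s₂ h₂ t₂ ht₂ => hΦ _ ?_ t₂ ht₂
      have := Nat.mul_le_mul_left 30000 (Nat.succ_le_succ hm)
      simp only [Nat.succ_eq_add_one] at this
      omega

end

/-- The entries `es` chosen by the greedy algorithm, starting from the bound `b`. -/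
inductive GreedyRun (T : Tr Stab) : List ℝ → List (Entry Stab) → Prop
  | done {b : List ℝ} (h : T.query b = none) : GreedyRun T b []
  | step {b : List ℝ} {e : Entry Stab} {es : List (Entry Stab)} (h : T.query b = some e)
      (hes : GreedyRun T e.pay.bound es) : GreedyRun T b (e :: es)

/-- The points added to `m` by the greedy algorithm. -/
noncomputable def greedyPoints (G : Tr (ℝ × Point)) (es : List (Entry Stab)) (m : List Point) :
    List Point :=
  es.foldl (fun m e => (stabPoints G e.pay.hi e.pay.probes).reverse ++ m) m

/-- The dynamic part of a state. -/
structure St : Type where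
  T : Tr Stab
  bad : Tr Unit
  m : List Point
  t : Tr ℕ
  cnt : ℝ

/-- The static part of a state. -/
structure Static : Type where
  G₁ : Tr (ℝ × Point)
  G₂ : Tr (ℝ × Point)
  aux : Val

/-- Machine representation of the static part of a state. -/
noncomputable def encStatic (S : Static) : Val :=
  .cell (.cell (encT encR S.G₁) (encT encR S.G₂)) S.aux

/-- Machine representation of a state. -/
noncomputable def encSt (S : Static) (s : St) : Val :=
  .cell (encStatic S) (.cell (encT encStab s.T) (.cell (encT encU s.bad)
    (.cell (encM s.m s.t) (.num s.cnt))))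

/-- Machine representation of a covering point and the entry of an element. -/
noncomputable def encEntry (G : Tr (ℝ × Point)) (e : Elem) : Val :=
  match (scan G e).found with
  | none => .cell .nil (encE encU (badEntry e))
  | some a => .cell (encodePoint a) (encE encStab (stabEntry G e))

theorem length_stabPoints (G : Tr (ℝ × Point)) (v : ℝ) (l : List Probe) :
    (stabPoints G v l).length ≤ l.length := List.length_filterMap_le _ _

@[simp ↓] theorem ret_ifNil_encodePoint {P : List Code} {Φ : Val → ℕ → Prop} {env : List Val}
    {K : List Frame} {n : ℕ} {a : Point} {e₁ e₂ : Code} :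
    ret P Φ (.ifNil env e₁ e₂ :: K) (encodePoint a) n ↔ ev P Φ env e₂ K (n + 4) := ret_ifNil_cell

section
variable {P : List Code} (hP : coreFuns <+: P)
include hP

open Classical in
-- The fuel `k` bounds the number of keys beyond `b`. A chosen entry lies beyond the old bound but
-- not beyond its own, so this number drops in every step. The time is proportional to the number of
-- chosen entries and not to the size of `T`, on which the amortization rests.
theorem wpc_greedy {T : Tr Stab} {G : Tr (ℝ × Point)} {h : ℕ} (hT : T.ht ≤ h) (hG : G.ht ≤ h)
    (hoT : T.Ordered) (hbound : ∀ e ∈ T, e.key ≤ e.pay.bound ∧ e.pay.probes.length ≤ 4)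
    (k : ℕ) {b : List ℝ} (hk : (T.keys.filter (b < ·)).card ≤ k)
    {m : List Point} {t : Tr ℕ} (hc : Counts t m)
    (hh : 2 * Nat.log 2 (m.length + 4 * k + 1) + 1 ≤ h) {c : ℝ} {Φ : Val → ℕ → Prop}
    (hΦ : ∀ es, GreedyRun T b es → ∀ s ≤ 300000 * (es.length + 1) * (h + 1), ∀ t',
      Counts t' (greedyPoints G es m) →
        Φ (.cell (encM (greedyPoints G es m) t') (.num (c + es.length))) s) :
    wpc P 15 (.cell (encT encStab T) (.cell (encT encR G) (.cell (encL b)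
      (.cell (encM m t) (.num c))))) Φ := by
  induction k generalizing b m t c Φ with
  | zero =>
    refine wpc_of_ev (getElem?_of_prefix hP (i := 15) rfl) ?_
    simp [codeGreedy]
    refine wpc_query encStab (treeFuns_prefix hP) fun s₁ h₁ => ?_
    have hq : T.query b = none := by
      by_contra hne
      obtain ⟨e, he⟩ := Option.ne_none_iff_exists'.1 hne
      obtain ⟨h₁, h₂, -⟩ := (Tr.query_spec hoT b).2 e he
      have : e.key ∈ T.keys.filter (b < ·) := by
        rw [Finset.mem_filter, Tr.mem_keys]; exact ⟨⟨e, h₁, rfl⟩, h₂⟩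
      have := Finset.card_pos.2 ⟨_, this⟩
      omega
    rw [hq]
    simp
    simpa [greedyPoints] using hΦ [] (.done hq) _ (by simp; omega) t hc
  | succ k ih =>
    refine wpc_of_ev (getElem?_of_prefix hP (i := 15) rfl) ?_
    simp [codeGreedy]
    refine wpc_query encStab (treeFuns_prefix hP) fun s₁ h₁ => ?_
    cases hq : T.query b with
    | none =>
      simp
      simpa [greedyPoints] using hΦ [] (.done hq) _ (by simp; omega) t hc
    | some e =>
      obtain ⟨h₂, h₃, -⟩ := (Tr.query_spec hoT b).2 e hq
      obtain ⟨h₄, h₅⟩ := hbound e h₂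
      simp [encStab]
      refine wpc_stab hP hG hc ?_ fun s₂ hs₂ t₂ ht₂ => ?_
      · have := Nat.log_mono_right (b := 2)
          (show m.length + e.pay.probes.length + 1 ≤ m.length + 4 * (k + 1) + 1 by omega)
        omega
      refine ih ?_ ht₂ ?_ fun es hes s₃ hs₃ t₃ ht₃ => ?_
      · have hsub : T.keys.filter (e.pay.bound < ·) ⊂ T.keys.filter (b < ·) := by
          refine Finset.ssubset_iff_subset_ne.2 ⟨?_, fun heq => ?_⟩
          · exact Finset.monotone_filter_right _ fun x _ hx => (h₃.trans_le h₄).trans hx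
          · have : e.key ∈ T.keys.filter (b < ·) := by
              rw [Finset.mem_filter, Tr.mem_keys]; exact ⟨⟨e, h₂, rfl⟩, h₃⟩
            rw [← heq, Finset.mem_filter] at this
            exact this.2.not_ge h₄
        have := Finset.card_lt_card hsub
        omega
      · have := length_stabPoints G e.pay.hi e.pay.probes
        have := Nat.log_mono_right (b := 2)
          (show ((stabPoints G e.pay.hi e.pay.probes).reverse ++ m).length + 4 * k + 1 ≤
            m.length + 4 * (k + 1) + 1 by simp; omega)
        omega
      · have hcast : c + 1 + (es.length : ℝ) = c + ((e :: es).length : ℕ) := by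
          rw [List.length_cons]; push_cast; ring
        rw [hcast]
        refine hΦ (e :: es) (.step hq hes) _ ?_ t₃ ht₃
        have e₁ : 300000 * ((e :: es).length + 1) * (h + 1) =
          300000 * (es.length + 1) * (h + 1) + 300000 * (h + 1) := by
            rw [List.length_cons]; ring
        have e₂ : 40000 * (e.pay.probes.length + 1) * (h + 1) ≤ 40000 * 5 * (h + 1) :=
          Nat.mul_le_mul_right _ (by omega)
        omega

theorem wpc_entry {G : Tr (ℝ × Point)} {e : Elem} {Φ : Val → ℕ → Prop}
    (h : ∀ s ≤ 40000 * (G.ht + 1), Φ (encEntry G e) s) :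
    wpc P 16 (.cell (encT encR G) (encElem e)) Φ := by
  refine wpc_of_ev (getElem?_of_prefix hP (i := 16) rfl) ?_
  have hp := e.probes_le
  have hl := e.len_le
  simp [codeEntry, encElem]
  refine wpc_scan hP (s := ⟨e.x, e.x, none⟩) fun s₁ h₁ => ?_
  -- At most four probes, hence `7000 * 5`.
  have h₁' : s₁ ≤ 35000 * (G.ht + 1) := h₁.trans (Nat.mul_le_mul_right _ (by omega))
  rw [show List.foldl (scanStep G e.x) ⟨e.x, e.x, none⟩ e.probes = scan G e from rfl]
  simp [encScan]
  unfold encEntry at h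
  cases hf : (scan G e).found with
  | none =>
    simp [hf, encOP] at h ⊢
    exact h _ (by omega)
  | some a =>
    simp [hf, encOP] at h ⊢
    refine wpc_append (getElem?_of_prefix hP (i := 9) rfl) (b := (scan G e).lo :: 0 :: e.id) _
      (by omega) fun s₂ h₂ => ?_
    refine wpc_append (getElem?_of_prefix hP (i := 9) rfl) (b := [(scan G e).hi]) _
      (by omega) fun s₃ h₃ => ?_
    refine wpc_append (getElem?_of_prefix hP (i := 9) rfl) (b := [(scan G e).hi, 1]) _
      (by omega) fun s₄ h₄ => ?_
    exact h _ (by omega)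

/-- The function that describes an element depends on the problem, so its behaviour and its cost `τ`
enter as a hypothesis. -/
theorem wpc_insElem {S : Static} {s : St} {d : Val} {e : Elem} {τ : ℕ}
    (hd : ∀ Φ : Val → ℕ → Prop, (∀ t ≤ τ, Φ (encElem e) t) → wpc P 23 (.cell (encStatic S) d) Φ)
    (hc : Counts s.t s.m) {Φ : Val → ℕ → Prop}
    (h₁ : (scan S.G₁ e).found = none → ∀ t ≤ τ + 50000 * (S.G₁.ht + s.bad.ht + 2),
      Φ (encSt S { s with bad := s.bad.ins (badEntry e) }) t)
    (h₂ : ∀ a, (scan S.G₁ e).found = some a →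
      ∀ t ≤ τ + 50000 * (S.G₁.ht + s.T.ht + s.t.ht + 3), ∀ t', Counts t' (a :: s.m) →
      Φ (encSt S { s with T := s.T.ins (stabEntry S.G₁ e), m := a :: s.m, t := t' }) t) :
    wpc P 17 (.cell (encSt S s) d) Φ := by
  refine wpc_of_ev (getElem?_of_prefix hP (i := 17) rfl) ?_
  simp [codeInsElem, encSt, encStatic]
  refine hd _ fun s₁ hs₁ => ?_
  refine wpc_entry hP fun s₂ hs₂ => ?_
  simp only [encEntry]
  cases hf : (scan S.G₁ e).found with
  | none =>
    simp
    refine wpc_ins encU (treeFuns_prefix hP) fun s₃ hs₃ => ?_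
    exact h₁ hf _ (by omega)
  | some a =>
    simp
    refine wpc_ins encStab (treeFuns_prefix hP) fun s₃ hs₃ => ?_
    refine wpc_push hP hc fun s₄ hs₄ t' ht' => ?_
    exact h₂ a hf _ (by omega) t' ht'

/-- The key to delete is recomputed from the element and the static trees, so no table from elements
to intervals is kept. The stored solution stays as it is. -/
theorem wpc_delElem {S : Static} {s : St} {d : Val} {e : Elem} {τ : ℕ}
    (hd : ∀ Φ : Val → ℕ → Prop, (∀ t ≤ τ, Φ (encElem e) t) → wpc P 23 (.cell (encStatic S) d) Φ)
    {Φ : Val → ℕ → Prop}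
    (h₁ : (scan S.G₁ e).found = none → ∀ t ≤ τ + 50000 * (S.G₁.ht + s.bad.ht + 2),
      Φ (encSt S { s with bad := s.bad.del e.id }) t)
    (h₂ : ∀ a, (scan S.G₁ e).found = some a → ∀ t ≤ τ + 50000 * (S.G₁.ht + s.T.ht + 2),
      Φ (encSt S { s with T := s.T.del (stabEntry S.G₁ e).key }) t) :
    wpc P 18 (.cell (encSt S s) d) Φ := by
  refine wpc_of_ev (getElem?_of_prefix hP (i := 18) rfl) ?_
  simp [codeDelElem, encSt, encStatic]
  refine hd _ fun s₁ hs₁ => ?_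
  refine wpc_entry hP fun s₂ hs₂ => ?_
  simp only [encEntry]
  cases hf : (scan S.G₁ e).found with
  | none =>
    simp
    refine wpc_del encU (treeFuns_prefix hP) fun s₃ hs₃ => ?_
    exact h₁ hf _ (by omega)
  | some a =>
    simp
    refine wpc_del encStab (treeFuns_prefix hP) fun s₃ hs₃ => ?_
    exact h₂ a hf _ (by omega)

theorem wpc_rebuild {S : Static} {s : St} {h : ℕ} (hT : s.T.ht ≤ h) (hG : S.G₂.ht ≤ h)
    (hoT : s.T.Ordered) (hbound : ∀ e ∈ s.T, e.key ≤ e.pay.bound ∧ e.pay.probes.length ≤ 4)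
    (hh : 2 * Nat.log 2 (4 * s.T.size + 1) + 1 ≤ h) {Φ : Val → ℕ → Prop}
    (hΦ : ∀ es, GreedyRun s.T [] es → ∀ n ≤ 300100 * (es.length + 1) * (h + 1), ∀ t',
      Counts t' (greedyPoints S.G₂ es []) →
        Φ (encSt S { s with m := greedyPoints S.G₂ es [], t := t', cnt := es.length }) n) :
    wpc P 19 (encSt S s) Φ := by
  classical
  refine wpc_of_ev (getElem?_of_prefix hP (i := 19) rfl) ?_
  have hM : encM [] .nil = .cell (.num 0) (.cell .nil .nil) := by simp [encM, Val.ofList]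
  simp [codeRebuild, encSt, encStatic]
  rw [← hM]
  refine wpc_greedy hP hT hG hoT hbound s.T.size (b := [])
    ((Finset.card_filter_le _ _).trans (Tr.card_keys hoT).le) Counts.nil (t := .nil) (m := [])
    (by simpa using hh) fun es hes s₁ h₁ t' ht' => ?_
  rw [zero_add]
  refine hΦ es hes _ ?_ t' ht'
  have : 300100 * (es.length + 1) * (h + 1) =
    300000 * (es.length + 1) * (h + 1) + 100 * ((es.length + 1) * (h + 1)) := by ring
  have : 0 < (es.length + 1) * (h + 1) := by positivity
  omega

theorem wpc_addRec {r : Rec} {G₁ G₂ : Tr (ℝ × Point)} {Φ : Val → ℕ → Prop}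
    (h : ∀ s ≤ 30000 * (G₁.ht + G₂.ht + 2),
      Φ (.cell (encT encR (G₁.ins r.entryH)) (encT encR (G₂.ins r.entryC))) s) :
    wpc P 21 (.cell (.cell (encL r.grp) (.cell (.num r.c) (.num r.h)))
      (.cell (encodePoint r.a) (.cell (encT encR G₁) (encT encR G₂)))) Φ := by
  refine wpc_of_ev (getElem?_of_prefix hP (i := 21) rfl) ?_
  have hl := r.grp_le
  simp [codeAddRec, encodePoint]
  refine wpc_append (getElem?_of_prefix hP (i := 9) rfl) (b := [r.h, r.a.1, r.a.2]) _
    (by omega) fun s₁ h₁ => ?_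
  refine wpc_append (getElem?_of_prefix hP (i := 9) rfl) (b := [-r.c]) _
    (by omega) fun s₂ h₂ => ?_
  refine wpc_ins encR (treeFuns_prefix hP) (e := r.entryH) fun s₃ h₃ => ?_
  refine wpc_append (getElem?_of_prefix hP (i := 9) rfl) (b := [r.c, r.a.1, r.a.2]) _
    (by omega) fun s₄ h₄ => ?_
  refine wpc_append (getElem?_of_prefix hP (i := 9) rfl) (b := [-r.h]) _
    (by omega) fun s₅ h₅ => ?_
  refine wpc_ins encR (treeFuns_prefix hP) (e := r.entryC) fun s₆ h₆ => ?_
  exact h _ (by omega)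

end

/-! ### The data structure -/

/-- The updates left until the next new solution are counted. -/
def codeTick : Code :=
  .ifLe (.lit 2) (stCount (.var 0))
    (state (stStatic (.var 0)) (stTree (.var 0)) (stBad (.var 0)) (stSol (.var 0))
      (.sub (stCount (.var 0)) (.lit 2)))
    (.call 19 (.var 0))

/-- The data structure with the given functions that describe dynamic elements (function `23`) and
make the static part of the state (function `24`). -/
def mkDataStructure (fs : List Code) : DataStructure where
  funs := coreFuns ++ fs
  build := .call 19 (.call 20 (.cons (.var 0)
    (state (.call 24 (.var 1)) .nil .nil (triple (.lit 0) .nil .nil) (.lit 0))))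
  insert := .letIn (.call 17 (.cons (.var 0) (.var 1))) codeTick
  delete := .letIn (.call 18 (.cons (.var 0) (.var 1))) codeTick
  size := ifNil (stBad (.var 0)) (fst (stSol (.var 0))) .nil
  member := .letIn (.call 7 (.cons (snd (snd (stSol (.var 0)))) (key (.var 1))))
    (ifNil (.var 0) (.lit 0) (pay (.var 0)))
  report := fst (snd (stSol (.var 0)))

/-! ### Correctness of stabbing -/

/-- Because of this, prefixing keys and values with groups or cells of a fixed length makes one tree
act as a separate tree for each prefix. -/
theorem append_lt_append {p q a b : List ℝ} (h : p.length = q.length) :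
    p ++ a < q ++ b ↔ p < q ∨ p = q ∧ a < b := by
  induction p generalizing q with
  | nil =>
    obtain rfl : q = [] := by simpa using h.symm
    simp
  | cons x p ih =>
    rcases q with _ | ⟨y, q⟩
    · simp at h
    · rw [List.cons_append, List.cons_append, cons_lt_cons, cons_lt_cons, ih (by simpa using h),
        List.cons.injEq]
      tauto

theorem append_le_append {p q a b : List ℝ} (h : p.length = q.length) :
    p ++ a ≤ q ++ b ↔ p < q ∨ p = q ∧ a ≤ b := by
  rw [← not_lt, append_lt_append h.symm, ← not_lt]
  rcases lt_trichotomy p q with h | h | h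
  · simp [h, h.ne', h.not_gt]
  · simp [h]
  · simp [h, h.ne', h.not_gt]

/-- The trees `G₁` and `G₂` store the set `R` of records. -/
structure Stores (G₁ G₂ : Tr (ℝ × Point)) (R : Set Rec) (n : ℕ) : Prop where
  ordered₁ : G₁.Ordered
  ordered₂ : G₂.Ordered
  mem₁ : ∀ e, e ∈ G₁ ↔ ∃ r ∈ R, e = r.entryH
  mem₂ : ∀ e, e ∈ G₂ ↔ ∃ r ∈ R, e = r.entryC
  length : ∀ r ∈ R, r.grp.length = n

section
variable {G₁ G₂ : Tr (ℝ × Point)} {R : Set Rec} {n : ℕ}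

/-- The key continues with the coordinates of the point while the bound ends. A tie in `h` therefore
still counts as larger, and the strict order of keys yields the weak inequality `p.y ≤ r.h`. -/
theorem Stores.query₁_lt (hR : Stores G₁ G₂ R n) {p : Probe} (hp : p.grp.length = n) {r : Rec}
    (hr : r ∈ R) : p.grp ++ [p.y] < r.entryH.key ↔
      p.grp < r.grp ∨ p.grp = r.grp ∧ p.y ≤ r.h := by
  rw [Rec.entryH, append_lt_append (hp.trans (hR.length r hr).symm), cons_lt_cons,
    le_iff_lt_or_eq]
  simp

theorem Stores.query₂_lt (hR : Stores G₁ G₂ R n) {p : Probe} (hp : p.grp.length = n) {r : Rec}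
    (hr : r ∈ R) {v : ℝ} : p.grp ++ [v] < r.entryC.key ↔
      p.grp < r.grp ∨ p.grp = r.grp ∧ v ≤ r.c := by
  rw [Rec.entryC, append_lt_append (hp.trans (hR.length r hr).symm), cons_lt_cons,
    le_iff_lt_or_eq]
  simp

theorem singleton_le {x y : ℝ} : [x] ≤ [y] ↔ x ≤ y := by
  rw [cons_le_cons]; simp [le_iff_lt_or_eq]

/-- A single step of the scan either finds no record, or the one that reaches farthest. -/
theorem Stores.scanStep_spec (hR : Stores G₁ G₂ R n) {p : Probe} (hp : p.grp.length = n) (x : ℝ)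
    (s : Scan) : ((∀ r ∈ R, ¬ p.Hits x r) ∧ scanStep G₁ x s p = s) ∨
      ∃ r ∈ R, p.Hits x r ∧ (∀ r' ∈ R, p.Hits x r' → r'.c ≤ r.c) ∧
        scanStep G₁ x s p = if p.pos then ⟨s.lo, max s.hi r.c, some r.a⟩
          else ⟨min s.lo (-r.c), s.hi, some r.a⟩ := by
  have key : ∀ r ∈ R, p.Hits x r → p.grp ++ [p.y] < r.entryH.key := fun r hr h =>
    (hR.query₁_lt hp hr).2 (.inr ⟨h.1.symm, h.2.2⟩)
  obtain ⟨h₁, h₂⟩ := Tr.query_spec hR.ordered₁ (p.grp ++ [p.y])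
  unfold scanStep
  cases hq : G₁.query (p.grp ++ [p.y]) with
  | none =>
    refine .inl ⟨fun r hr h => ?_, rfl⟩
    exact (h₁ hq _ ((hR.mem₁ _).2 ⟨r, hr, rfl⟩)).not_gt (key r hr h)
  | some e =>
    obtain ⟨he, hlt, hmin⟩ := h₂ e hq
    obtain ⟨r, hr, rfl⟩ := (hR.mem₁ e).1 he
    have hval : ∀ r' ∈ R, p.Hits x r' → r.grp ++ [-r.c] ≤ r'.grp ++ [-r'.c] := fun r' hr' h =>
      hmin _ ((hR.mem₁ _).2 ⟨r', hr', rfl⟩) (key r' hr' h)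
    rw [hR.query₁_lt hp hr] at hlt
    -- The query may return a record of a later group. Since `hlt` excludes earlier groups, this
    -- test succeeds exactly if `p` hits the record.
    have hle : r.entryH.val ≤ p.grp ++ [-p.sgn x] ↔
        r.grp < p.grp ∨ r.grp = p.grp ∧ p.sgn x ≤ r.c := by
      rw [Rec.entryH, append_le_append ((hR.length r hr).trans hp.symm), singleton_le, neg_le_neg_iff]
    dsimp only
    by_cases h : r.entryH.val ≤ p.grp ++ [-p.sgn x]
    · rw [if_pos h]
      right
      refine ⟨r, hr, ?_, ?_, rfl⟩ <;> rw [hle] at h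
      · rcases h with h | h
        · exact absurd h (by rcases hlt with h' | h' <;> [exact h'.not_gt; exact h'.1.not_gt])
        · rcases hlt with h' | h'
          · exact absurd h.1 h'.ne'
          · exact ⟨h.1, h.2, h'.2⟩
      · intro r' hr' h'
        have := hval r' hr' h'
        rw [append_le_append ((hR.length r hr).trans (hR.length r' hr').symm), singleton_le,
          neg_le_neg_iff] at this
        rcases this with h'' | h''
        · rw [h'.1] at h''
          rcases hlt with h₃ | h₃
          · exact absurd h'' h₃.not_gt
          · exact absurd h₃.1 h''.ne'
        · exact h''.2
    · rw [if_neg h]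
      refine .inl ⟨fun r' hr' h' => h (le_trans (hval r' hr' h') ?_), rfl⟩
      rw [append_le_append ((hR.length r' hr').trans hp.symm), singleton_le, neg_le_neg_iff]
      exact .inr ⟨h'.1, h'.2.1⟩

/-- What the scan of the probes `l` at position `x` returns. -/
structure ScanSpec (R : Set Rec) (x : ℝ) (l : List Probe) (s : Scan) : Prop where
  lo_le : s.lo ≤ x
  le_hi : x ≤ s.hi
  le_of_pos : ∀ p ∈ l, p.pos = true → ∀ r ∈ R, p.Hits x r → r.c ≤ s.hi
  le_of_neg : ∀ p ∈ l, p.pos = false → ∀ r ∈ R, p.Hits x r → s.lo ≤ -r.c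
  hi_eq : s.hi = x ∨ ∃ p ∈ l, p.pos = true ∧ ∃ r ∈ R, p.Hits x r ∧ r.c = s.hi
  lo_eq : s.lo = x ∨ ∃ p ∈ l, p.pos = false ∧ ∃ r ∈ R, p.Hits x r ∧ -r.c = s.lo
  none : s.found = none → ∀ p ∈ l, ∀ r ∈ R, ¬ p.Hits x r
  some : ∀ a, s.found = some a → ∃ p ∈ l, ∃ r ∈ R, p.Hits x r ∧ r.a = a

theorem Stores.scanSpec (hR : Stores G₁ G₂ R n) (x : ℝ) (l : List Probe)
    (hl : ∀ p ∈ l, p.grp.length = n) :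
    ScanSpec R x l (l.foldl (scanStep G₁ x) ⟨x, x, .none⟩) := by
  -- The fold treats the last probe last, so the list is extended at its end.
  induction l using List.reverseRecOn with
  | nil => constructor <;> simp
  | append_singleton l p ih =>
    have ih := ih fun q hq => hl q (List.mem_append_left _ hq)
    rw [List.foldl_append, List.foldl_cons, List.foldl_nil]
    generalize l.foldl (scanStep G₁ x) ⟨x, x, .none⟩ = s at ih ⊢
    obtain ⟨i₁, i₂, i₃, i₄, i₅, i₆, i₇, i₈⟩ := ih
    rcases hR.scanStep_spec (hl p (by simp)) x s with ⟨h₁, h₂⟩ | ⟨r, hr, h₁, h₂, h₃⟩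
    · rw [h₂]
      constructor <;> grind
    · rw [h₃]
      cases hp : p.pos with
      | true =>
        simp only [if_true]
        constructor <;> grind
      | false =>
        simp only [Bool.false_eq_true, if_false]
        constructor <;> grind

/-- The best record of the group of `p` for the position `v` is among the points for `v`. -/
theorem Stores.exists_stabPoint (hR : Stores G₁ G₂ R n) {l : List Probe} {p : Probe} (hpl : p ∈ l)
    (hp : p.grp.length = n) {v : ℝ} {r : Rec} (hr : r ∈ R) (hg : r.grp = p.grp)
    (hv : p.sgn v ≤ r.c) :
    ∃ r' ∈ R, r'.grp = p.grp ∧ p.sgn v ≤ r'.c ∧ r.h ≤ r'.h ∧ r'.a ∈ stabPoints G₂ v l := by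
  obtain ⟨h₁, h₂⟩ := Tr.query_spec hR.ordered₂ (p.grp ++ [p.sgn v])
  have hlt : p.grp ++ [p.sgn v] < r.entryC.key := (hR.query₂_lt hp hr).2 (.inr ⟨hg.symm, hv⟩)
  have hmem := (hR.mem₂ _).2 ⟨r, hr, rfl⟩
  cases hq : G₂.query (p.grp ++ [p.sgn v]) with
  | none => exact absurd hlt (h₁ hq _ hmem).not_gt
  | some e =>
    obtain ⟨he, hlt', hmin⟩ := h₂ e hq
    obtain ⟨r', hr', rfl⟩ := (hR.mem₂ e).1 he
    have := hmin _ hmem hlt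
    rw [Rec.entryC, Rec.entryC, append_le_append ((hR.length r' hr').trans (hR.length r hr).symm),
      singleton_le, neg_le_neg_iff] at this
    rw [hR.query₂_lt hp hr'] at hlt'
    -- Values begin with the group, so the presence of `r` keeps the minimum from lying in a later
    -- group; the bound rules out earlier ones.
    have hg' : r'.grp = p.grp ∧ r.h ≤ r'.h ∧ p.sgn v ≤ r'.c := by
      rcases this with h | h <;> rcases hlt' with h' | h'
      · exact absurd h (hg ▸ h'.not_gt)
      · exact absurd (hg.trans h'.1) h.ne'
      · exact absurd (h.1.trans hg) h'.ne'
      · exact ⟨h.1.trans hg, h.2, h'.2⟩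
    refine ⟨r', hr', hg'.1, hg'.2.2, hg'.2.1, ?_⟩
    simp only [stabPoints, List.mem_filterMap, Option.map_eq_some_iff]
    exact ⟨p, hpl, _, hq, rfl⟩

/-- If the group of a probe has no eligible record, the query may return a point of another group.
That is harmless, since every answer is a static point. -/
theorem Stores.stabPoints_subset (hR : Stores G₁ G₂ R n) {l : List Probe} {v : ℝ} {a : Point}
    (ha : a ∈ stabPoints G₂ v l) : ∃ r ∈ R, r.a = a := by
  simp only [stabPoints, List.mem_filterMap, Option.map_eq_some_iff] at ha
  obtain ⟨p, -, e, he, rfl⟩ := ha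
  obtain ⟨h, -⟩ := (Tr.query_spec hR.ordered₂ _).2 e he
  obtain ⟨r, hr, rfl⟩ := (hR.mem₂ e).1 h
  exact ⟨r, hr, rfl⟩

end

/-! ### Runs of the greedy algorithm -/

namespace GreedyRun
variable {T : Tr Stab} {b : List ℝ} {es : List (Entry Stab)}

theorem mem (h : GreedyRun T b es) (ho : T.Ordered) : ∀ e ∈ es, e ∈ T := by
  induction h with
  | done h => simp
  | step h _ ih =>
    intro e he
    rcases List.mem_cons.1 he with rfl | he
    · exact ((Tr.query_spec ho _).2 _ h).1
    · exact ih e he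

theorem head_lt (h : GreedyRun T b es) (ho : T.Ordered) (hb : ∀ e ∈ T, e.key ≤ e.pay.bound) :
    ∀ e ∈ es, b < e.key := by
  induction h with
  | done h => simp
  | step h _ ih =>
    intro e he
    obtain ⟨h₁, h₂, -⟩ := (Tr.query_spec ho _).2 _ h
    rcases List.mem_cons.1 he with rfl | he
    · exact h₂
    · exact (h₂.trans_le (hb _ h₁)).trans (ih e he)

theorem pairwise (h : GreedyRun T b es) (ho : T.Ordered) (hb : ∀ e ∈ T, e.key ≤ e.pay.bound) :
    es.Pairwise fun e e' => e.pay.bound < e'.key := by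
  induction h with
  | done h => simp
  | step h hes ih => exact List.pairwise_cons.2 ⟨hes.head_lt ho hb, ih⟩

/-- Take the first chosen entry whose bound is not before `e.key`. When it was chosen, `e` was still
eligible, so the chosen value is no larger than that of `e`. -/
theorem exists_stab (h : GreedyRun T b es) (ho : T.Ordered) {e : Entry Stab} (he : e ∈ T)
    (hlt : b < e.key) : ∃ e' ∈ es, e'.val ≤ e.val ∧ e.key ≤ e'.pay.bound := by
  induction h with
  | done h => exact absurd hlt ((Tr.query_spec ho _).1 h e he).not_gt
  | @step b e' es h hes ih =>
    by_cases hle : e.key ≤ e'.pay.bound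
    · exact ⟨e', List.mem_cons_self, ((Tr.query_spec ho _).2 _ h).2.2 e he hlt, hle⟩
    · obtain ⟨e'', h₁, h₂⟩ := ih (not_le.1 hle)
      exact ⟨e'', List.mem_cons_of_mem _ h₁, h₂⟩

end GreedyRun

theorem mem_greedyPoints {G : Tr (ℝ × Point)} {es : List (Entry Stab)} {m : List Point}
    {a : Point} : a ∈ greedyPoints G es m ↔
      (∃ e ∈ es, a ∈ stabPoints G e.pay.hi e.pay.probes) ∨ a ∈ m := by
  induction es generalizing m with
  | nil => simp [greedyPoints]
  | cons e es ih =>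
    rw [greedyPoints, List.foldl_cons, ← greedyPoints, ih]
    simp only [List.mem_append, List.mem_reverse, List.mem_cons, exists_eq_or_imp]
    exact or_left_comm.trans or_assoc.symm

theorem length_greedyPoints (G : Tr (ℝ × Point)) {es : List (Entry Stab)}
    (h : ∀ e ∈ es, e.pay.probes.length ≤ 4) (m : List Point) :
    (greedyPoints G es m).length ≤ 4 * es.length + m.length := by
  induction es generalizing m with
  | nil => simp [greedyPoints]
  | cons e es ih =>
    rw [greedyPoints, List.foldl_cons, ← greedyPoints]
    refine (ih (fun e he => h e (List.mem_cons_of_mem _ he)) _).trans ?_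
    have := length_stabPoints G e.pay.hi e.pay.probes
    have := h e List.mem_cons_self
    simp; omega

/-- The description `el` of the dynamic elements and the records `rc a i` of the static points
`a ∈ A₀` describe the relation `cov`, and the records are stored in `G₁` and `G₂`. -/
structure Model {D : Type} (A₀ : Finset Point) (cov : Point → D → Prop) (G₁ G₂ : Tr (ℝ × Point))
    (el : D → Elem) (rc : Point → Fin 16 → Rec) (ng nc : ℕ) : Prop where
  stores : Stores G₁ G₂ {r | ∃ a ∈ A₀, ∃ i, rc a i = r} ng
  rc_a : ∀ a i, (rc a i).a = a
  grp_length : ∀ d, ∀ p ∈ (el d).probes, p.grp.length = ng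
  cell_length : ∀ d, (el d).probes ≠ [] → (el d).cell.length = nc
  cov_iff : ∀ d, ∀ a ∈ A₀, cov a d ↔ ∃ p ∈ (el d).probes, ∃ i, p.Hits (el d).x (rc a i)
  of_grp : ∀ d d', ∀ p ∈ (el d).probes, ∀ p' ∈ (el d').probes, p.grp = p'.grp →
    p.pos = p'.pos ∧ (el d).cell = (el d').cell
  of_cell : ∀ d d', (el d).cell = (el d').cell → (el d').probes ≠ [] → ∀ p ∈ (el d).probes,
    ∃ p' ∈ (el d').probes, p'.pos = p.pos ∧ p'.grp = p.grp
  id_injective : Function.Injective fun d => (el d).id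

-- Reduction of covering to interval stabbing

namespace Model
variable {D : Type} {A₀ : Finset Point} {cov : Point → D → Prop} {G₁ G₂ : Tr (ℝ × Point)}
  {el : D → Elem} {rc : Point → Fin 16 → Rec} {ng nc : ℕ}
  (hM : Model A₀ cov G₁ G₂ el rc ng nc)
include hM

theorem scanSpec (d : D) :
    ScanSpec {r | ∃ a ∈ A₀, ∃ i, rc a i = r} (el d).x (el d).probes (scan G₁ (el d)) :=
  hM.stores.scanSpec _ _ (hM.grp_length d)

theorem found_eq_none {d : D} : (scan G₁ (el d)).found = none ↔ ∀ a ∈ A₀, ¬ cov a d := by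
  constructor
  · intro h a ha hc
    obtain ⟨p, hp, i, hi⟩ := (hM.cov_iff d a ha).1 hc
    exact (hM.scanSpec d).none h p hp _ ⟨a, ha, i, rfl⟩ hi
  · intro h
    by_contra hne
    obtain ⟨a, ha⟩ := Option.ne_none_iff_exists'.1 hne
    obtain ⟨p, hp, r, ⟨a', ha', i, rfl⟩, hr, -⟩ := (hM.scanSpec d).some a ha
    exact h a' ha' ((hM.cov_iff d a' ha').2 ⟨p, hp, i, hr⟩)

theorem found_eq_some {d : D} {a : Point} (h : (scan G₁ (el d)).found = some a) :
    a ∈ A₀ ∧ cov a d := by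
  obtain ⟨p, hp, r, ⟨a', ha', i, rfl⟩, hr, h⟩ := (hM.scanSpec d).some a h
  rw [hM.rc_a] at h
  subst h
  exact ⟨ha', (hM.cov_iff d a' ha').2 ⟨p, hp, i, hr⟩⟩

theorem probes_ne_nil {d : D} {a : Point} (ha : a ∈ A₀) (h : cov a d) : (el d).probes ≠ [] := by
  obtain ⟨p, hp, -⟩ := (hM.cov_iff d a ha).1 h
  exact List.ne_nil_of_mem hp

/-- The identifier at the end of the key separates elements with the same cell and left end. -/
theorem key_injective {d d' : D} (hd : (el d).probes ≠ []) (hd' : (el d').probes ≠ [])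
    (h : (stabEntry G₁ (el d)).key = (stabEntry G₁ (el d')).key) : d = d' := by
  have hl := (hM.cell_length d hd).trans (hM.cell_length d' hd').symm
  have := (List.append_inj h hl).2
  exact hM.id_injective (by simpa using (List.cons.inj (List.cons.inj this).2).2)

/-- A stabbed element is covered by the points that serve the position. -/
theorem exists_cov {d d' : D} {a : Point} (ha : a ∈ A₀) (hc : cov a d)
    (hd' : (el d').probes ≠ []) (hcell : (el d).cell = (el d').cell) {v : ℝ}
    (h₁ : (scan G₁ (el d)).lo ≤ v) (h₂ : v ≤ (scan G₁ (el d)).hi) :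
    ∃ b ∈ stabPoints G₂ v (el d').probes, b ∈ A₀ ∧ cov b d := by
  have hs := hM.scanSpec d
  -- If `r` is hit by `p` and also reaches `v`, then the best record for `v` in that group is at
  -- least as high as `r`. It reaches `v`, and with it the position of `d` when `v` lies on the far
  -- side for `p`.
  have main : ∀ p ∈ (el d).probes, ∀ r ∈ {r | ∃ a ∈ A₀, ∃ i, rc a i = r}, p.Hits (el d).x r →
      p.sgn v ≤ r.c → p.sgn (el d).x ≤ p.sgn v →
      ∃ b ∈ stabPoints G₂ v (el d').probes, b ∈ A₀ ∧ cov b d := by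
    intro p hp r hr hh hv hx
    obtain ⟨p', hp', e₁, e₂⟩ := hM.of_cell d d' hcell hd' p hp
    have hsgn : ∀ y, p'.sgn y = p.sgn y := fun y => by simp [Probe.sgn, e₁]
    obtain ⟨r', ⟨b, hb, i, rfl⟩, g₁, g₂, g₃, g₄⟩ := hM.stores.exists_stabPoint hp'
      (hM.grp_length d' p' hp') hr (hh.1.trans e₂.symm) (by rwa [hsgn])
    rw [hM.rc_a] at g₄
    refine ⟨b, g₄, hb, (hM.cov_iff d b hb).2 ⟨p, hp, i, g₁.trans e₂, ?_, hh.2.2.trans g₃⟩⟩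
    rw [hsgn] at g₂
    exact hx.trans g₂
  have hpos : ∀ p : Probe, p.pos = true → ∀ y, p.sgn y = y := fun p h y => by simp [Probe.sgn, h]
  have hneg : ∀ p : Probe, p.pos = false → ∀ y, p.sgn y = -y := fun p h y => by
    simp [Probe.sgn, h]
  -- To the left of the position, the negative probe that determined `lo` is used; to the right, the
  -- positive one that determined `hi`; at the position itself, any probe that is hit.
  rcases lt_trichotomy v (el d).x with hv | hv | hv
  · rcases hs.lo_eq with h | ⟨p, hp, hp', r, hr, hh, he⟩
    · linarith
    · refine main p hp r hr hh ?_ ?_ <;> rw [hneg p hp'] <;> [skip; rw [hneg p hp']] <;> linarith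
  · obtain ⟨p, hp, i, hi⟩ := (hM.cov_iff d a ha).1 hc
    exact main p hp _ ⟨a, ha, i, rfl⟩ hi (hv ▸ hi.2.1) (hv ▸ le_rfl)
  · rcases hs.hi_eq with h | ⟨p, hp, hp', r, hr, hh, he⟩
    · linarith
    · refine main p hp r hr hh ?_ ?_ <;> rw [hpos p hp'] <;> [skip; rw [hpos p hp']] <;> linarith

/-- The interval of `d` lies before that of `d'`. -/
def _root_.GeomCover.Before (G₁ : Tr (ℝ × Point)) (el : D → Elem) (d d' : D) : Prop :=
  (stabEntry G₁ (el d)).pay.bound < (stabEntry G₁ (el d')).key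

theorem lo_le_hi (d : D) : (scan G₁ (el d)).lo ≤ (scan G₁ (el d)).hi :=
  (hM.scanSpec d).lo_le.trans (hM.scanSpec d).le_hi

/-- If both ends of the interval agree, the entries `0` and `1` after them decide. -/
theorem key_le_bound (d : D) :
    (stabEntry G₁ (el d)).key ≤ (stabEntry G₁ (el d)).pay.bound := by
  rw [stabEntry, append_le_append rfl, cons_le_cons, cons_le_cons]
  rcases (hM.lo_le_hi d).lt_or_eq with h | h
  · exact .inr ⟨rfl, .inl h⟩
  · exact .inr ⟨rfl, .inr ⟨h, .inl one_pos⟩⟩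

theorem before_iff {d d' : D} (hd : (el d).probes ≠ []) (hd' : (el d').probes ≠ []) :
    Before G₁ el d d' ↔ (el d).cell < (el d').cell ∨
      (el d).cell = (el d').cell ∧ (scan G₁ (el d)).hi < (scan G₁ (el d')).lo := by
  have hl := (hM.cell_length d hd).trans (hM.cell_length d' hd').symm
  rw [Before, stabEntry, stabEntry, append_lt_append hl, cons_lt_cons, cons_lt_cons]
  -- Intervals are closed: when one ends where the other starts, the entries `1` and `0` keep them
  -- from counting as disjoint.
  have : ¬ (1 : ℝ) < 0 := by norm_num
  simp [this]

/-- A common record of positive probes would reach no farther than the right end of `d`, hence not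
as far as the left end of `d'` and still less its position. For negative probes the argument is
mirrored. -/
theorem not_hits {d d' : D} (h : Before G₁ el d d') {p p' : Probe}
    (hp : p ∈ (el d).probes) (hp' : p' ∈ (el d').probes) {a : Point} (ha : a ∈ A₀) {i : Fin 16}
    (h₁ : p.Hits (el d).x (rc a i)) (h₂ : p'.Hits (el d').x (rc a i)) : False := by
  obtain ⟨e₁, e₂⟩ := hM.of_grp d d' p hp p' hp' (h₁.1.symm.trans h₂.1)
  rw [hM.before_iff (List.ne_nil_of_mem hp) (List.ne_nil_of_mem hp'), e₂] at h
  replace h := (h.resolve_left (lt_irrefl _)).2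
  have s := hM.scanSpec d
  have s' := hM.scanSpec d'
  have hr : rc a i ∈ {r | ∃ a ∈ A₀, ∃ i, rc a i = r} := ⟨a, ha, i, rfl⟩
  have k₁ := h₁.2.1
  have k₂ := h₂.2.1
  cases hpos : p.pos with
  | true =>
    have := s.le_of_pos p hp hpos _ hr h₁
    simp only [Probe.sgn, ← e₁, hpos, if_true] at k₂
    linarith [s'.lo_le]
  | false =>
    have := s'.le_of_neg p' hp' (e₁ ▸ hpos) _ hr h₂
    simp only [Probe.sgn, hpos, Bool.false_eq_true, if_false] at k₁
    linarith [s.le_hi]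

/-- Elements with disjoint intervals need many points. -/
theorem card_le {W : Finset D} (hW : ∀ d ∈ W, ∀ d' ∈ W, d ≠ d' → Before G₁ el d d' ∨ Before G₁ el d' d)
    {M : Multiset Point} (hA : ∀ a ∈ M, a ∈ A₀) (hcov : ∀ d ∈ W, ∃ a ∈ M, cov a d) :
    W.card ≤ 16 * M.card := by
  classical
  -- Each element is sent to a covering point together with the index of the record that is hit. By
  -- `not_hits` this map is injective, and a point has sixteen indices.
  have : ∀ d ∈ W, ∃ q : Point × Fin 16, q.1 ∈ M ∧ ∃ p ∈ (el d).probes, p.Hits (el d).x (rc q.1 q.2) := by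
    intro d hd
    obtain ⟨a, ha, hc⟩ := hcov d hd
    obtain ⟨p, hp, i, hi⟩ := (hM.cov_iff d a (hA a ha)).1 hc
    exact ⟨(a, i), ha, p, hp, hi⟩
  choose! f hf₁ hf₂ using this
  have hinj : Set.InjOn f W := by
    intro d hd d' hd' h
    by_contra hne
    obtain ⟨p, hp, h₁⟩ := hf₂ d hd
    obtain ⟨p', hp', h₂⟩ := hf₂ d' hd'
    rw [← h] at h₂
    rcases hW d hd d' hd' hne with hb | hb
    · exact hM.not_hits hb hp hp' (hA _ (hf₁ d hd)) h₁ h₂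
    · exact hM.not_hits hb hp' hp (hA _ (hf₁ d hd)) h₂ h₁
  calc W.card ≤ (M.toFinset ×ˢ (Finset.univ : Finset (Fin 16))).card :=
        Finset.card_le_card_of_injOn f (fun d hd => by simpa using hf₁ d hd) hinj
    _ = M.toFinset.card * 16 := by simp
    _ ≤ 16 * M.card := by rw [mul_comm]; exact Nat.mul_le_mul_left _ (Multiset.toFinset_card_le M)

/-- The tree `T` stores the entries of those elements of `X` that can be covered. -/
def _root_.GeomCover.Represents (A₀ : Finset Point) (cov : Point → D → Prop) (G₁ : Tr (ℝ × Point))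
    (el : D → Elem) (T : Tr Stab) (X : Finset D) : Prop :=
  ∀ e, e ∈ T ↔ ∃ d ∈ X, (∃ a ∈ A₀, cov a d) ∧ stabEntry G₁ (el d) = e

/-- Reads the outcome of `GreedyRun.exists_stab` geometrically. The values give one inequality
between the cells and the keys the other, so the cells coincide and the chosen right end stabs the
interval of `d`. -/
theorem lo_le_of_key_le {d d' : D} (hd : (el d).probes ≠ []) (hd' : (el d').probes ≠ [])
    (h₁ : (stabEntry G₁ (el d')).val ≤ (stabEntry G₁ (el d)).val)
    (h₂ : (stabEntry G₁ (el d)).key ≤ (stabEntry G₁ (el d')).pay.bound) :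
    (el d).cell = (el d').cell ∧ (scan G₁ (el d)).lo ≤ (scan G₁ (el d')).hi ∧
      (scan G₁ (el d')).hi ≤ (scan G₁ (el d)).hi := by
  have hl := (hM.cell_length d hd).trans (hM.cell_length d' hd').symm
  rw [stabEntry, stabEntry, append_le_append hl.symm, singleton_le] at h₁
  rw [stabEntry, stabEntry, append_le_append hl, cons_le_cons] at h₂
  rcases h₁ with h₁ | h₁ <;> rcases h₂ with h₂ | h₂
  · exact absurd h₁ h₂.not_gt
  · exact absurd h₂.1 h₁.ne'
  · exact absurd h₁.1 h₂.ne'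
  · refine ⟨h₂.1, ?_, h₁.2⟩
    rcases h₂.2 with h | h
    · exact h.le
    · exact h.1.le

/-- The greedy algorithm covers all elements that can be covered, and each of its steps is caused
by an element of its own. -/
theorem greedy_spec {X : Finset D} {T : Tr Stab} (hT : Represents A₀ cov G₁ el T X)
    (ho : T.Ordered) {es : List (Entry Stab)} (hes : GreedyRun T [] es) :
    (∀ a ∈ greedyPoints G₂ es [], a ∈ A₀) ∧
      (∀ d ∈ X, (∃ a ∈ A₀, cov a d) → ∃ a ∈ greedyPoints G₂ es [], cov a d) ∧
      (greedyPoints G₂ es []).length ≤ 4 * es.length ∧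
      ∃ W ⊆ X, W.card = es.length ∧ (∀ d ∈ W, ∃ a ∈ A₀, cov a d) ∧
        ∀ d ∈ W, ∀ d' ∈ W, d ≠ d' → Before G₁ el d d' ∨ Before G₁ el d' d := by
  classical
  have hmem := hes.mem ho
  refine ⟨fun a ha => ?_, fun d hd hc => ?_, ?_, ?_⟩
  · obtain ⟨e, he, ha⟩ | ha := mem_greedyPoints.1 ha
    · obtain ⟨r, ⟨b, hb, i, rfl⟩, rfl⟩ := hM.stores.stabPoints_subset ha
      rwa [hM.rc_a]
    · simp at ha
  · have hne : ([] : List ℝ) < (stabEntry G₁ (el d)).key := by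
      refine lt_of_le_of_ne (nil_le_list _) ?_
      simp [stabEntry]
    obtain ⟨e, he, h₁, h₂⟩ := hes.exists_stab ho ((hT _).2 ⟨d, hd, hc, rfl⟩) hne
    obtain ⟨d', hd', ⟨a', ha', hc'⟩, rfl⟩ := (hT e).1 (hmem e he)
    obtain ⟨a, ha, hca⟩ := hc
    have hp' := hM.probes_ne_nil ha' hc'
    obtain ⟨g₁, g₂, g₃⟩ := hM.lo_le_of_key_le (hM.probes_ne_nil ha hca) hp' h₁ h₂
    obtain ⟨b, hb, -, hcb⟩ := hM.exists_cov ha hca hp' g₁ g₂ g₃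
    exact ⟨b, mem_greedyPoints.2 (.inl ⟨_, he, hb⟩), hcb⟩
  · have : ∀ e ∈ es, e.pay.probes.length ≤ 4 := by
      intro e he
      obtain ⟨d', -, -, rfl⟩ := (hT e).1 (hmem e he)
      exact (el d').probes_le
    simpa using length_greedyPoints G₂ this []
  -- One element is picked for each chosen entry. The chosen intervals follow one another strictly,
  -- so no element is picked twice.
  · obtain ⟨ds, hds, rfl⟩ : ∃ ds : List D, (∀ d ∈ ds, d ∈ X ∧ ∃ a ∈ A₀, cov a d) ∧
        ds.map (fun d => stabEntry G₁ (el d)) = es := by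
      clear hes
      induction es with
      | nil => exact ⟨[], by simp⟩
      | cons e es ih =>
        obtain ⟨ds, h₁, h₂⟩ := ih fun e he => hmem e (List.mem_cons_of_mem _ he)
        obtain ⟨d, hd, hc, h⟩ := (hT e).1 (hmem e List.mem_cons_self)
        refine ⟨d :: ds, ?_, by simp [h, h₂]⟩
        exact List.forall_mem_cons.2 ⟨⟨hd, hc⟩, h₁⟩
    have hp := hes.pairwise ho fun e he => by
      obtain ⟨d, -, -, rfl⟩ := (hT e).1 he
      exact hM.key_le_bound d
    rw [List.pairwise_map] at hp
    have hp' : ds.Pairwise fun d d' => Before G₁ el d d' := hp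
    have hnd : ds.Nodup := hp'.imp fun {a b} h => by
      rintro rfl
      exact absurd h (hM.key_le_bound a).not_gt
    refine ⟨ds.toFinset, fun d hd => (hds d (by simpa using hd)).1, ?_,
      fun d hd => (hds d (by simpa using hd)).2, fun d hd d' hd' hne => ?_⟩
    · rw [List.toFinset_card_of_nodup hnd, List.length_map]
    · obtain ⟨i, hi, rfl⟩ := List.getElem_of_mem (List.mem_toFinset.1 hd)
      obtain ⟨j, hj, rfl⟩ := List.getElem_of_mem (List.mem_toFinset.1 hd')
      rw [List.pairwise_iff_getElem] at hp'
      rcases lt_trichotomy i j with h | rfl | h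
      · exact .inl (hp' i j hi hj h)
      · exact absurd rfl hne
      · exact .inr (hp' j i hj hi h)

end Model

-- Folding a function over a list

section
variable {P : List Code} {D : Type} {enc : D → Val} {f g : ℕ}

/-- The invariant is indexed by the part of the list that is still to be processed. -/
theorem wpc_fold (hf : P[f]? = some (codeFold f g)) (I : List D → Val → Prop) {B : ℕ}
    (hstep : ∀ d l σ, I (d :: l) σ → ∀ Φ : Val → ℕ → Prop,
      (∀ t ≤ B, ∀ σ', I l σ' → Φ σ' t) → wpc P g (.cell σ (enc d)) Φ)
    {l : List D} {σ : Val} (hσ : I l σ) {Φ : Val → ℕ → Prop}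
    (hΦ : ∀ t ≤ (B + 60) * (l.length + 1), ∀ σ', I [] σ' → Φ σ' t) :
    wpc P f (.cell (Val.ofList (l.map enc)) σ) Φ := by
  induction l generalizing σ Φ with
  | nil =>
    refine wpc_of_ev hf ?_
    simp [codeFold, Val.ofList]
    exact hΦ _ (by simp) σ hσ
  | cons d l ih =>
    refine wpc_of_ev hf ?_
    simp [codeFold, Val.ofList]
    refine hstep d l σ hσ _ fun t₁ h₁ σ' hσ' => ?_
    refine ih hσ' fun t₂ h₂ σ'' hσ'' => hΦ _ ?_ σ'' hσ''
    have : (B + 60) * ((d :: l).length + 1) = (B + 60) * (l.length + 1) + (B + 60) := by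
      rw [List.length_cons]; ring
    omega

end

/-! ### Invariants -/

section
variable {D : Type} (A₀ : Finset Point) (cov : Point → D → Prop) (S : Static) (el : D → Elem)

/-- The state `s` belongs to the set `X` of dynamic elements, and its points cover all elements
of `X` that can be covered. -/
structure Inv (X : Finset D) (s : St) : Prop where
  ordered : s.T.Ordered
  balanced : s.T.Balanced
  represents : Represents A₀ cov S.G₁ el s.T X
  bad_ordered : s.bad.Ordered
  bad_balanced : s.bad.Balanced
  mem_bad : ∀ e, e ∈ s.bad ↔ ∃ d ∈ X, (¬ ∃ a ∈ A₀, cov a d) ∧ badEntry (el d) = e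
  counts : Counts s.t s.m
  mem : ∀ a ∈ s.m, a ∈ A₀
  exists_cov : ∀ d ∈ X, (∃ a ∈ A₀, cov a d) → ∃ a ∈ s.m, cov a d

open Classical in
/-- After `q` updates since the last new solution, the solution is still small. -/
def Approx (X : Finset D) (s : St) (q : ℕ) : Prop :=
  ∃ W : Finset D, (∀ d ∈ W, ∃ a ∈ A₀, cov a d) ∧
    (∀ d ∈ W, ∀ d' ∈ W, d ≠ d' → Before S.G₁ el d d' ∨ Before S.G₁ el d' d) ∧
    (W \ X).card ≤ q ∧ s.m.length ≤ 4 * W.card + q ∧ s.cnt = W.card - 2 * q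

end

section
variable {D : Type} {A₀ : Finset Point} {cov : Point → D → Prop} {S : Static} {el : D → Elem}
  {rc : Point → Fin 16 → Rec} {ng nc : ℕ} {X : Finset D} {s : St}

theorem Inv.size_le (h : Inv A₀ cov S el X s) : s.T.size ≤ X.card :=
  Tr.size_le_of_keys h.ordered X (fun d => (stabEntry S.G₁ (el d)).key) fun e he => by
    obtain ⟨d, hd, -, rfl⟩ := (h.represents e).1 he
    exact ⟨d, hd, rfl⟩

theorem Inv.bad_size_le (h : Inv A₀ cov S el X s) : s.bad.size ≤ X.card :=
  Tr.size_le_of_keys h.bad_ordered X (fun d => (badEntry (el d)).key) fun e he => by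
    obtain ⟨d, hd, -, rfl⟩ := (h.mem_bad e).1 he
    exact ⟨d, hd, rfl⟩

open Classical in
-- A nonnegative counter means `2 * q ≤ |W|`. Then `4 * |W| + q ≤ 9 * (|W| - q)`, and at least `|W|
-- - q` elements of `W` are still present.
theorem Approx.card_le (h : Approx A₀ cov S el X s q) (hc : 0 ≤ s.cnt) :
    ∃ W ⊆ X, (∀ d ∈ W, ∃ a ∈ A₀, cov a d) ∧
      (∀ d ∈ W, ∀ d' ∈ W, d ≠ d' → Before S.G₁ el d d' ∨ Before S.G₁ el d' d) ∧
      s.m.length ≤ 9 * W.card := by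
  obtain ⟨W, h₁, h₂, h₃, h₄, h₅⟩ := h
  refine ⟨W ∩ X, Finset.inter_subset_right, fun d hd => h₁ d (Finset.mem_inter.1 hd).1,
    fun d hd d' hd' => h₂ d (Finset.mem_inter.1 hd).1 d' (Finset.mem_inter.1 hd').1, ?_⟩
  rw [h₅] at hc
  have hc : 2 * q ≤ W.card := by
    have : (2 * q : ℝ) ≤ W.card := by linarith
    exact_mod_cast this
  have := Finset.card_sdiff_add_card_inter W X
  omega

open Classical in
-- The witness `W` remains the one of the last greedy run: an update takes away at most one element
-- and adds at most one point.
theorem Approx.step {q : ℕ} {X' : Finset D} {s' : St} (h : Approx A₀ cov S el X s q)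
    (hX : (X \ X').card ≤ 1) (hm : s'.m.length ≤ s.m.length + 1) (hc : s'.cnt = s.cnt - 2) :
    Approx A₀ cov S el X' s' (q + 1) := by
  obtain ⟨W, h₁, h₂, h₃, h₄, h₅⟩ := h
  refine ⟨W, h₁, h₂, ?_, by omega, ?_⟩
  · have : W \ X' ⊆ (W \ X) ∪ (X \ X') := by
      intro d
      simp only [Finset.mem_sdiff, Finset.mem_union]
      tauto
    have := (Finset.card_le_card this).trans (Finset.card_union_le _ _)
    omega
  · rw [hc, h₅]; push_cast; ring

variable (hM : Model A₀ cov S.G₁ S.G₂ el rc ng nc)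
include hM

theorem exists_cov_iff {d : D} : (∃ a ∈ A₀, cov a d) ↔ (scan S.G₁ (el d)).found ≠ none := by
  rw [Ne, hM.found_eq_none]; push Not; rfl

theorem stabEntry_key_ne {d d' : D} (hd : ∃ a ∈ A₀, cov a d) (hd' : ∃ a ∈ A₀, cov a d')
    (hne : d ≠ d') : (stabEntry S.G₁ (el d)).key ≠ (stabEntry S.G₁ (el d')).key := by
  obtain ⟨a, ha, hc⟩ := hd
  obtain ⟨a', ha', hc'⟩ := hd'
  exact fun h => hne (hM.key_injective (hM.probes_ne_nil ha hc) (hM.probes_ne_nil ha' hc') h)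

theorem badEntry_key_ne {d d' : D} (hne : d ≠ d') :
    (badEntry (el d)).key ≠ (badEntry (el d')).key :=
  fun h => hne (hM.id_injective h)

open Classical in
theorem Inv.insert_bad (h : Inv A₀ cov S el X s) {d : D} (hd : (scan S.G₁ (el d)).found = none) :
    Inv A₀ cov S el (insert d X) { s with bad := s.bad.ins (badEntry (el d)) } := by
  have hd' : ¬ ∃ a ∈ A₀, cov a d := by rw [exists_cov_iff hM]; exact not_not.2 hd
  obtain ⟨o₁, o₂⟩ := Tr.ordered_mem_ins (e := badEntry (el d)) h.bad_ordered
  refine ⟨h.ordered, h.balanced, fun e => ?_, o₁, (Tr.balanced_ins h.bad_balanced).1, fun e => ?_,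
    h.counts, h.mem, fun d' h' => ?_⟩
  · rw [h.represents]
    simp only [Finset.mem_insert, or_and_right, exists_or, exists_eq_left]
    exact ⟨.inr, fun h => h.resolve_left fun h => hd' h.1⟩
  · rw [o₂, h.mem_bad]
    constructor
    · rintro (rfl | ⟨⟨d', h₁, h₂, rfl⟩, -⟩)
      · exact ⟨d, Finset.mem_insert_self _ _, hd', rfl⟩
      · exact ⟨d', Finset.mem_insert_of_mem h₁, h₂, rfl⟩
    · rintro ⟨d', h₁, h₂, rfl⟩
      by_cases hne : d' = d
      · exact .inl (hne ▸ rfl)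
      · exact .inr ⟨⟨d', Finset.mem_of_mem_insert_of_ne h₁ hne, h₂, rfl⟩, badEntry_key_ne hM hne⟩
  · rcases Finset.mem_insert.1 h' with rfl | h'
    · exact fun hc => absurd hc hd'
    · exact h.exists_cov d' h'

open Classical in
theorem Inv.insert_stab (h : Inv A₀ cov S el X s) {d : D} {a : Point}
    (hd : (scan S.G₁ (el d)).found = some a) {t : Tr ℕ} (ht : Counts t (a :: s.m)) :
    Inv A₀ cov S el (insert d X)
      { s with T := s.T.ins (stabEntry S.G₁ (el d)), m := a :: s.m, t := t } := by
  obtain ⟨ha, hc⟩ := hM.found_eq_some hd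
  have hd' : ∃ a ∈ A₀, cov a d := ⟨a, ha, hc⟩
  obtain ⟨o₁, o₂⟩ := Tr.ordered_mem_ins (e := stabEntry S.G₁ (el d)) h.ordered
  refine ⟨o₁, (Tr.balanced_ins h.balanced).1, fun e => ?_, h.bad_ordered, h.bad_balanced,
    fun e => ?_, ht, fun b hb => ?_, fun d' h' hc' => ?_⟩
  · rw [o₂, h.represents]
    constructor
    · rintro (rfl | ⟨⟨d', h₁, h₂, rfl⟩, -⟩)
      · exact ⟨d, Finset.mem_insert_self _ _, hd', rfl⟩
      · exact ⟨d', Finset.mem_insert_of_mem h₁, h₂, rfl⟩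
    · rintro ⟨d', h₁, h₂, rfl⟩
      by_cases hne : d' = d
      · exact .inl (hne ▸ rfl)
      · exact .inr ⟨⟨d', Finset.mem_of_mem_insert_of_ne h₁ hne, h₂, rfl⟩,
          stabEntry_key_ne hM h₂ hd' hne⟩
  · rw [h.mem_bad]
    simp only [Finset.mem_insert, or_and_right, exists_or, exists_eq_left]
    exact ⟨.inr, fun h => h.resolve_left fun h => h.1 hd'⟩
  · rcases List.mem_cons.1 hb with rfl | hb
    · exact ha
    · exact h.mem b hb
  · rcases Finset.mem_insert.1 h' with rfl | h'
    · exact ⟨a, List.mem_cons_self, hc⟩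
    · obtain ⟨b, hb, hc⟩ := h.exists_cov d' h' hc'
      exact ⟨b, List.mem_cons_of_mem _ hb, hc⟩

open Classical in
theorem Inv.delete_bad (h : Inv A₀ cov S el X s) {d : D} (hd : (scan S.G₁ (el d)).found = none) :
    Inv A₀ cov S el (X.erase d) { s with bad := s.bad.del (el d).id } := by
  have hd' : ¬ ∃ a ∈ A₀, cov a d := by rw [exists_cov_iff hM]; exact not_not.2 hd
  obtain ⟨o₁, o₂, o₃, -⟩ := Tr.del_spec (k := (el d).id) h.bad_ordered h.bad_balanced
  refine ⟨h.ordered, h.balanced, fun e => ?_, o₁, o₂, fun e => ?_,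
    h.counts, h.mem, fun d' h' => h.exists_cov d' (Finset.mem_of_mem_erase h')⟩
  · rw [h.represents]
    refine exists_congr fun d' => ?_
    rw [Finset.mem_erase]
    constructor
    · rintro ⟨h₁, h₂, h₃⟩
      exact ⟨⟨fun e => hd' (e ▸ h₂), h₁⟩, h₂, h₃⟩
    · rintro ⟨h₁, h₂, h₃⟩
      exact ⟨h₁.2, h₂, h₃⟩
  · rw [o₃, h.mem_bad]
    constructor
    · rintro ⟨⟨d', h₁, h₂, rfl⟩, h₃⟩
      exact ⟨d', Finset.mem_erase.2 ⟨fun e => h₃ (e ▸ rfl), h₁⟩, h₂, rfl⟩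
    · rintro ⟨d', h₁, h₂, rfl⟩
      obtain ⟨hne, h₁⟩ := Finset.mem_erase.1 h₁
      exact ⟨⟨d', h₁, h₂, rfl⟩, badEntry_key_ne hM hne⟩

open Classical in
theorem Inv.delete_stab (h : Inv A₀ cov S el X s) {d : D} {a : Point}
    (hd : (scan S.G₁ (el d)).found = some a) :
    Inv A₀ cov S el (X.erase d) { s with T := s.T.del (stabEntry S.G₁ (el d)).key } := by
  obtain ⟨ha, hc⟩ := hM.found_eq_some hd
  have hd' : ∃ a ∈ A₀, cov a d := ⟨a, ha, hc⟩
  obtain ⟨o₁, o₂, o₃, -⟩ := Tr.del_spec (k := (stabEntry S.G₁ (el d)).key) h.ordered h.balanced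
  refine ⟨o₁, o₂, fun e => ?_, h.bad_ordered, h.bad_balanced, fun e => ?_,
    h.counts, h.mem, fun d' h' => h.exists_cov d' (Finset.mem_of_mem_erase h')⟩
  · rw [o₃, h.represents]
    constructor
    · rintro ⟨⟨d', h₁, h₂, rfl⟩, h₃⟩
      exact ⟨d', Finset.mem_erase.2 ⟨fun e => h₃ (e ▸ rfl), h₁⟩, h₂, rfl⟩
    · rintro ⟨d', h₁, h₂, rfl⟩
      obtain ⟨hne, h₁⟩ := Finset.mem_erase.1 h₁
      exact ⟨⟨d', h₁, h₂, rfl⟩, stabEntry_key_ne hM h₂ hd' hne⟩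
  · rw [h.mem_bad]
    refine exists_congr fun d' => ?_
    rw [Finset.mem_erase]
    constructor
    · rintro ⟨h₁, h₂, h₃⟩
      exact ⟨⟨fun e => h₂ (e ▸ hd'), h₁⟩, h₂, h₃⟩
    · rintro ⟨h₁, h₂, h₃⟩
      exact ⟨h₁.2, h₂, h₃⟩

/-- The last bound holds because the old points still cover all coverable elements, in particular
the disjoint family of the new run. It makes the cost of a new run proportional to the size of the
old solution. -/
theorem Inv.rebuild (h : Inv A₀ cov S el X s) {es : List (Entry Stab)}
    (hes : GreedyRun s.T [] es) {t : Tr ℕ} (ht : Counts t (greedyPoints S.G₂ es [])) :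
    Inv A₀ cov S el X { s with m := greedyPoints S.G₂ es [], t := t, cnt := es.length } ∧
    Approx A₀ cov S el X { s with m := greedyPoints S.G₂ es [], t := t, cnt := es.length } 0 ∧
    es.length ≤ X.card ∧ es.length ≤ 16 * s.m.length := by
  classical
  obtain ⟨g₁, g₂, g₃, W, hW, hWc, w₁, w₂⟩ := hM.greedy_spec h.represents h.ordered hes
  refine ⟨⟨h.ordered, h.balanced, h.represents, h.bad_ordered, h.bad_balanced, h.mem_bad, ht, g₁,
    g₂⟩, ⟨W, w₁, w₂, ?_, ?_, ?_⟩, ?_, ?_⟩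
  · simp [Finset.sdiff_eq_empty_iff_subset.2 hW]
  · simpa [hWc] using g₃
  · simp [hWc]
  · rw [← hWc]; exact Finset.card_le_card hW
  · rw [← hWc, ← Multiset.coe_card]
    exact hM.card_le w₂ (by simpa using h.mem) fun d hd => by
      simpa using h.exists_cov d (hW hd) (w₁ d hd)

/-- The factor is `9 * 16`, from `Approx.card_le` and `Model.card_le`. -/
theorem Approx.length_le {q : ℕ} (h : Approx A₀ cov S el X s q) (hc : 0 ≤ s.cnt)
    {M : Multiset Point} (hA : ∀ a ∈ M, a ∈ A₀) (hcov : ∀ d ∈ X, ∃ a ∈ M, cov a d) :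
    s.m.length ≤ 144 * M.card := by
  obtain ⟨W, hW, -, h₂, h₃⟩ := h.card_le hc
  have := hM.card_le h₂ hA fun d hd => hcov d (hW hd)
  omega

omit hM in
theorem Approx.length_le_card {q : ℕ} (h : Approx A₀ cov S el X s q) (hc : 0 ≤ s.cnt) :
    s.m.length ≤ 9 * X.card := by
  obtain ⟨W, hW, -, -, h₃⟩ := h.card_le hc
  have := Finset.card_le_card hW
  omega

end

/-- The functions `P` describe dynamic elements by `el`, using the static part `S`. -/
structure Prepared (P : List Code) {D : Type} (encD : D → Val) (A₀ : Finset Point)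
    (cov : Point → D → Prop) (S : Static) (el : D → Elem) (K L : ℕ) : Prop where
  core : coreFuns <+: P
  model : ∃ rc ng nc, Model A₀ cov S.G₁ S.G₂ el rc ng nc
  ht₁ : S.G₁.ht ≤ K * L
  ht₂ : S.G₂.ht ≤ K * L
  elem : ∀ d (Φ : Val → ℕ → Prop), (∀ t ≤ K * L, Φ (encElem (el d)) t) →
    wpc P 23 (.cell (encStatic S) (encD d)) Φ

-- Cost of updates and of the construction

section
variable {P : List Code} {D : Type} {encD : D → Val} {A₀ : Finset Point} {cov : Point → D → Prop}
  {S : Static} {el : D → Elem} {K L : ℕ} {X : Finset D} {s : St}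

theorem Tr.ht_le_of_size_le {β : Type} {t : Tr β} (hb : t.Balanced) {n : ℕ} (hn : t.size ≤ n + 1) :
    t.ht ≤ 3 * Nat.log 2 (n + 2) := by
  have := Tr.ht_le hb
  have := Nat.log_mono_right (b := 2) (show t.size + 1 ≤ n + 2 by omega)
  have : 0 < Nat.log 2 (n + 2) := Nat.log_pos (by norm_num) (by omega)
  omega

theorem log_mul_two_pow_le {a n : ℕ} (k : ℕ) (h : a ≤ 2 ^ k * (n + 2)) :
    Nat.log 2 a ≤ Nat.log 2 (n + 2) + k := by
  refine (Nat.log_mono_right h).trans ?_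
  clear h
  induction k with
  | zero => simp
  | succ k ih =>
    rw [show 2 ^ (k + 1) * (n + 2) = 2 ^ k * (n + 2) * 2 by ring,
      Nat.log_mul_base (by norm_num) (by positivity)]
    omega

/-- Costs are measured by the size `n` after an update, whereas `X` is the set before it, which a
deletion allows to be larger by one. -/
theorem Inv.ht_le (h : Inv A₀ cov S el X s) {n : ℕ} (hn : X.card ≤ n + 1) :
    s.T.ht ≤ 3 * Nat.log 2 (n + 2) ∧ s.bad.ht ≤ 3 * Nat.log 2 (n + 2) :=
  ⟨Tr.ht_le_of_size_le h.balanced (h.size_le.trans hn),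
    Tr.ht_le_of_size_le h.bad_balanced (h.bad_size_le.trans hn)⟩

theorem Counts.ht_le_of_length_le {t : Tr ℕ} {l : List Point} (h : Counts t l) {n : ℕ}
    (hn : l.length ≤ 9 * (n + 1)) : t.ht ≤ 11 * Nat.log 2 (n + 2) := by
  have := h.ht_le
  have := log_mul_two_pow_le 4 (show l.length + 1 ≤ 2 ^ 4 * (n + 2) by omega)
  have : 0 < Nat.log 2 (n + 2) := Nat.log_pos (by norm_num) (by omega)
  omega

theorem ret_ifNil_encT {β : Type} {encP : β → Val} {Φ : Val → ℕ → Prop} {env : List Val}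
    {F : List Frame} {n : ℕ} {t : Tr β} {e₁ e₂ : Code}
    (h₁ : t = .nil → ev P Φ env e₁ F (n + 4)) (h₂ : t ≠ .nil → ev P Φ env e₂ F (n + 4)) :
    ret P Φ (.ifNil env e₁ e₂ :: F) (encT encP t) n := by
  rw [ret_ifNil]
  cases t with
  | nil => exact ⟨fun _ => h₁ rfl, fun h => absurd rfl h⟩
  | node l x r => exact ⟨fun h => by simp [encT] at h, fun _ => h₂ (by simp)⟩

variable (hS : Prepared P encD A₀ cov S el K L)
include hS

theorem Prepared.wpc_rebuild (h : Inv A₀ cov S el X s) {n : ℕ} (hL : L ≤ Nat.log 2 (n + 2))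
    (hn : X.card ≤ n) {Φ : Val → ℕ → Prop}
    (hΦ : ∀ s' r, Inv A₀ cov S el X s' → Approx A₀ cov S el X s' 0 → 0 ≤ s'.cnt →
      r ≤ X.card → r ≤ 16 * s.m.length →
      ∀ t ≤ 400000 * (K + 20) * Nat.log 2 (n + 2) * (r + 1), Φ (encSt S s') t) :
    wpc P 19 (encSt S s) Φ := by
  obtain ⟨rc, ng, nc, hM⟩ := hS.model
  have hpos : 0 < Nat.log 2 (n + 2) := Nat.log_pos (by norm_num) (by omega)
  have hKL := Nat.mul_le_mul_left K hL
  have hT := (h.ht_le (hn.trans (Nat.le_succ n))).1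
  have hlog := log_mul_two_pow_le 2 (show 4 * s.T.size + 1 ≤ 2 ^ 2 * (n + 2) by
    have := h.size_le; omega)
  set l := Nat.log 2 (n + 2)
  have hK : (K + 7) * l = K * l + 7 * l := by ring
  refine GeomCover.wpc_rebuild hS.core (h := (K + 7) * l) (by omega)
    (hS.ht₂.trans (by omega)) h.ordered (fun e he => ?_) (by omega) fun es hes t ht t' ht' => ?_
  · obtain ⟨d, -, -, rfl⟩ := (h.represents e).1 he
    exact ⟨hM.key_le_bound d, (el d).probes_le⟩
  · obtain ⟨h₁, h₂, h₃, h₄⟩ := h.rebuild hM hes ht'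
    refine hΦ _ es.length h₁ h₂ (by simp) h₃ h₄ t (ht.trans ?_)
    calc 300100 * (es.length + 1) * ((K + 7) * l + 1)
        ≤ 400000 * (es.length + 1) * ((K + 20) * l) := by
          refine Nat.mul_le_mul (Nat.mul_le_mul_right _ (by norm_num)) ?_
          have : (K + 20) * l = K * l + 20 * l := by ring
          omega
      _ = _ := by ring

/-- The cost of an update that changes the number of updates since the last new solution from `q`
to `q'`, when the size after the update is `n`. -/
def UpdateCost (C n q q' t : ℕ) : Prop :=
  (q' = q + 1 ∧ t ≤ C * Nat.log 2 (n + 2)) ∨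
  (q' = 0 ∧ t ≤ C * Nat.log 2 (n + 2) * (min (144 * (q + 1)) n + 2))

theorem Prepared.ev_tick (h : Inv A₀ cov S el X s) {q : ℕ}
    (hA : Approx A₀ cov S el X { s with cnt := s.cnt - 2 } (q + 1)) {n : ℕ}
    (hL : L ≤ Nat.log 2 (n + 2)) (hn : X.card ≤ n) {env : List Val} {Φ : Val → ℕ → Prop} {τ : ℕ}
    (hτ : τ + 100 ≤ 400000 * (K + 20) * Nat.log 2 (n + 2))
    (hΦ : ∀ s' q', Inv A₀ cov S el X s' → Approx A₀ cov S el X s' q' → 0 ≤ s'.cnt →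
      ∀ t, UpdateCost (400000 * (K + 20)) n q q' t → Φ (encSt S s') t) :
    ev P Φ (encSt S s :: env) codeTick [] τ := by
  simp [codeTick, encSt]
  refine ⟨fun hc => ?_, fun hc => ?_⟩
  · exact hΦ { s with cnt := s.cnt - 2 } (q + 1)
      ⟨h.ordered, h.balanced, h.represents, h.bad_ordered, h.bad_balanced, h.mem_bad, h.counts,
        h.mem, h.exists_cov⟩ hA (by simpa using hc) _ (.inl ⟨rfl, by omega⟩)
  · refine hS.wpc_rebuild h hL hn fun s' r h₁ h₂ h₃ h₄ h₅ t ht => ?_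
    refine hΦ s' 0 h₁ h₂ h₃ _ (.inr ⟨rfl, ?_⟩)
    obtain ⟨W, -, -, -, hm, hcnt⟩ := hA
    -- The counter cannot pay for another update, so `|W| ≤ 2 * q + 1`. The solution then has at
    -- most `4 * |W| + q + 1 ≤ 9 * (q + 1)` points, and the new run has at most `16` times as many
    -- steps.
    have hW : W.card < 2 * q + 2 := by
      have : (W.card : ℝ) < 2 * q + 2 := by
        simp only at hcnt
        push_cast at hcnt
        linarith
      exact_mod_cast this
    have hr : r ≤ min (144 * (q + 1)) n := by
      refine le_min ?_ (h₄.trans hn)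
      simp only at hm
      omega
    have := Nat.mul_le_mul_left (400000 * (K + 20) * Nat.log 2 (n + 2)) (Nat.succ_le_succ hr)
    simp only [Nat.succ_eq_add_one] at this
    rw [show min (144 * (q + 1)) n + 2 = min (144 * (q + 1)) n + 1 + 1 from rfl, mul_add_one]
    omega

open Classical in
theorem Prepared.wp_insert (h : Inv A₀ cov S el X s) {q : ℕ} (hA : Approx A₀ cov S el X s q)
    (hc : 0 ≤ s.cnt) {d : D} {n : ℕ} (hL : L ≤ Nat.log 2 (n + 2)) (hn : (insert d X).card ≤ n)
    {Φ : Val → ℕ → Prop}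
    (hΦ : ∀ s' q', Inv A₀ cov S el (insert d X) s' → Approx A₀ cov S el (insert d X) s' q' →
      0 ≤ s'.cnt → ∀ t, UpdateCost (400000 * (K + 20)) n q q' t → Φ (encSt S s') t) :
    wp P [encSt S s, encD d] (.letIn (.call 17 (.cons (.var 0) (.var 1))) codeTick) Φ := by
  obtain ⟨rc, ng, nc, hM⟩ := hS.model
  have hpos : 0 < Nat.log 2 (n + 2) := Nat.log_pos (by norm_num) (by omega)
  have hKL := Nat.mul_le_mul_left K hL
  have hX : X.card ≤ n := (Finset.card_le_card (Finset.subset_insert d X)).trans hn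
  obtain ⟨hT, hbad⟩ := h.ht_le (hX.trans (Nat.le_succ n))
  have ht := h.counts.ht_le_of_length_le (n := n) ((hA.length_le_card hc).trans (by omega))
  have hC : 400000 * (K + 20) * Nat.log 2 (n + 2) =
    400000 * (K * Nat.log 2 (n + 2)) + 8000000 * Nat.log 2 (n + 2) := by ring
  have h₁ := hS.ht₁
  have hsub : (X \ insert d X).card ≤ 1 := by
    simp [Finset.sdiff_eq_empty_iff_subset.2 (Finset.subset_insert d X)]
  refine wp_of_ev ?_
  simp
  refine wpc_insElem hS.core (hS.elem d) h.counts (fun hd τ hτ => ?_) fun a hd τ hτ t' ht' => ?_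
  · exact hS.ev_tick (h.insert_bad hM hd) (q := q) (hA.step hsub (by simp) rfl) hL hn (by omega) hΦ
  · exact hS.ev_tick (h.insert_stab hM hd ht') (q := q) (hA.step hsub (by simp) rfl) hL hn
      (by omega) hΦ

open Classical in
theorem Prepared.wp_delete (h : Inv A₀ cov S el X s) {q : ℕ} (hA : Approx A₀ cov S el X s q)
    {d : D} {n : ℕ} (hL : L ≤ Nat.log 2 (n + 2)) (hn : (X.erase d).card ≤ n)
    {Φ : Val → ℕ → Prop}
    (hΦ : ∀ s' q', Inv A₀ cov S el (X.erase d) s' → Approx A₀ cov S el (X.erase d) s' q' →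
      0 ≤ s'.cnt → ∀ t, UpdateCost (400000 * (K + 20)) n q q' t → Φ (encSt S s') t) :
    wp P [encSt S s, encD d] (.letIn (.call 18 (.cons (.var 0) (.var 1))) codeTick) Φ := by
  obtain ⟨rc, ng, nc, hM⟩ := hS.model
  have hpos : 0 < Nat.log 2 (n + 2) := Nat.log_pos (by norm_num) (by omega)
  have hKL := Nat.mul_le_mul_left K hL
  have hX : X.card ≤ n + 1 := by
    have := Finset.pred_card_le_card_erase (s := X) (a := d)
    omega
  obtain ⟨hT, hbad⟩ := h.ht_le hX
  have hC : 400000 * (K + 20) * Nat.log 2 (n + 2) =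
    400000 * (K * Nat.log 2 (n + 2)) + 8000000 * Nat.log 2 (n + 2) := by ring
  have h₁ := hS.ht₁
  have hsub : (X \ X.erase d).card ≤ 1 := by
    refine (Finset.card_le_card (t := {d}) fun x hx => ?_).trans (by simp)
    simp only [Finset.mem_sdiff, Finset.mem_erase, Finset.mem_singleton] at hx ⊢
    tauto
  refine wp_of_ev ?_
  simp
  refine wpc_delElem hS.core (hS.elem d) (fun hd τ hτ => ?_) fun a hd τ hτ => ?_
  · exact hS.ev_tick (h.delete_bad hM hd) (q := q) (hA.step hsub (by simp) rfl) hL hn (by omega) hΦ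
  · exact hS.ev_tick (h.delete_stab hM hd) (q := q) (hA.step hsub (by simp) rfl) hL hn
      (by omega) hΦ

open Classical in
/-- The construction, after the static part has been made. -/
theorem Prepared.wpc_build {l : List D} {n : ℕ} (hL : L ≤ Nat.log 2 (n + 2)) (hn : l.length ≤ n)
    {Φ : Val → ℕ → ℕ → Prop}
    (hΦ : ∀ s, Inv A₀ cov S el l.toFinset s → Approx A₀ cov S el l.toFinset s 0 → 0 ≤ s.cnt →
      ∀ t t', t + t' ≤ 800000 * (K + 20) * Nat.log 2 (n + 2) * (n + 1) → Φ (encSt S s) t t') :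
    wpc P 20 (.cell (Val.ofList (l.map encD)) (encSt S ⟨.nil, .nil, [], .nil, 0⟩))
      fun σ t => wpc P 19 σ fun σ' t' => Φ σ' t t' := by
  obtain ⟨rc, ng, nc, hM⟩ := hS.model
  have hpos : 0 < Nat.log 2 (n + 2) := Nat.log_pos (by norm_num) (by omega)
  have hKL := Nat.mul_le_mul_left K hL
  have hC : 400000 * (K + 20) * Nat.log 2 (n + 2) =
    400000 * (K * Nat.log 2 (n + 2)) + 8000000 * Nat.log 2 (n + 2) := by ring
  have h₁ := hS.ht₁
  refine wpc_fold (getElem?_of_prefix hS.core (i := 20) rfl)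
    (fun r σ => ∃ X s, σ = encSt S s ∧ Inv A₀ cov S el X s ∧ X ∪ r.toFinset = l.toFinset ∧
      s.m.length + r.length ≤ l.length ∧ X.card + r.length ≤ l.length)
    -- `wpc_fold` adds 60 steps of its own to each step of the fold; subtracting them here makes the
    -- total a clean product.
    (B := 400000 * (K + 20) * Nat.log 2 (n + 2) - 60) ?_ ?_ ?_
  · rintro d r σ ⟨X, s, rfl, hI, hX, hm, hc⟩ Φ hΦ
    rw [List.length_cons] at hm hc
    rw [List.toFinset_cons, Finset.union_insert, ← Finset.insert_union] at hX
    have hc' := Finset.card_insert_le d X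
    obtain ⟨hT, hbad⟩ := hI.ht_le (n := n) (by omega)
    have ht := hI.counts.ht_le_of_length_le (n := n) (by omega)
    refine wpc_insElem hS.core (hS.elem d) hI.counts (fun hd τ hτ => ?_) fun a hd τ hτ t' ht' => ?_
    · exact hΦ _ (by omega) _ ⟨_, _, rfl, hI.insert_bad hM hd, hX, by simp; omega, by omega⟩
    · exact hΦ _ (by omega) _ ⟨_, _, rfl, hI.insert_stab hM hd ht', hX, by simp; omega, by omega⟩
  · refine ⟨∅, _, rfl, ⟨trivial, trivial, ?_, trivial, trivial, ?_, Counts.nil, ?_, ?_⟩, ?_, ?_, ?_⟩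
    all_goals simp [Represents]
  · rintro t ht σ ⟨X, s, rfl, hI, hX, -, -⟩
    obtain rfl : X = l.toFinset := by simpa using hX
    have hX := List.toFinset_card_le l
    refine hS.wpc_rebuild hI hL (hX.trans hn) fun s' r i₁ i₂ i₃ h₄ _ t' ht' =>
      hΦ s' i₁ i₂ i₃ t t' ?_
    calc t + t' ≤ (400000 * (K + 20) * Nat.log 2 (n + 2)) * (n + 1) +
          400000 * (K + 20) * Nat.log 2 (n + 2) * (n + 1) := by
          refine add_le_add (ht.trans ?_) (ht'.trans ?_)
          · rw [Nat.sub_add_cancel (by omega)]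
            exact Nat.mul_le_mul_left _ (by omega)
          · exact Nat.mul_le_mul_left _ (by omega)
      _ = _ := by ring

end

/-! ### Amortization -/

/-- The instance may have been much smaller during earlier updates, so only the last `⌈p / 2⌉` of
them are charged. Sizes grow by at most one per update and `p` does not exceed the final size, so
throughout this stretch the size was at least about half of the final one and the logarithm at least
half as large. The two halvings give the factor 4. -/
theorem mul_log_le_sum {n : ℕ → ℕ} (hn : ∀ i, n (i + 1) ≤ n i + 1) {i q p : ℕ} (hq : q ≤ i)
    (hp : p ≤ q + 1) (hp' : p ≤ n (i + 1)) :
    p * Nat.log 2 (n (i + 1) + 2) ≤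
      4 * ∑ r ∈ Finset.Ico (i - q) (i + 1), Nat.log 2 (n (r + 1) + 2) := by
  have hsub : Finset.Ico (i + 1 - (p + 1) / 2) (i + 1) ⊆ Finset.Ico (i - q) (i + 1) :=
    Finset.Ico_subset_Ico_left (by omega)
  have hmono : ∀ j k, n (j + k) ≤ n j + k := by
    intro j k
    induction k with
    | zero => simp
    | succ k ih => have := hn (j + k); rw [← add_assoc]; omega
  have hle : ∀ r ∈ Finset.Ico (i + 1 - (p + 1) / 2) (i + 1),
      Nat.log 2 (n (i + 1) + 2) ≤ 2 * Nat.log 2 (n (r + 1) + 2) := by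
    intro r hr
    rw [Finset.mem_Ico] at hr
    have h₁ := hmono (r + 1) (i - r)
    rw [show r + 1 + (i - r) = i + 1 by omega] at h₁
    have h₂ := log_mul_two_pow_le 1 (show n (i + 1) + 2 ≤ 2 ^ 1 * (n (r + 1) + 2) by omega)
    have : 0 < Nat.log 2 (n (r + 1) + 2) := Nat.log_pos (by norm_num) (by omega)
    omega
  have h₁ := Finset.card_nsmul_le_sum _ _ _ hle
  rw [Nat.card_Ico, ← Finset.mul_sum, smul_eq_mul, Nat.sub_sub_self (by omega)] at h₁
  have h₂ := Finset.sum_le_sum_of_subset (f := fun r => Nat.log 2 (n (r + 1) + 2)) hsub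
  have h₃ : p * Nat.log 2 (n (i + 1) + 2) ≤ 2 * ((p + 1) / 2 * Nat.log 2 (n (i + 1) + 2)) := by
    rw [← mul_assoc]
    exact Nat.mul_le_mul_right _ (by omega)
  omega

theorem sum_le_of_updateCost {n q t : ℕ → ℕ} {C : ℕ} (hn : ∀ i, n (i + 1) ≤ n i + 1)
    (hq : q 0 = 0) (h : ∀ i, UpdateCost C (n (i + 1)) (q i) (q (i + 1)) (t i)) (m : ℕ) :
    ∑ i ∈ Finset.range m, t i ≤
      ∑ i ∈ Finset.range m, 578 * C * Nat.log 2 (n (i + 1) + 2) := by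
  set L : ℕ → ℕ := fun i => Nat.log 2 (n (i + 1) + 2) with hL
  -- Every update pays `2 * C` units at once. A further `576 * C = 144 * 4 * C` units are held back
  -- by the `q m` updates since the last new solution, and are spent when the next one is computed.
  have key : ∀ m, q m ≤ m ∧ ∑ i ∈ Finset.range m, t i ≤
      2 * C * ∑ i ∈ Finset.range m, L i + 576 * C * ∑ i ∈ Finset.range (m - q m), L i := by
    intro m
    induction m with
    | zero => simp [hq]
    | succ m ih =>
      obtain ⟨ih₁, ih₂⟩ := ih
      rw [Finset.sum_range_succ, Finset.sum_range_succ, mul_add]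
      rcases h m with ⟨h₁, h₂⟩ | ⟨h₁, h₂⟩
      · refine ⟨by omega, ?_⟩
        rw [h₁, Nat.add_sub_add_right]
        have : C * L m ≤ 2 * C * L m := Nat.mul_le_mul_right _ (by omega)
        change t m ≤ C * L m at h₂
        omega
      · refine ⟨by omega, ?_⟩
        rw [h₁, Nat.sub_zero]
        have h₃ := mul_log_le_sum hn ih₁ (min_le_left (q m + 1) (n (m + 1))) (min_le_right _ _)
        have h₄ := Finset.sum_range_add_sum_Ico L (show m - q m ≤ m + 1 by omega)
        rw [← h₄, mul_add]
        have h₅ : C * L m * (min (144 * (q m + 1)) (n (m + 1)) + 2) ≤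
            2 * C * L m + 144 * C * (min (q m + 1) (n (m + 1)) * L m) := by
          have : min (144 * (q m + 1)) (n (m + 1)) ≤ 144 * min (q m + 1) (n (m + 1)) := by omega
          calc _ ≤ C * L m * (144 * min (q m + 1) (n (m + 1)) + 2) := by gcongr
            _ = _ := by ring
        have h₆ := Nat.mul_le_mul_left (144 * C) h₃
        change t m ≤ C * L m * _ at h₂
        change 144 * C * (min (q m + 1) (n (m + 1)) * L m) ≤
          144 * C * (4 * ∑ r ∈ Finset.Ico (m - q m) (m + 1), L r) at h₆
        rw [show 144 * C * (4 * ∑ r ∈ Finset.Ico (m - q m) (m + 1), L r) =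
          576 * C * ∑ r ∈ Finset.Ico (m - q m) (m + 1), L r by ring] at h₆
        omega
  refine (key m).2.trans ?_
  rw [← Finset.mul_sum]
  have : ∑ i ∈ Finset.range (m - q m), L i ≤ ∑ i ∈ Finset.range m, L i :=
    Finset.sum_le_sum_of_subset (Finset.range_subset_range.2 (by omega))
  calc _ ≤ 2 * C * ∑ i ∈ Finset.range m, L i + 576 * C * ∑ i ∈ Finset.range m, L i := by gcongr
    _ = _ := by ring

/-! ### Queries -/

theorem DataStructure.Maintains.mono {ds : DataStructure} {A : Type} {encA : A → Val}
    {A₀ : Finset A} {IsSol : Multiset A → Prop} {c C C' : ℕ} {σ : Val}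
    (h : ds.Maintains encA A₀ IsSol c C σ) (hC : C ≤ C') : ds.Maintains encA A₀ IsSol c C' σ := by
  refine ⟨fun h' => ?_, fun h' => ?_⟩
  · obtain ⟨t, ht, hr⟩ := h.1 h'
    exact ⟨t, ht.trans hC, hr⟩
  · obtain ⟨M, h₁, h₂, ⟨t, ht, hr⟩, h₃, l, hl, t', ht', hr'⟩ := h.2 h'
    refine ⟨M, h₁, h₂, ⟨t, ht.trans hC, hr⟩, fun a ha => ?_, l, hl, t', ?_, hr'⟩
    · obtain ⟨s, hs, hrs⟩ := h₃ a ha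
      exact ⟨s, hs.trans (Nat.mul_le_mul_right _ hC), hrs⟩
    · exact ht'.trans (Nat.mul_le_mul_right _ hC)

theorem exists_map_eq_of_forall_mem {α β : Type} {f : α → β} {p : α → Prop} {l : List β}
    (h : ∀ b ∈ l, ∃ a, p a ∧ f a = b) : ∃ k : List α, k.map f = l ∧ ∀ a ∈ k, p a := by
  induction l with
  | nil => exact ⟨[], rfl, by simp⟩
  | cons b l ih =>
    obtain ⟨k, h₁, h₂⟩ := ih fun b hb => h b (List.mem_cons_of_mem _ hb)
    obtain ⟨a, ha, rfl⟩ := h b List.mem_cons_self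
    exact ⟨a :: k, by rw [List.map_cons, h₁], List.forall_mem_cons.2 ⟨ha, h₂⟩⟩

section
variable {D A : Type} {encA : A → Val} {pt : A → Point} {fs : List Code} {A₀ : Finset Point}
  {B₀ : Finset A} {cov : Point → D → Prop} {S : Static} {el : D → Elem} {X : Finset D} {s : St}

theorem runs_size (h : s.bad = .nil) : ∃ t ≤ 10000,
    Runs (mkDataStructure fs).funs [encSt S s] (mkDataStructure fs).size (.num s.m.length) t := by
  suffices wp (mkDataStructure fs).funs [encSt S s] (mkDataStructure fs).size
      fun v t => v = .num s.m.length ∧ t ≤ 10000 by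
    obtain ⟨v, t, h₁, rfl, h₂⟩ := this
    exact ⟨t, h₂, h₁⟩
  refine wp_of_ev ?_
  simp [mkDataStructure, encSt]
  rw [h]
  simp [encT, encM]

theorem runs_size_nil (h : s.bad ≠ .nil) : ∃ t ≤ 10000,
    Runs (mkDataStructure fs).funs [encSt S s] (mkDataStructure fs).size .nil t := by
  suffices wp (mkDataStructure fs).funs [encSt S s] (mkDataStructure fs).size
      fun v t => v = .nil ∧ t ≤ 10000 by
    obtain ⟨v, t, h₁, rfl, h₂⟩ := this
    exact ⟨t, h₂, h₁⟩
  refine wp_of_ev ?_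
  simp [mkDataStructure, encSt]
  refine ret_ifNil_encT (fun h' => absurd h' h) fun _ => ?_
  simp

open Classical in
theorem runs_member (h : Counts s.t s.m) (a : Point) :
    ∃ t ≤ 10000 * (Nat.log 2 s.m.length + 1),
      Runs (mkDataStructure fs).funs [encSt S s, encodePoint a] (mkDataStructure fs).member
        (.num (s.m.count a : ℝ)) t := by
  suffices wp (mkDataStructure fs).funs [encSt S s, encodePoint a] (mkDataStructure fs).member
      fun v t => v = .num (s.m.count a : ℝ) ∧ t ≤ 10000 * (Nat.log 2 s.m.length + 1) by
    obtain ⟨v, t, h₁, rfl, h₂⟩ := this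
    exact ⟨t, h₂, h₁⟩
  refine wp_of_ev ?_
  have hlog : Nat.log 2 (s.m.length + 1) ≤ Nat.log 2 s.m.length + 1 := by
    rcases Nat.eq_zero_or_pos s.m.length with h | h
    · simp [h]
    · rw [← Nat.log_mul_base (by norm_num) (by omega)]
      exact Nat.log_mono_right (by omega)
  have hht := h.ht_le
  have hpre : coreFuns <+: (mkDataStructure fs).funs := List.prefix_append _ _
  rw [← h.count a]
  simp [mkDataStructure, encSt, encM, encodePoint]
  refine wpc_find encN (treeFuns_prefix hpre) (k := ptKey a) fun t ht => ?_
  cases hf : s.t.find (ptKey a) with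
  | none =>
    simp
    omega
  | some e =>
    simp [encN]
    omega

theorem runs_report : ∃ t ≤ 10000 * (s.m.length + 1),
    Runs (mkDataStructure fs).funs [encSt S s] (mkDataStructure fs).report
      (Val.ofList (s.m.map encodePoint)) t := by
  suffices wp (mkDataStructure fs).funs [encSt S s] (mkDataStructure fs).report
      fun v t => v = Val.ofList (s.m.map encodePoint) ∧ t ≤ 10000 * (s.m.length + 1) by
    obtain ⟨v, t, h₁, rfl, h₂⟩ := this
    exact ⟨t, h₂, h₁⟩
  refine wp_of_ev ?_
  simp [mkDataStructure, encSt, encM]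
  omega

/-- The state stores points, while the problem may ask for squares. As the map `pt` is injective and
respects the encodings, the stored list lifts to static elements with the same multiplicities. A
solution exists exactly if `s.bad` is empty. -/
theorem maintains {P : List Code} {encD : D → Val} {K L : ℕ} (hpt : Function.Injective pt)
    (henc : ∀ a, encA a = encodePoint (pt a)) (hA : ∀ a, a ∈ A₀ ↔ ∃ b ∈ B₀, pt b = a)
    {IsSol : Multiset A → Prop}
    (hSol : ∀ M, IsSol M ↔ (∀ b ∈ M, b ∈ B₀) ∧ ∀ d ∈ X, ∃ b ∈ M, cov (pt b) d)
    (hS : Prepared P encD A₀ cov S el K L) (hI : Inv A₀ cov S el X s) {q : ℕ}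
    (hq : Approx A₀ cov S el X s q) (hc : 0 ≤ s.cnt) :
    (mkDataStructure fs).Maintains encA B₀ IsSol 144 10000 (encSt S s) := by
  classical
  obtain ⟨rc, ng, nc, hM⟩ := hS.model
  have hbad : ∀ {d}, d ∈ X → s.bad = .nil → ∃ a ∈ A₀, cov a d := by
    intro d hd h
    by_contra hne
    have := (hI.mem_bad (badEntry (el d))).2 ⟨d, hd, hne, rfl⟩
    rw [h] at this
    exact this
  obtain ⟨m, hm, hmB⟩ := exists_map_eq_of_forall_mem (f := pt) (p := (· ∈ B₀)) fun a ha =>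
    (hA a).1 (hI.mem a ha)
  have hsol : s.bad = .nil → IsSol m := by
    refine fun h => (hSol _).2 ⟨by simpa using hmB, fun d hd => ?_⟩
    obtain ⟨a, ha, hca⟩ := hI.exists_cov d hd (hbad hd h)
    rw [← hm, List.mem_map] at ha
    obtain ⟨b, hb, rfl⟩ := ha
    exact ⟨b, by simpa using hb, hca⟩
  have hlen : s.m.length = m.length := by rw [← hm, List.length_map]
  refine ⟨fun h => runs_size_nil fun h' => h ⟨_, hsol h'⟩, fun ⟨M, hMs⟩ => ?_⟩
  have hnil : s.bad = .nil := by
    cases hb : s.bad with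
    | nil => rfl
    | node l e r =>
      have he : e ∈ s.bad := by rw [hb]; exact .inr (.inl rfl)
      obtain ⟨d, hd, hne, -⟩ := (hI.mem_bad e).1 he
      obtain ⟨h₁, h₂⟩ := (hSol M).1 hMs
      obtain ⟨b, hb, hcb⟩ := h₂ d hd
      exact absurd ⟨_, (hA _).2 ⟨b, h₁ b hb, rfl⟩, hcb⟩ hne
  refine ⟨m, hsol hnil, fun M' hM' => ?_, ?_, fun b hb => ?_, m, rfl, ?_⟩
  · obtain ⟨h₁, h₂⟩ := (hSol M').1 hM'
    have := hq.length_le hM hc (M := M'.map pt) (fun a ha => ?_) fun d hd => ?_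
    · simpa [hlen] using this
    · obtain ⟨b, hb, rfl⟩ := Multiset.mem_map.1 ha
      exact (hA _).2 ⟨b, h₁ b hb, rfl⟩
    · obtain ⟨b, hb, hcb⟩ := h₂ d hd
      exact ⟨_, Multiset.mem_map_of_mem pt hb, hcb⟩
  · rw [Multiset.coe_card, ← hlen]
    exact runs_size hnil
  · have := runs_member (fs := fs) (S := S) hI.counts (pt b)
    rw [Multiset.coe_card, ← hlen, henc, Multiset.coe_count]
    rw [← hm, List.count_map_of_injective _ _ hpt] at this
    convert this using 5
    rw [hm]
  · rw [Multiset.coe_card, ← hlen]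
    have := runs_report (fs := fs) (S := S) (s := s)
    rw [← hm, List.map_map, hm] at this
    rwa [show encA = encodePoint ∘ pt from funext henc]

end

-- From a description of the elements to a data structure

/-- The functions `fs` describe dynamic elements and make the static part of the state, so that the
relation `cov` is described. -/
def Implements (fs : List Code) {D : Type} (encD : D → Val) (cov : Point → D → Prop) (K : ℕ) :
    Prop :=
  ∀ (l : List Point) (A₀ : Finset Point), (∀ a, a ∈ A₀ ↔ a ∈ l) → ∃ (S : Static) (el : D → Elem),
    Prepared (coreFuns ++ fs) encD A₀ cov S el K (Nat.log 2 (l.length + 2)) ∧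
    ∀ Φ : Val → ℕ → Prop,
      (∀ t ≤ K * (l.length + 1) * Nat.log 2 (l.length + 2), Φ (encStatic S) t) →
      wpc (coreFuns ++ fs) 24 (Val.ofList (l.map encodePoint)) Φ

open Classical in
theorem card_apply_le {D : Type} (u : Update D) (X : Finset D) : (u.apply X).card ≤ X.card + 1 := by
  cases u with
  | insert d => exact Finset.card_insert_le d X
  | delete d => exact (Finset.card_erase_le).trans (Nat.le_succ _)

/-- Used for the sequence of states along a sequence of updates, each paired with the number of
updates since the last new solution. -/
theorem exists_dependent_seq {α β : Type} (p : ℕ → α → Prop) (r : ℕ → α → α → β → Prop) {a : α}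
    (ha : p 0 a) (h : ∀ i a, p i a → ∃ a' b, p (i + 1) a' ∧ r i a a' b) :
    ∃ (f : ℕ → α) (g : ℕ → β), f 0 = a ∧ (∀ i, p i (f i)) ∧ ∀ i, r i (f i) (f (i + 1)) (g i) := by
  choose F G hF hG using h
  let f : ∀ i, {a // p i a} :=
    Nat.rec (motive := fun i => {a // p i a}) ⟨a, ha⟩ fun i x => ⟨F i x x.2, hF i x x.2⟩
  exact ⟨fun i => (f i).1, fun i => G i (f i).1 (f i).2, rfl, fun i => (f i).2,
    fun i => hG i (f i).1 (f i).2⟩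

/-- The generic data structure works for every relation that can be described. -/
theorem Implements.isPartiallyDynamic {fs : List Code} {D A : Type} {encD : D → Val}
    {cov : Point → D → Prop} {K : ℕ} (h : Implements fs encD cov K) {encA : A → Val}
    {pt : A → Point} (hpt : Function.Injective pt) (henc : ∀ a, encA a = encodePoint (pt a))
    {IsSol : Finset D → Finset A → Multiset A → Prop}
    (hSol : ∀ X B₀ M, IsSol X B₀ M ↔ (∀ b ∈ M, b ∈ B₀) ∧ ∀ d ∈ X, ∃ b ∈ M, cov (pt b) d) :
    IsPartiallyDynamic (mkDataStructure fs) encD encA IsSol 144 (578 * (400000 * (K + 20))) 1 := by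
  classical
  intro l l' _ _ u
  obtain ⟨S, el, hS, hstatic⟩ := h (l'.map pt) (l'.map pt).toFinset (by simp)
  rw [List.length_map] at hS hstatic
  set X := current l.toFinset u with hX
  set n : ℕ → ℕ := fun i => (X i).card + l'.length with hn
  have hL : ∀ k, Nat.log 2 (l'.length + 2) ≤ Nat.log 2 (k + l'.length + 2) := fun k =>
    Nat.log_mono_right (by omega)
  have hbuild : wp (mkDataStructure fs).funs
      [Val.ofList (l.map encD), Val.ofList (l'.map encA)] (mkDataStructure fs).build fun σ t =>
        (∃ s, σ = encSt S s ∧ Inv (l'.map pt).toFinset cov S el (X 0) s ∧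
          Approx (l'.map pt).toFinset cov S el (X 0) s 0 ∧ 0 ≤ s.cnt) ∧
        t ≤ 578 * (400000 * (K + 20)) * (l.length + l'.length + 1) *
          Nat.log 2 (l.length + l'.length + 2) ^ 1 := by
    refine wp_of_ev ?_
    have henc' : encSt S ⟨.nil, .nil, [], .nil, 0⟩ = .cell (encStatic S) (.cell .nil
        (.cell .nil (.cell (.cell (.num 0) (.cell .nil .nil)) (.num 0)))) := by
      simp [encSt, encM, Val.ofList]
    simp [mkDataStructure]
    rw [show l'.map encA = (l'.map pt).map encodePoint by simp [funext henc]]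
    refine hstatic _ fun t₁ ht₁ => ?_
    rw [← henc']
    refine hS.wpc_build (hL l.length) (Nat.le_add_right _ _) fun s h₁ h₂ h₃ t t' ht => ?_
    refine ⟨⟨s, rfl, h₁, h₂, h₃⟩, ?_⟩
    have h₄ : K * (l'.length + 1) * Nat.log 2 (l'.length + 2) ≤
        (K + 20) * (l.length + l'.length + 1) * Nat.log 2 (l.length + l'.length + 2) := by
      gcongr <;> omega
    have h₅ : 0 < (K + 20) * (l.length + l'.length + 1) * Nat.log 2 (l.length + l'.length + 2) :=
      Nat.mul_pos (by positivity) (Nat.log_pos (by norm_num) (by omega))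
    have h₆ : 800000 * (K + 20) * Nat.log 2 (l.length + l'.length + 2) *
      (l.length + l'.length + 1) = 800000 * ((K + 20) * (l.length + l'.length + 1) *
        Nat.log 2 (l.length + l'.length + 2)) := by ring
    rw [show 578 * (400000 * (K + 20)) * (l.length + l'.length + 1) *
      Nat.log 2 (l.length + l'.length + 2) = 231200000 * ((K + 20) * (l.length + l'.length + 1) *
        Nat.log 2 (l.length + l'.length + 2)) by ring]
    omega
  obtain ⟨σ₀, t₀, hrun, hσ₀, ht₀⟩ := hbuild
  obtain ⟨f, t, hf₀, hf, hft⟩ := exists_dependent_seq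
    (p := fun i (x : Val × ℕ) => ∃ s, x.1 = encSt S s ∧
      Inv (l'.map pt).toFinset cov S el (X i) s ∧
      Approx (l'.map pt).toFinset cov S el (X i) s x.2 ∧ 0 ≤ s.cnt)
    (r := fun i x x' t => (mkDataStructure fs).RunsUpdate encD (u i) x.1 x'.1 t ∧
      UpdateCost (400000 * (K + 20)) (n (i + 1)) x.2 x'.2 t) (a := (σ₀, 0)) hσ₀ <| by
    rintro i ⟨σ, q⟩ ⟨s, rfl, h₁, h₂, h₃⟩
    have hcur : X (i + 1) = (u i).apply (X i) := rfl
    cases hu : u i with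
    | insert d =>
      rw [hu] at hcur
      obtain ⟨v, t, hr, s', q', rfl, h₄⟩ := hS.wp_insert h₁ h₂ h₃ (d := d) (n := n (i + 1))
        (hL _) (by simp only [hn, hcur]; exact Nat.le_add_right _ _)
        (Φ := fun v t => ∃ s' q', v = encSt S s' ∧ Inv (l'.map pt).toFinset cov S el (X (i + 1)) s' ∧
          Approx (l'.map pt).toFinset cov S el (X (i + 1)) s' q' ∧ 0 ≤ s'.cnt ∧
          UpdateCost (400000 * (K + 20)) (n (i + 1)) q q' t)
        fun s' q' i₁ i₂ i₃ t ht => ⟨s', q', rfl, by rw [hcur]; exact i₁, by rw [hcur]; exact i₂, i₃, ht⟩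
      exact ⟨(_, q'), t, ⟨s', rfl, h₄.1, h₄.2.1, h₄.2.2.1⟩, hr, h₄.2.2.2⟩
    | delete d =>
      rw [hu] at hcur
      obtain ⟨v, t, hr, s', q', rfl, h₄⟩ := hS.wp_delete h₁ h₂ (d := d) (n := n (i + 1))
        (hL _) (by simp only [hn, hcur]; exact Nat.le_add_right _ _)
        (Φ := fun v t => ∃ s' q', v = encSt S s' ∧ Inv (l'.map pt).toFinset cov S el (X (i + 1)) s' ∧
          Approx (l'.map pt).toFinset cov S el (X (i + 1)) s' q' ∧ 0 ≤ s'.cnt ∧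
          UpdateCost (400000 * (K + 20)) (n (i + 1)) q q' t)
        fun s' q' i₁ i₂ i₃ t ht => ⟨s', q', rfl, by rw [hcur]; exact i₁, by rw [hcur]; exact i₂, i₃, ht⟩
      exact ⟨(_, q'), t, ⟨s', rfl, h₄.1, h₄.2.1, h₄.2.2.1⟩, hr, h₄.2.2.2⟩
  refine ⟨fun i => (f i).1, t₀, t, by simpa only [hf₀] using hrun, ht₀, fun i => (hft i).1, fun m => ?_,
    fun i => ?_⟩
  · have hstep : ∀ i, n (i + 1) ≤ n i + 1 := fun i => by
      have : (X (i + 1)).card ≤ (X i).card + 1 := card_apply_le (u i) (X i)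
      simp only [hn]
      omega
    simpa only [pow_one] using
      sum_le_of_updateCost (q := fun i => (f i).2) hstep (by simp [hf₀]) (fun i => (hft i).2) m
  · obtain ⟨s, hs, h₁, h₂, h₃⟩ := hf i
    have := maintains (fs := fs) (B₀ := l'.toFinset) hpt henc (by simp)
      (hSol (X i) l'.toFinset) hS h₁ h₂ h₃
    simp only [hs]
    exact this.mono (by omega)

/-! ### Construction of the static part -/

/-- Trees that store the records of `R`, made by at most `k` insertions. -/
structure Built (G₁ G₂ : Tr (ℝ × Point)) (R : Set Rec) (n k : ℕ) : Prop where
  stores : Stores G₁ G₂ R n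
  balanced₁ : G₁.Balanced
  balanced₂ : G₂.Balanced
  size₁ : G₁.size ≤ k
  size₂ : G₂.size ≤ k

theorem Built.nil (n : ℕ) : Built .nil .nil ∅ n 0 := by
  refine ⟨⟨trivial, trivial, ?_, ?_, ?_⟩, trivial, trivial, le_rfl, le_rfl⟩ <;> simp

/-- Keys contain the group and the point, which by `hR` determine the record. So an insertion never
displaces a different record. -/
theorem Built.insert {G₁ G₂ : Tr (ℝ × Point)} {R : Set Rec} {n k : ℕ} (h : Built G₁ G₂ R n k)
    {r : Rec} (hr : r.grp.length = n)
    (hR : ∀ r' ∈ R, r'.grp = r.grp → r'.a = r.a → r' = r) :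
    Built (G₁.ins r.entryH) (G₂.ins r.entryC) (insert r R) n (k + 1) := by
  obtain ⟨⟨s₁, s₂, s₃, s₄, s₅⟩, b₁, b₂, k₁, k₂⟩ := h
  obtain ⟨o₁, m₁⟩ := Tr.ordered_mem_ins (e := r.entryH) s₁
  obtain ⟨o₂, m₂⟩ := Tr.ordered_mem_ins (e := r.entryC) s₂
  have key : ∀ r' ∈ R, ∀ x x' : ℝ,
      r'.grp ++ [x', r'.a.1, r'.a.2] = r.grp ++ [x, r.a.1, r.a.2] → r' = r := by
    intro r' hr' x x' he
    obtain ⟨e₁, e₂⟩ := List.append_inj he ((s₅ r' hr').trans hr.symm)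
    simp only [List.cons.injEq, and_true] at e₂
    exact hR r' hr' e₁ (Prod.ext e₂.2.1 e₂.2.2)
  refine ⟨⟨o₁, o₂, fun e => ?_, fun e => ?_, ?_⟩, (Tr.balanced_ins b₁).1, (Tr.balanced_ins b₂).1,
    Tr.size_ins.trans (by omega), Tr.size_ins.trans (by omega)⟩
  · rw [m₁, s₃]
    constructor
    · rintro (rfl | ⟨⟨r', hr', rfl⟩, -⟩)
      · exact ⟨r, Set.mem_insert _ _, rfl⟩
      · exact ⟨r', Set.mem_insert_of_mem _ hr', rfl⟩
    · rintro ⟨r', hr' | hr', rfl⟩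
      · exact .inl (hr' ▸ rfl)
      · by_cases he : r'.entryH.key = r.entryH.key
        · exact .inl (key r' hr' _ _ he ▸ rfl)
        · exact .inr ⟨⟨r', hr', rfl⟩, he⟩
  · rw [m₂, s₄]
    constructor
    · rintro (rfl | ⟨⟨r', hr', rfl⟩, -⟩)
      · exact ⟨r, Set.mem_insert _ _, rfl⟩
      · exact ⟨r', Set.mem_insert_of_mem _ hr', rfl⟩
    · rintro ⟨r', hr' | hr', rfl⟩
      · exact .inl (hr' ▸ rfl)
      · by_cases he : r'.entryC.key = r.entryC.key
        · exact .inl (key r' hr' _ _ he ▸ rfl)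
        · exact .inr ⟨⟨r', hr', rfl⟩, he⟩
  · rintro r' (rfl | hr')
    · exact hr
    · exact s₅ r' hr'

theorem Built.mono {G₁ G₂ : Tr (ℝ × Point)} {R : Set Rec} {n k k' : ℕ} (h : Built G₁ G₂ R n k)
    (hk : k ≤ k') : Built G₁ G₂ R n k' :=
  ⟨h.stores, h.balanced₁, h.balanced₂, h.size₁.trans hk, h.size₂.trans hk⟩

theorem Built.ht_le {G₁ G₂ : Tr (ℝ × Point)} {R : Set Rec} {n k : ℕ} (h : Built G₁ G₂ R n k)
    {m : ℕ} (hk : k ≤ 16 * m) :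
    G₁.ht ≤ 11 * Nat.log 2 (m + 2) ∧ G₂.ht ≤ 11 * Nat.log 2 (m + 2) := by
  have h₁ := Tr.ht_le h.balanced₁
  have h₂ := Tr.ht_le h.balanced₂
  have := h.size₁
  have := h.size₂
  have := log_mul_two_pow_le 4 (show G₁.size + 1 ≤ 2 ^ 4 * (m + 2) by omega)
  have := log_mul_two_pow_le 4 (show G₂.size + 1 ≤ 2 ^ 4 * (m + 2) by omega)
  have : 0 < Nat.log 2 (m + 2) := Nat.log_pos (by norm_num) (by omega)
  omega

/-- Machine representation of a record without its point. -/
def encRec (r : Rec) : Val := .cell (encL r.grp) (.cell (.num r.c) (.num r.h))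

/-- The static part of a state, for a list of points. -/
def codeStatic : Code :=
  .letIn (.call 30 (.var 0))
    (.letIn (.call 25 (.cons (.var 1) (.cons (.var 0) (.cons .nil .nil))))
      (.cons (snd (.var 0)) (fst (.var 0))))

/-- Addition of a point to the static part. -/
def codePoint : Code :=
  let aux := fst (fst (.var 0))
  .cons aux (snd (.call 27 (.cons (.call 29 (.cons aux (snd (.var 0))))
    (.cons (snd (.var 0)) (snd (fst (.var 0)))))))

/-- Addition of a record of a point. -/
def codeAddTo : Code := .cons (fst (fst (.var 0))) (.call 21 (.cons (snd (.var 0)) (fst (.var 0))))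

/-- The functions that describe dynamic elements and make the static part of a state: `E` describes
an element, `R` lists the records of a point and `A` makes the auxiliary part. -/
def staticFuns (E R A : Code) (fs : List Code) : List Code :=
  E :: codeStatic :: codeFold 25 26 :: codePoint :: codeFold 27 28 :: codeAddTo :: R :: A :: fs

section
variable {E R A : Code} {fs : List Code} {A₀ : Finset Point} {rc : Point → Fin 16 → Rec} {n : ℕ}

theorem wpc_point {P : List Code} (hP : coreFuns ++ staticFuns E R A fs <+: P) {m K : ℕ} {aux : Val}
    (hrc : ∀ a i, (rc a i).a = a) (hlen : ∀ a ∈ A₀, ∀ i, (rc a i).grp.length = n)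
    (hgrp : ∀ a i j, (rc a i).grp = (rc a j).grp → rc a i = rc a j) {a : Point} (ha : a ∈ A₀)
    {rs : List Rec} (hrs : rs.length ≤ 16) (hmem : ∀ r, r ∈ rs ↔ ∃ i, rc a i = r)
    (hrec : ∀ Φ : Val → ℕ → Prop,
      (∀ t ≤ K * Nat.log 2 (m + 2), Φ (Val.ofList (rs.map encRec)) t) →
        wpc P 29 (.cell aux (encodePoint a)) Φ)
    {G₁ G₂ : Tr (ℝ × Point)} {R₀ : Set Rec} {k : ℕ} (hB : Built G₁ G₂ R₀ n k)
    (hR₀ : ∀ r ∈ R₀, ∃ a i, rc a i = r) (hk : k + 16 ≤ 16 * m) {Φ : Val → ℕ → Prop}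
    (hΦ : ∀ t ≤ (K + 13000000) * Nat.log 2 (m + 2), ∀ G₁' G₂',
      Built G₁' G₂' (R₀ ∪ {r | ∃ i, rc a i = r}) n (k + 16) →
        Φ (.cell aux (.cell (encT encR G₁') (encT encR G₂'))) t) :
    wpc P 26 (.cell (.cell aux (.cell (encT encR G₁) (encT encR G₂))) (encodePoint a)) Φ := by
  have hcore : coreFuns <+: P := (List.prefix_append _ _).trans hP
  have hpos : 0 < Nat.log 2 (m + 2) := Nat.log_pos (by norm_num) (by omega)
  refine wpc_of_ev (getElem?_of_prefix hP (i := 26) rfl) ?_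
  simp [codePoint]
  refine hrec _ fun t₁ ht₁ => ?_
  -- Both trees have height at most `11 * log`, so a record costs `30000 * 24 * log` steps and a
  -- little overhead.
  refine wpc_fold (getElem?_of_prefix hP (i := 27) rfl) (enc := encRec)
    (fun l σ => ∃ G₁ G₂ R' k', σ = .cell (encodePoint a) (.cell (encT encR G₁) (encT encR G₂)) ∧
      Built G₁ G₂ R' n k' ∧ k' + l.length ≤ k + 16 ∧
      (∀ r ∈ l, ∃ i, rc a i = r) ∧ R' ∪ {r | r ∈ l} = R₀ ∪ {r | ∃ i, rc a i = r}) (B := 720100 * Nat.log 2 (m + 2)) ?_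
    ⟨G₁, G₂, R₀, k, rfl, hB, by omega, fun r => (hmem r).1, by simp only [hmem]⟩ ?_
  · rintro r l σ ⟨G₁, G₂, R', k', rfl, hB, hk', hl, hR'⟩ Φ hΦ
    rw [List.length_cons] at hk'
    obtain ⟨i, rfl⟩ := hl r List.mem_cons_self
    obtain ⟨h₁, h₂⟩ := hB.ht_le (m := m) (by omega)
    refine wpc_of_ev (getElem?_of_prefix hP (i := 28) rfl) ?_
    simp [codeAddTo, encRec]
    have hadd := fun Φ => wpc_addRec hcore (r := rc a i) (G₁ := G₁) (G₂ := G₂) (Φ := Φ)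
    rw [hrc] at hadd
    refine hadd _ fun t ht => ?_
    refine hΦ _ (by omega) _ ⟨_, _, _, k' + 1, rfl, hB.insert (hlen a ha i) fun r' hr' e₁ e₂ => ?_,
      by omega, fun r hr => hl r (List.mem_cons_of_mem _ hr), ?_⟩
    · obtain ⟨a', j, rfl⟩ : ∃ a j, rc a j = r' := by
        have : r' ∈ R₀ ∪ {r | ∃ i, rc a i = r} := hR' ▸ (.inl hr')
        rcases this with h | ⟨j, h⟩
        · exact hR₀ r' h
        · exact ⟨a, j, h⟩
      rw [hrc, hrc] at e₂
      subst e₂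
      exact hgrp a' j i e₁
    · rw [← hR']
      ext r
      simp only [Set.mem_union, Set.mem_insert_iff, Set.mem_ofPred_eq, List.mem_cons]
      tauto
  · rintro t₂ ht₂ σ ⟨G₁', G₂', R', k', rfl, hB', hk', -, hR'⟩
    simp
    obtain rfl : R' = R₀ ∪ {r | ∃ i, rc a i = r} := by simpa using hR'
    refine hΦ _ ?_ _ _ (hB'.mono (by simpa using hk'))
    have h₁ : (720100 * Nat.log 2 (m + 2) + 60) * (rs.length + 1) ≤
      (720100 * Nat.log 2 (m + 2) + 60) * 17 := Nat.mul_le_mul_left _ (by omega)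
    have h₂ : (K + 13000000) * Nat.log 2 (m + 2) =
      K * Nat.log 2 (m + 2) + 13000000 * Nat.log 2 (m + 2) := by ring
    omega

theorem wpc_static {l : List Point} (hA₀ : ∀ a, a ∈ A₀ ↔ a ∈ l) {aux : Val} {K : ℕ}
    (hrc : ∀ a i, (rc a i).a = a)
    (hlen : ∀ a ∈ A₀, ∀ i, (rc a i).grp.length = n)
    (hgrp : ∀ a i j, (rc a i).grp = (rc a j).grp → rc a i = rc a j)
    (haux : ∀ Φ : Val → ℕ → Prop, (∀ t ≤ K * (l.length + 1) * Nat.log 2 (l.length + 2), Φ aux t) →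
      wpc (coreFuns ++ staticFuns E R A fs) 30 (Val.ofList (l.map encodePoint)) Φ)
    (hrec : ∀ a ∈ A₀, ∃ rs : List Rec, rs.length ≤ 16 ∧ (∀ r, r ∈ rs ↔ ∃ i, rc a i = r) ∧
      ∀ Φ : Val → ℕ → Prop,
        (∀ t ≤ K * Nat.log 2 (l.length + 2), Φ (Val.ofList (rs.map encRec)) t) →
        wpc (coreFuns ++ staticFuns E R A fs) 29 (.cell aux (encodePoint a)) Φ) :
    ∃ S : Static, S.aux = aux ∧ Stores S.G₁ S.G₂ {r | ∃ a ∈ A₀, ∃ i, rc a i = r} n ∧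
      S.G₁.ht ≤ 11 * Nat.log 2 (l.length + 2) ∧ S.G₂.ht ≤ 11 * Nat.log 2 (l.length + 2) ∧
      ∀ Φ : Val → ℕ → Prop,
        (∀ t ≤ (2 * K + 20000000) * (l.length + 1) * Nat.log 2 (l.length + 2),
          Φ (encStatic S) t) →
        wpc (coreFuns ++ staticFuns E R A fs) 24 (Val.ofList (l.map encodePoint)) Φ := by
  set P := coreFuns ++ staticFuns E R A fs with hP
  have hpos : 0 < Nat.log 2 (l.length + 2) := Nat.log_pos (by norm_num) (by omega)
  -- The shape of the trees depends on the order of insertions, so the static part is read off from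
  -- the run itself.
  suffices wpc P 24 (Val.ofList (l.map encodePoint)) fun σ t => ∃ S : Static, σ = encStatic S ∧
      S.aux = aux ∧ Stores S.G₁ S.G₂ {r | ∃ a ∈ A₀, ∃ i, rc a i = r} n ∧
      S.G₁.ht ≤ 11 * Nat.log 2 (l.length + 2) ∧ S.G₂.ht ≤ 11 * Nat.log 2 (l.length + 2) ∧
      t ≤ (2 * K + 20000000) * (l.length + 1) * Nat.log 2 (l.length + 2) by
    obtain ⟨b, hb, v, t, hr, S, rfl, h₁, h₂, h₃, h₄, ht⟩ := this
    exact ⟨S, h₁, h₂, h₃, h₄, fun Φ hΦ => ⟨b, hb, _, t, hr, hΦ t ht⟩⟩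
  refine wpc_of_ev (body := codeStatic) rfl ?_
  simp [codeStatic, -Prod.exists]
  refine haux _ fun t₁ ht₁ => ?_
  refine wpc_fold (f := 25) (g := 26) rfl (enc := encodePoint)
    (fun r σ => ∃ G₁ G₂ R' k, σ = .cell aux (.cell (encT encR G₁) (encT encR G₂)) ∧
      Built G₁ G₂ R' n k ∧ k + 16 * r.length ≤ 16 * l.length ∧ (∀ a ∈ r, a ∈ A₀) ∧
      R' ∪ {x | ∃ a ∈ r, ∃ i, rc a i = x} = {r | ∃ a ∈ A₀, ∃ i, rc a i = r})
    (B := (K + 13000000) * Nat.log 2 (l.length + 2)) ?_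
    ⟨.nil, .nil, ∅, 0, rfl, Built.nil n, by omega, fun a => (hA₀ a).2, by simp [hA₀]⟩ ?_
  · rintro a r σ ⟨G₁, G₂, R', k, rfl, hB, hk, hr, hR'⟩ Φ hΦ
    rw [List.length_cons] at hk
    have ha := hr a List.mem_cons_self
    obtain ⟨rs, h₁, h₂, h₃⟩ := hrec a ha
    refine wpc_point List.prefix_rfl hrc hlen hgrp ha h₁ h₂ h₃ hB (fun x hx => ?_) (by omega)
      fun t ht G₁' G₂' hB' => hΦ t ht _ ⟨G₁', G₂', _, _, rfl, hB', by omega,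
        fun b hb => hr b (List.mem_cons_of_mem _ hb), ?_⟩
    · have : x ∈ {r | ∃ a ∈ A₀, ∃ i, rc a i = r} := hR' ▸ (.inl hx)
      obtain ⟨a, -, i, h⟩ := this
      exact ⟨a, i, h⟩
    · rw [← hR']
      ext x
      simp only [Set.mem_union, Set.mem_ofPred_eq, List.mem_cons, exists_eq_or_imp, or_assoc]
  · rintro t₂ ht₂ σ ⟨G₁, G₂, R', k, rfl, hB, hk, -, hR'⟩
    obtain rfl : R' = {r | ∃ a ∈ A₀, ∃ i, rc a i = r} := by simpa using hR'
    obtain ⟨h₁, h₂⟩ := hB.ht_le (m := l.length) (by omega)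
    simp [-Prod.exists]
    refine ⟨⟨G₁, G₂, aux⟩, rfl, rfl, hB.stores, h₁, h₂, ?_⟩
    have h₃ : (2 * K + 20000000) * (l.length + 1) * Nat.log 2 (l.length + 2) =
      K * (l.length + 1) * Nat.log 2 (l.length + 2) +
        (K + 13000000) * Nat.log 2 (l.length + 2) * (l.length + 1) +
          7000000 * ((l.length + 1) * Nat.log 2 (l.length + 2)) := by ring
    have h₄ : l.length + 1 ≤ (l.length + 1) * Nat.log 2 (l.length + 2) :=
      Nat.le_mul_of_pos_right _ hpos
    rw [add_mul] at ht₂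
    omega

end

/-! ### Quadrants -/

/-- The sign of the horizontal direction. -/
def Direction.sx : Direction → ℝ
  | .northeast => 1
  | .northwest => -1
  | .southeast => 1
  | .southwest => -1

/-- The sign of the vertical direction. -/
def Direction.sy : Direction → ℝ
  | .northeast => 1
  | .northwest => 1
  | .southeast => -1
  | .southwest => -1

theorem Direction.ext_signs {d d' : Direction} (h₁ : d.sx = d'.sx) (h₂ : d.sy = d'.sy) :
    d = d' := by
  cases d <;> cases d' <;> first | rfl | (revert h₁ h₂; norm_num [sx, sy])

/-- The description of a quadrant. -/
noncomputable def quadElem (Q : Quadrant) : Elem where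
  cell := [Q.dir.sx, Q.dir.sy]
  x := Q.dir.sx * Q.vertex.1
  id := [Q.dir.sx, Q.dir.sy, Q.vertex.1, Q.vertex.2]
  probes := [{ pos := true, grp := [Q.dir.sx, Q.dir.sy], y := Q.dir.sy * Q.vertex.2 }]

/-- The record of a point for the quadrants of one type. -/
noncomputable def quadRec (d : Direction) (a : Point) : Rec where
  grp := [d.sx, d.sy]
  c := d.sx * a.1
  h := d.sy * a.2
  a := a

/-- All types of quadrants. -/
def quadDir (i : Fin 16) : Direction :=
  if i = 0 then .northeast else if i = 1 then .northwest else if i = 2 then .southeast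
  else .southwest

/-- All indices from 3 on denote the same type. The repetition is harmless, since only the set of
records matters. -/
theorem quadDir_surjective : Function.Surjective quadDir
  | .northeast => ⟨0, rfl⟩
  | .northwest => ⟨1, rfl⟩
  | .southeast => ⟨2, rfl⟩
  | .southwest => ⟨3, rfl⟩

theorem mem_region_iff (Q : Quadrant) (a : Point) : a ∈ Q.region ↔
    Q.dir.sx * Q.vertex.1 ≤ Q.dir.sx * a.1 ∧ Q.dir.sy * Q.vertex.2 ≤ Q.dir.sy * a.2 := by
  obtain ⟨d, v⟩ := Q
  cases d <;> simp [Quadrant.region, Direction.sx, Direction.sy]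

/-- Multiplying the coordinates by the two signs turns every quadrant into a northeast one, where
membership is dominance. One positive probe suffices, and the type serves both as group and as cell.
-/
theorem quad_model {A₀ : Finset Point} {G₁ G₂ : Tr (ℝ × Point)}
    (h : Stores G₁ G₂ {r | ∃ a ∈ A₀, ∃ i, quadRec (quadDir i) a = r} 2) :
    Model A₀ (fun a Q => a ∈ Quadrant.region Q) G₁ G₂ quadElem (fun a i => quadRec (quadDir i) a)
      2 2 where
  stores := h
  rc_a _ _ := rfl
  grp_length := by simp [quadElem]
  cell_length := by simp [quadElem]
  cov_iff Q a _ := by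
    rw [mem_region_iff]
    simp only [quadElem, List.mem_singleton, exists_eq_left, Probe.Hits, quadRec, Probe.sgn, if_true,
      List.cons.injEq, and_true]
    constructor
    · intro h
      obtain ⟨i, hi⟩ := quadDir_surjective Q.dir
      exact ⟨i, by rw [hi]; exact ⟨⟨rfl, rfl⟩, h⟩⟩
    · rintro ⟨i, ⟨h₁, h₂⟩, h⟩
      rwa [Direction.ext_signs h₁ h₂] at h
  of_grp Q Q' p hp p' hp' h := by
    simp only [quadElem, List.mem_singleton] at hp hp' ⊢
    subst hp hp'
    exact ⟨rfl, h⟩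
  of_cell Q Q' h _ p hp := by
    simp only [quadElem, List.mem_singleton, exists_eq_left] at h hp ⊢
    subst hp
    exact ⟨rfl, h.symm⟩
  id_injective := by
    rintro ⟨d, v⟩ ⟨d', v'⟩ h
    simp only [quadElem, List.cons.injEq, and_true] at h
    rw [Direction.ext_signs h.1 h.2.1, Prod.ext h.2.2.1 h.2.2.2]

/-- A coordinate with a sign. -/
@[simp ↓] def Code.signed (s x : Code) : Code := .ifLe s (.lit 0) (.sub (.lit 0) x) x

/-- The description of a quadrant. -/
def codeQuadElem : Code :=
  let sx := fst (fst (snd (.var 0)))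
  let sy := snd (fst (snd (.var 0)))
  let x := fst (snd (snd (.var 0)))
  let y := snd (snd (snd (.var 0)))
  triple (.cons sx (.cons sy .nil)) (signed sx x)
    (.cons (.cons sx (.cons sy (.cons x (.cons y .nil))))
      (.cons (.cons (.lit 1) (.cons (.cons sx (.cons sy .nil)) (signed sy y))) .nil))

/-- The record of a point for the quadrants of one type. -/
def codeQuadRec (sx sy : ℚ) : Code :=
  .cons (.cons (.lit sx) (.cons (.lit sy) .nil))
    (.cons (signed (.lit sx) (fst (snd (.var 0)))) (signed (.lit sy) (snd (snd (.var 0)))))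

/-- The records of a point. -/
def codeQuadRecs : Code :=
  .cons (codeQuadRec 1 1) (.cons (codeQuadRec (-1) 1)
    (.cons (codeQuadRec 1 (-1)) (.cons (codeQuadRec (-1) (-1)) .nil)))

/-- The functions for quadrants. -/
def quadFuns : List Code := staticFuns codeQuadElem codeQuadRecs .nil []

theorem quad_implements :
    Implements quadFuns encodeQuadrant (fun a Q => a ∈ Quadrant.region Q) 20001000 := by
  intro l A₀ hA₀
  have hpos : 0 < Nat.log 2 (l.length + 2) := Nat.log_pos (by norm_num) (by omega)
  have hrecs : ∀ a ∈ A₀, ∃ rs : List Rec, rs.length ≤ 16 ∧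
      (∀ r, r ∈ rs ↔ ∃ i, quadRec (quadDir i) a = r) ∧ ∀ Φ : Val → ℕ → Prop,
        (∀ t ≤ 500 * Nat.log 2 (l.length + 2), Φ (Val.ofList (rs.map encRec)) t) →
          wpc (coreFuns ++ quadFuns) 29 (.cell .nil (encodePoint a)) Φ := by
    refine fun a _ => ⟨[quadRec .northeast a, quadRec .northwest a, quadRec .southeast a,
      quadRec .southwest a], by simp, fun r => ?_,
      fun Φ hΦ => wpc_of_ev (body := codeQuadRecs) rfl ?_⟩
    · constructor
      · intro h
        simp only [List.mem_cons, List.not_mem_nil, or_false] at h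
        rcases h with rfl | rfl | rfl | rfl
        · exact ⟨0, rfl⟩
        · exact ⟨1, rfl⟩
        · exact ⟨2, rfl⟩
        · exact ⟨3, rfl⟩
      · rintro ⟨i, rfl⟩
        cases quadDir i <;> simp
    · have hle : ∀ t ≤ 500, Φ (Val.ofList ([quadRec .northeast a, quadRec .northwest a,
        quadRec .southeast a, quadRec .southwest a].map encRec)) t := fun t ht => hΦ t (by omega)
      simp [encRec, quadRec, Direction.sx, Direction.sy, Val.ofList] at hle
      simp [codeQuadRecs, codeQuadRec, encodePoint]
      exact hle _ (by norm_num)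
  obtain ⟨S, -, h₁, h₂, h₃, h₄⟩ := wpc_static (E := codeQuadElem) (R := codeQuadRecs) (A := .nil)
    (fs := []) (rc := fun a i => quadRec (quadDir i) a) (n := 2) (K := 500) hA₀ (aux := .nil)
    (fun _ _ => rfl) (fun _ _ _ => rfl)
    (fun a i j h => by
      simp only [quadRec, List.cons.injEq, and_true] at h
      rw [Direction.ext_signs h.1 h.2])
    (fun Φ hΦ => wpc_of_ev (body := .nil) rfl <| by
      simp
      exact hΦ _ (Nat.mul_pos (by positivity) hpos))
    hrecs
  refine ⟨S, quadElem, ⟨List.prefix_append _ _, ⟨_, _, _, quad_model h₁⟩, by omega, by omega,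
    fun Q Φ hΦ => wpc_of_ev (body := codeQuadElem) rfl ?_⟩, fun Φ hΦ => h₄ Φ fun t ht => hΦ t ?_⟩
  · obtain ⟨d, v⟩ := Q
    have hle : ∀ t ≤ 500, Φ (encElem (quadElem ⟨d, v⟩)) t := fun t ht => hΦ t (by omega)
    cases d <;>
    · simp [encElem, quadElem, encProbe, Direction.sx, Direction.sy] at hle
      simp [codeQuadElem, encodeQuadrant, encodeDirection, encodePoint]
      exact hle _ (by norm_num)
  · refine ht.trans ?_
    gcongr

theorem hasPartiallyDynamicHittingSet_quadrant :
    HasPartiallyDynamicHittingSet Quadrant.region encodeQuadrant :=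
  ⟨_, _, _, _, quad_implements.isPartiallyDynamic (pt := id) Function.injective_id (fun _ => rfl)
    fun _ _ _ => Iff.rfl⟩

/-! ### Lines -/

/-- The entry of a line in the tree of lines. -/
def lineEntry (m : ℝ) : Entry ℝ where
  key := [m, 0]
  val := [m]
  pay := m

/-- The tree `t`, made by at most `k` insertions, stores the lines of `Λ`. -/
structure Lines (t : Tr ℝ) (Λ : Set ℝ) (k : ℕ) : Prop where
  ordered : t.Ordered
  balanced : t.Balanced
  mem : ∀ e, e ∈ t ↔ ∃ m ∈ Λ, e = lineEntry m
  size_le : t.size ≤ k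

namespace Lines
variable {t : Tr ℝ} {Λ : Set ℝ} {k : ℕ}

theorem nil : Lines .nil ∅ 0 := ⟨trivial, trivial, by simp, le_rfl⟩

theorem insert (h : Lines t Λ k) (m : ℝ) : Lines (t.ins (lineEntry m)) (insert m Λ) (k + 1) := by
  obtain ⟨o, hm⟩ := Tr.ordered_mem_ins (e := lineEntry m) h.ordered
  refine ⟨o, (Tr.balanced_ins h.balanced).1, fun e => ?_,
    Tr.size_ins.trans (Nat.succ_le_succ h.size_le)⟩
  rw [hm, h.mem]
  constructor
  · rintro (rfl | ⟨⟨m', hm', rfl⟩, -⟩)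
    · exact ⟨m, Set.mem_insert _ _, rfl⟩
    · exact ⟨m', Set.mem_insert_of_mem _ hm', rfl⟩
  · rintro ⟨m', rfl | hm', rfl⟩
    · exact .inl rfl
    · by_cases he : m' = m
      · exact .inl (he ▸ rfl)
      · exact .inr ⟨⟨m', hm', rfl⟩, by simpa [lineEntry] using he⟩

/-- The first line that is not before `v`. -/
theorem query_ge (h : Lines t Λ k) (v : ℝ) : (t.query [v] = none → ∀ m ∈ Λ, m < v) ∧
    ∀ e, t.query [v] = some e → e.pay ∈ Λ ∧ v ≤ e.pay ∧ ∀ m ∈ Λ, v ≤ m → e.pay ≤ m := by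
  -- The second entry of a key makes `[m, 0]` larger than `[m]` and smaller than `[m, 1]`. So the
  -- bound `[v]` includes the line at `v`, and `[v, 1]` excludes it.
  have hlt : ∀ m, [v] < (lineEntry m).key ↔ v ≤ m := fun m => by
    rw [lineEntry, cons_lt_cons, le_iff_lt_or_eq]; simp
  obtain ⟨h₁, h₂⟩ := Tr.query_spec h.ordered [v]
  refine ⟨fun hq m hm => ?_, fun e hq => ?_⟩
  · have := h₁ hq _ ((h.mem _).2 ⟨m, hm, rfl⟩)
    rwa [← not_lt, hlt, not_le] at this
  · obtain ⟨g₁, g₂, g₃⟩ := h₂ e hq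
    obtain ⟨m, hm, rfl⟩ := (h.mem e).1 g₁
    refine ⟨hm, (hlt m).1 g₂, fun m' hm' hv => ?_⟩
    exact singleton_le.1 (g₃ _ ((h.mem _).2 ⟨m', hm', rfl⟩) ((hlt m').2 hv))

/-- The first line after `v`. -/
theorem query_gt (h : Lines t Λ k) (v : ℝ) : (t.query [v, 1] = none → ∀ m ∈ Λ, m ≤ v) ∧
    ∀ e, t.query [v, 1] = some e → e.pay ∈ Λ ∧ v < e.pay ∧ ∀ m ∈ Λ, v < m → e.pay ≤ m := by
  have hlt : ∀ m, [v, 1] < (lineEntry m).key ↔ v < m := fun m => by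
    have : ¬ (1 : ℝ) < 0 := by norm_num
    rw [lineEntry, cons_lt_cons, cons_lt_cons]; simp [this]
  obtain ⟨h₁, h₂⟩ := Tr.query_spec h.ordered [v, 1]
  refine ⟨fun hq m hm => ?_, fun e hq => ?_⟩
  · have := h₁ hq _ ((h.mem _).2 ⟨m, hm, rfl⟩)
    rwa [← not_lt, hlt, not_lt] at this
  · obtain ⟨g₁, g₂, g₃⟩ := h₂ e hq
    obtain ⟨m, hm, rfl⟩ := (h.mem e).1 g₁
    refine ⟨hm, (hlt m).1 g₂, fun m' hm' hv => ?_⟩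
    exact singleton_le.1 (g₃ _ ((h.mem _).2 ⟨m', hm', rfl⟩) ((hlt m').2 hv))

theorem mono {k' : ℕ} (h : Lines t Λ k) (hk : k ≤ k') : Lines t Λ k' :=
  ⟨h.ordered, h.balanced, h.mem, h.size_le.trans hk⟩

theorem ht_le (h : Lines t Λ k) {n : ℕ} (hk : k ≤ 3 * n) : t.ht ≤ 7 * Nat.log 2 (n + 2) := by
  have h₁ := Tr.ht_le h.balanced
  have := h.size_le
  have := log_mul_two_pow_le 2 (show t.size + 1 ≤ 2 ^ 2 * (n + 2) by omega)
  have : 0 < Nat.log 2 (n + 2) := Nat.log_pos (by norm_num) (by omega)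
  omega

end Lines

/-- The lines of one direction, more than half a unit apart, in both orders. -/
structure Axis (p n : Tr ℝ) (Λ : Set ℝ) (k : ℕ) : Prop where
  pos : Lines p Λ k
  neg : Lines n {m | -m ∈ Λ} k
  apart : ∀ m ∈ Λ, ∀ m' ∈ Λ, m < m' → m + 1 / 2 < m'

theorem Axis.nil : Axis .nil .nil ∅ 0 := ⟨.nil, by simpa using Lines.nil, by simp⟩

theorem Axis.mono {p n : Tr ℝ} {Λ : Set ℝ} {k k' : ℕ} (h : Axis p n Λ k) (hk : k ≤ k') :
    Axis p n Λ k' :=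
  ⟨h.pos.mono hk, h.neg.mono hk, h.apart⟩

/-- Machine representation of the lines of one direction. -/
noncomputable def encAxis (p n : Tr ℝ) : Val := .cell (encT .num p) (encT .num n)

/-- The lines `m` and `m'` are the first and the last one at distance at most `1/2` from `u`. -/
structure Ends (Λ : Set ℝ) (u m m' : ℝ) : Prop where
  mem : m ∈ Λ
  mem' : m' ∈ Λ
  near : |m - u| ≤ 1 / 2
  near' : |m' - u| ≤ 1 / 2
  eq_or : ∀ x ∈ Λ, |x - u| ≤ 1 / 2 → x = m ∨ x = m'

/-- The lines `m` and `m'` are the last one up to `v` and the first one after `v`. -/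
structure Bracket (Λ : Set ℝ) (v m m' : ℝ) : Prop where
  mem : m ∈ Λ
  mem' : m' ∈ Λ
  le : m ≤ v
  lt : v < m'
  le_of_le : ∀ x ∈ Λ, x ≤ v → x ≤ m
  le_of_lt : ∀ x ∈ Λ, v < x → m' ≤ x

/-- The number `u` is separated from the ends by lines, and close to a line. -/
structure Guarded (Λ : Set ℝ) (u : ℝ) : Prop where
  near : ∃ m ∈ Λ, |m - u| ≤ 1 / 2
  before : ∃ m ∈ Λ, |m - (u - 1)| ≤ 1 / 2
  after : ∃ m ∈ Λ, |m - (u + 3 / 2)| ≤ 1 / 2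

theorem Guarded.mono {Λ Λ' : Set ℝ} {u : ℝ} (h : Guarded Λ u) (hΛ : Λ ⊆ Λ') : Guarded Λ' u := by
  obtain ⟨⟨m, h₁, h₂⟩, ⟨m', h₃, h₄⟩, ⟨m'', h₅, h₆⟩⟩ := h
  exact ⟨⟨m, hΛ h₁, h₂⟩, ⟨m', hΛ h₃, h₄⟩, ⟨m'', hΛ h₅, h₆⟩⟩

/-- The last line up to `v` and the first line after `v`. -/
noncomputable def bracket (p n : Tr ℝ) (v : ℝ) : Option (ℝ × ℝ) :=
  match n.query [-v], p.query [v, 1] with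
  | some e, some e' => some (-e.pay, e'.pay)
  | _, _ => none

/-- The first line from `u - 1/2` on. -/
noncomputable def firstEnd (p : Tr ℝ) (u : ℝ) : ℝ := (p.query [u - 1 / 2]).elim 0 fun e => e.pay

/-- The last line up to `u + 1/2`. -/
noncomputable def lastEnd (n : Tr ℝ) (u : ℝ) : ℝ := -(n.query [-(u + 1 / 2)]).elim 0 fun e => e.pay

-- Lines around a dynamic and near a static coordinate

section
variable {p n : Tr ℝ} {Λ : Set ℝ} {k : ℕ}

/-- The lines of a bracket are neighbours, so either one determines the gap. -/
theorem Bracket.unique {v v' m₁ m₂ m₁' m₂' : ℝ} (h : Bracket Λ v m₁ m₂) (h' : Bracket Λ v' m₁' m₂')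
    (he : m₁ = m₁' ∨ m₂ = m₂') : m₁ = m₁' ∧ m₂ = m₂' := by
  obtain ⟨a₁, a₂, a₃, a₄, a₅, a₆⟩ := h
  obtain ⟨b₁, b₂, b₃, b₄, b₅, b₆⟩ := h'
  rcases he with rfl | rfl
  · refine ⟨rfl, le_antisymm (a₆ _ b₂ ?_) (b₆ _ a₂ ?_)⟩ <;> by_contra! hc
    · linarith [a₅ _ b₂ hc]
    · linarith [b₅ _ a₂ hc]
  · refine ⟨le_antisymm (b₅ _ a₁ ?_) (a₅ _ b₁ ?_), rfl⟩ <;> by_contra! hc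
    · linarith [b₆ _ a₁ hc]
    · linarith [a₆ _ b₁ hc]

theorem Axis.bracket_spec (h : Axis p n Λ k) {v m m' : ℝ} (hb : bracket p n v = some (m, m')) :
    Bracket Λ v m m' := by
  unfold bracket at hb
  cases h₁ : n.query [-v] with
  | none => simp [h₁] at hb
  | some e =>
    cases h₂ : p.query [v, 1] with
    | none => simp [h₁, h₂] at hb
    | some e' =>
      simp only [h₁, h₂, Option.some.injEq, Prod.mk.injEq] at hb
      obtain ⟨rfl, rfl⟩ := hb
      obtain ⟨a₁, a₂, a₃⟩ := (h.neg.query_ge (-v)).2 e h₁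
      obtain ⟨b₁, b₂, b₃⟩ := (h.pos.query_gt v).2 e' h₂
      refine ⟨a₁, b₁, by linarith, b₂, fun x hx hxv => ?_, b₃⟩
      have := a₃ (-x) (by simpa using hx) (by linarith)
      linarith

/-- The line near `u - 1` is at most `u - 1 / 2`, hence at most `v`. The line near `u + 3 / 2` is at
least `u + 1`, hence strictly beyond `v`; one near `u + 1` could coincide with `v`. -/
theorem Axis.bracket_ne_none (h : Axis p n Λ k) {u v : ℝ} (hu : Guarded Λ u)
    (huv : |u - v| ≤ 1 / 2) : bracket p n v ≠ none := by
  obtain ⟨-, ⟨m, hm, hm'⟩, ⟨m', hm₁, hm₂⟩⟩ := hu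
  rw [abs_le] at huv hm' hm₂
  unfold bracket
  cases h₁ : n.query [-v] with
  | none =>
    have := (h.neg.query_ge (-v)).1 h₁ (-m) (by simpa using hm)
    linarith
  | some e =>
    cases h₂ : p.query [v, 1] with
    | none =>
      have := (h.pos.query_gt v).1 h₂ m' hm₁
      linarith
    | some e' => simp

theorem Axis.ends_spec (h : Axis p n Λ k) {u : ℝ} (hu : Guarded Λ u) :
    Ends Λ u (firstEnd p u) (lastEnd n u) := by
  obtain ⟨⟨m, hm, hm'⟩, -, -⟩ := hu
  rw [abs_le] at hm'
  unfold firstEnd lastEnd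
  cases h₁ : p.query [u - 1 / 2] with
  | none =>
    have := (h.pos.query_ge _).1 h₁ m hm
    linarith
  | some e =>
    cases h₂ : n.query [-(u + 1 / 2)] with
    | none =>
      have := (h.neg.query_ge _).1 h₂ (-m) (by simpa using hm)
      linarith
    | some e' =>
      obtain ⟨a₁, a₂, a₃⟩ := (h.pos.query_ge _).2 e h₁
      obtain ⟨b₁, b₂, b₃⟩ := (h.neg.query_ge _).2 e' h₂
      have c₁ := a₃ m hm (by linarith)
      have c₂ := b₃ (-m) (by simpa using hm) (by linarith)
      simp only [Option.elim_some]
      refine ⟨a₁, b₁, abs_le.2 ⟨by linarith, by linarith⟩, abs_le.2 ⟨by linarith, by linarith⟩,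
        fun x hx hxu => ?_⟩
      rw [abs_le] at hxu
      have d₁ := a₃ x hx (by linarith)
      have d₂ := b₃ (-x) (by simpa using hx) (by linarith)
      -- A third line would lie strictly between the two ends; two gaps of more than 1/2 do not fit
      -- into an interval of length 1.
      by_contra! hne
      have e₁ := h.apart _ a₁ x hx (lt_of_le_of_ne d₁ hne.1.symm)
      have e₂ := h.apart x hx _ b₁ (lt_of_le_of_ne (by linarith) hne.2)
      linarith

end

/-- The sign of a view. -/
def sg (b : Bool) : ℝ := if b then 1 else -1

theorem sg_injective : Function.Injective sg := by
  intro a b h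
  cases a <;> cases b <;> first | rfl | (revert h; norm_num [sg])

/-- Closeness of two numbers is witnessed by a line. -/
theorem abs_sub_le_iff_exists {Λ : Set ℝ} {u v m₁ m₂ e₁ e₂ : ℝ} (hB : Bracket Λ v m₁ m₂)
    (hE : Ends Λ u e₁ e₂) : |u - v| ≤ 1 / 2 ↔ ∃ s e : Bool,
      (if e then e₁ else e₂) = (if s then m₁ else m₂) ∧ sg s * v ≤ sg s * u + 1 / 2 := by
  obtain ⟨a₁, a₂, a₃, a₄, a₅, a₆⟩ := hB
  obtain ⟨b₁, b₂, b₃, b₄, b₅⟩ := hE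
  constructor
  · intro h
    rw [abs_le] at h
    have key : ∀ x ∈ Λ, |x - u| ≤ 1 / 2 → ∃ e : Bool, (if e then e₁ else e₂) = x := by
      intro x hx hxu
      rcases b₅ x hx hxu with rfl | rfl
      · exact ⟨true, rfl⟩
      · exact ⟨false, rfl⟩
    rw [abs_le] at b₃
    -- If `e₁` is not beyond `v`, then `m₁` lies between `e₁` and `v`, which are both within 1/2 of
    -- `u`; otherwise `m₂` does.
    by_cases he : e₁ ≤ v
    · obtain ⟨e, he'⟩ := key m₁ a₁ (by have := a₅ _ b₁ he; rw [abs_le]; constructor <;> linarith)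
      exact ⟨true, e, he', by simp only [sg, if_true]; linarith⟩
    · push Not at he
      obtain ⟨e, he'⟩ := key m₂ a₂ (by have := a₆ _ b₁ he; rw [abs_le]; constructor <;> linarith)
      exact ⟨false, e, he', by simp [sg]; linarith⟩
  -- The common line is within 1/2 of `u`, and `v` lies on its side `s`: this is one half of the
  -- claim, and the inequality `h'` is the other.
  · rintro ⟨s, e, h, h'⟩
    have hnear : |(if e then e₁ else e₂) - u| ≤ 1 / 2 := by cases e <;> assumption
    rw [h, abs_le] at hnear
    rw [abs_le]
    cases s <;> simp [sg] at hnear h' <;> constructor <;> linarith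

/-! ### Programs for unit squares -/

/-- Addition of a line, unless there is one at distance at most `1/2`. -/
def codeLine : Code :=
  let p := fst (fst (.var 1))
  let n := snd (fst (.var 1))
  let m := snd (.var 1)
  let m' := .sub (.lit 0) m
  let new := .cons
    (.call 4 (.cons p (triple (.cons m (.cons (.lit 0) .nil)) (.cons m .nil) m)))
    (.call 4 (.cons n (triple (.cons m' (.cons (.lit 0) .nil)) (.cons m' .nil) m')))
  .letIn (.call 8 (.cons (fst (fst (.var 0))) (.cons (.sub (snd (.var 0)) (.lit (1 / 2))) .nil)))
    (ifNil (.var 0) new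
      (.ifLe (pay (.var 0)) (.add m (.lit (1 / 2))) (fst (.var 1)) new))

/-- Addition of the lines near a coordinate. -/
def codeLines : Code :=
  let u := snd (.var 0)
  .call 31 (.cons (.call 31 (.cons (.call 31 (.cons (fst (.var 0)) (.sub u (.lit 1)))) u))
    (.add u (.lit (3 / 2))))

/-- Addition of the lines near a point. -/
def codeLinesPoint : Code :=
  .cons (.call 32 (.cons (fst (fst (.var 0))) (fst (snd (.var 0)))))
    (.call 32 (.cons (snd (fst (.var 0))) (snd (snd (.var 0)))))

/-- The lines for a list of points. -/
def codeAux : Code := .call 33 (.cons (.var 0) (.cons (.cons .nil .nil) (.cons .nil .nil)))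

/-- The first and the last line near a coordinate. -/
def codeEnds : Code :=
  let u := snd (.var 0)
  .cons (pay (.call 8 (.cons (fst (fst (.var 0))) (.cons (.sub u (.lit (1 / 2))) .nil))))
    (.sub (.lit 0) (pay (.call 8 (.cons (snd (fst (.var 0)))
      (.cons (.sub (.lit 0) (.add u (.lit (1 / 2)))) .nil)))))

/-- The last line up to a number and the first line after it. -/
def codeBracket : Code :=
  .letIn (.call 8 (.cons (snd (fst (.var 0))) (.cons (.sub (.lit 0) (snd (.var 0))) .nil)))
    (.letIn (.call 8 (.cons (fst (fst (.var 1))) (.cons (snd (.var 1)) (.cons (.lit 1) .nil))))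
      (ifNil (.var 1) .nil (ifNil (.var 0) .nil
        (.cons (.sub (.lit 0) (pay (.var 1))) (pay (.var 0))))))

/-- The record of a point for a view of a crossing of two lines. -/
def codeSquareRec (sx sy : ℚ) : Code :=
  .cons (.cons (.lit sx) (.cons (.lit sy)
      (.cons (fst (fst (.var 0))) (.cons (snd (fst (.var 0))) .nil))))
    (.cons (.add (signed (.lit sx) (fst (fst (snd (.var 0))))) (.lit (1 / 2)))
      (.add (signed (.lit sy) (snd (fst (snd (.var 0))))) (.lit (1 / 2))))

/-- The records of a point for a crossing of two lines, and a list of further records. -/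
def codeCrossing : Code :=
  .cons (codeSquareRec 1 1) (.cons (codeSquareRec 1 (-1)) (.cons (codeSquareRec (-1) 1)
    (.cons (codeSquareRec (-1) (-1)) (snd (snd (.var 0))))))

/-- The records of a point. -/
def codeSquareRecs : Code :=
  let m := .var 1
  let l := .var 0
  let a := snd (.var 2)
  .letIn (.call 35 (.cons (fst (fst (.var 0))) (fst (snd (.var 0)))))
    (.letIn (.call 35 (.cons (snd (fst (.var 1))) (snd (snd (.var 1)))))
      (.call 37 (.cons (.cons (fst m) (fst l)) (.cons a
        (.call 37 (.cons (.cons (fst m) (snd l)) (.cons a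
          (.call 37 (.cons (.cons (snd m) (fst l)) (.cons a
            (.call 37 (.cons (.cons (snd m) (snd l)) (.cons a .nil)))))))))))))

/-- The probe of a unit square for a view of a crossing of two lines. -/
def codeSquareProbe (sx sy : ℚ) (m l y : Code) : Code :=
  .cons (.lit sx) (.cons (.cons (.lit sx) (.cons (.lit sy) (.cons m (.cons l .nil))))
    (signed (.lit sy) y))

/-- The description of a unit square. -/
def codeSquareElem : Code :=
  let x := fst (snd (.var 2))
  let y := snd (snd (.var 2))
  let m := fst (.var 1)
  let m' := snd (.var 1)
  let l := fst (.var 0)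
  let l' := snd (.var 0)
  let e := triple .nil x (.cons (.cons x (.cons y .nil)) .nil)
  .letIn (.call 36 (.cons (fst (snd (fst (.var 0)))) (fst (snd (.var 0)))))
    (.letIn (.call 36 (.cons (snd (snd (fst (.var 1)))) (snd (snd (.var 1)))))
      (ifNil (.var 1) e (ifNil (.var 0) e
        (triple (.cons m (.cons m' (.cons l (.cons l' .nil)))) x
          (.cons (.cons x (.cons y .nil))
            (.cons (codeSquareProbe 1 1 m l y) (.cons (codeSquareProbe 1 (-1) m l' y)
              (.cons (codeSquareProbe (-1) 1 m' l y)
                (.cons (codeSquareProbe (-1) (-1) m' l' y) .nil)))))))))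

/-- The functions for unit squares. -/
def squareFuns : List Code := staticFuns codeSquareElem codeSquareRecs codeAux
  [codeLine, codeLines, codeFold 33 34, codeLinesPoint, codeEnds, codeBracket, codeCrossing]

theorem core_square : coreFuns <+: coreFuns ++ squareFuns := List.prefix_append _ _

-- Running times of the programs for lines

section
variable {p n : Tr ℝ} {Λ : Set ℝ} {k : ℕ}

theorem Axis.new_line (h : Axis p n Λ k) {v : ℝ} (hv : ∀ m ∈ Λ, v - 1 / 2 ≤ m → v + 1 / 2 < m) :
    Axis (p.ins (lineEntry v)) (n.ins (lineEntry (-v))) (insert v Λ) (k + 1) := by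
  refine ⟨h.pos.insert v, ?_, ?_⟩
  · convert h.neg.insert (-v) using 1
    ext m
    simp [neg_eq_iff_eq_neg]
  · rintro m (rfl | hm) m' (rfl | hm') hlt
    · exact absurd hlt (lt_irrefl _)
    · exact hv m' hm' (by linarith)
    · by_contra! hc
      linarith [hv m hm (by linarith)]
    · exact h.apart m hm m' hm' hlt

/-- If the first line from `v - 1 / 2` on is at most `v + 1 / 2`, it serves. Otherwise all lines are
more than 1/2 away from `v`, which can become a line itself. -/
theorem wpc_line (h : Axis p n Λ k) {v : ℝ} {Φ : Val → ℕ → Prop}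
    (hΦ : ∀ t ≤ 50000 * (p.ht + n.ht + 2), ∀ p' n' Λ', Axis p' n' Λ' (k + 1) → Λ ⊆ Λ' →
      (∃ m ∈ Λ', |m - v| ≤ 1 / 2) → Φ (encAxis p' n') t) :
    wpc (coreFuns ++ squareFuns) 31 (.cell (encAxis p n) (.num v)) Φ := by
  have hnew : (∀ m ∈ Λ, v - 1 / 2 ≤ m → v + 1 / 2 < m) → ∀ t ≤ 50000 * (p.ht + n.ht + 2),
      Φ (encAxis (p.ins (lineEntry v)) (n.ins (lineEntry (-v)))) t := fun hv t ht =>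
    hΦ t ht _ _ _ (h.new_line hv) (Set.subset_insert v Λ) ⟨v, Set.mem_insert _ _, by norm_num⟩
  refine wpc_of_ev (body := codeLine) rfl ?_
  simp [codeLine, encAxis, -one_div]
  refine wpc_query .num (treeFuns_prefix core_square) (b := [v - 1 / 2]) fun t₁ ht₁ => ?_
  obtain ⟨q₁, q₂⟩ := h.pos.query_ge (v - 1 / 2)
  cases hq : p.query [v - 1 / 2] with
  | none =>
    simp
    refine wpc_ins .num (treeFuns_prefix core_square) (e := lineEntry v) fun t₂ ht₂ => ?_
    refine wpc_ins .num (treeFuns_prefix core_square) (e := lineEntry (-v)) fun t₃ ht₃ => ?_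
    exact hnew (fun m hm hm' => absurd hm' (q₁ hq m hm).not_ge) _ (by omega)
  | some e =>
    obtain ⟨a₁, a₂, a₃⟩ := q₂ e hq
    simp [-one_div]
    refine ⟨fun hle => ?_, fun hlt => ?_⟩
    · exact hΦ _ (by omega) p n Λ (h.mono (Nat.le_succ k))
        subset_rfl ⟨e.pay, a₁, abs_le.2 ⟨by linarith, by linarith⟩⟩
    · refine wpc_ins .num (treeFuns_prefix core_square) (e := lineEntry v) fun t₂ ht₂ => ?_
      refine wpc_ins .num (treeFuns_prefix core_square) (e := lineEntry (-v)) fun t₃ ht₃ => ?_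
      exact hnew (fun m hm hm' => hlt.trans_le (a₃ m hm hm')) _ (by omega)

theorem wpc_lines (h : Axis p n Λ k) {m : ℕ} (hk : k + 3 ≤ 3 * m) {u : ℝ} {Φ : Val → ℕ → Prop}
    (hΦ : ∀ t ≤ 2500000 * Nat.log 2 (m + 2), ∀ p' n' Λ', Axis p' n' Λ' (k + 3) → Λ ⊆ Λ' →
      Guarded Λ' u → Φ (encAxis p' n') t) :
    wpc (coreFuns ++ squareFuns) 32 (.cell (encAxis p n) (.num u)) Φ := by
  have hpos : 0 < Nat.log 2 (m + 2) := Nat.log_pos (by norm_num) (by omega)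
  refine wpc_of_ev (body := codeLines) rfl ?_
  simp [codeLines]
  have := h.pos.ht_le (n := m) (by omega)
  have := h.neg.ht_le (n := m) (by omega)
  refine wpc_line h fun t₁ ht₁ p₁ n₁ Λ₁ h₁ s₁ ⟨m₁, a₁, b₁⟩ => ?_
  have := h₁.pos.ht_le (n := m) (by omega)
  have := h₁.neg.ht_le (n := m) (by omega)
  refine wpc_line h₁ fun t₂ ht₂ p₂ n₂ Λ₂ h₂ s₂ ⟨m₂, a₂, b₂⟩ => ?_
  have := h₂.pos.ht_le (n := m) (by omega)
  have := h₂.neg.ht_le (n := m) (by omega)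
  refine wpc_line h₂ fun t₃ ht₃ p₃ n₃ Λ₃ h₃ s₃ ⟨m₃, a₃, b₃⟩ => ?_
  exact hΦ _ (by omega) p₃ n₃ Λ₃ h₃ (s₁.trans (s₂.trans s₃))
    ⟨⟨m₂, s₃ a₂, b₂⟩, ⟨m₁, s₃ (s₂ a₁), b₁⟩, ⟨m₃, a₃, b₃⟩⟩

theorem wpc_ends (h : Axis p n Λ k) {m : ℕ} (hk : k ≤ 3 * m) {u : ℝ} (hu : Guarded Λ u)
    {Φ : Val → ℕ → Prop}
    (hΦ : ∀ t ≤ 70000 * Nat.log 2 (m + 2), Φ (encodePoint (firstEnd p u, lastEnd n u)) t) :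
    wpc (coreFuns ++ squareFuns) 35 (.cell (encAxis p n) (.num u)) Φ := by
  have hpos : 0 < Nat.log 2 (m + 2) := Nat.log_pos (by norm_num) (by omega)
  have := h.pos.ht_le hk
  have := h.neg.ht_le hk
  obtain ⟨⟨x, hx, hxu⟩, -, -⟩ := hu
  rw [abs_le] at hxu
  unfold firstEnd lastEnd at hΦ
  refine wpc_of_ev (body := codeEnds) rfl ?_
  simp [codeEnds, encAxis, -one_div, -neg_add_rev]
  refine wpc_query .num (treeFuns_prefix core_square) (b := [u - 1 / 2]) fun t₁ ht₁ => ?_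
  cases h₁ : p.query [u - 1 / 2] with
  | none =>
    have := (h.pos.query_ge _).1 h₁ x hx
    linarith
  | some e =>
    simp [-one_div, -neg_add_rev]
    refine wpc_query .num (treeFuns_prefix core_square) (b := [-(u + 1 / 2)]) fun t₂ ht₂ => ?_
    cases h₂ : n.query [-(u + 1 / 2)] with
    | none =>
      have := (h.neg.query_ge _).1 h₂ (-x) (by simpa using hx)
      linarith
    | some e' =>
      simp [h₁, h₂, encodePoint, -one_div, -neg_add_rev] at hΦ ⊢
      exact hΦ _ (by omega)

/-- Machine representation of an optional pair of lines. -/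
def encBracket : Option (ℝ × ℝ) → Val
  | none => .nil
  | some m => encodePoint m

theorem wpc_bracket (h : Axis p n Λ k) {m : ℕ} (hk : k ≤ 3 * m) {v : ℝ}
    {Φ : Val → ℕ → Prop}
    (hΦ : ∀ t ≤ 70000 * Nat.log 2 (m + 2), Φ (encBracket (bracket p n v)) t) :
    wpc (coreFuns ++ squareFuns) 36 (.cell (encAxis p n) (.num v)) Φ := by
  have hpos : 0 < Nat.log 2 (m + 2) := Nat.log_pos (by norm_num) (by omega)
  have := h.pos.ht_le hk
  have := h.neg.ht_le hk
  unfold bracket at hΦ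
  refine wpc_of_ev (body := codeBracket) rfl ?_
  simp [codeBracket, encAxis]
  refine wpc_query .num (treeFuns_prefix core_square) (b := [-v]) fun t₁ ht₁ => ?_
  refine wpc_query .num (treeFuns_prefix core_square) (b := [v, 1]) fun t₂ ht₂ => ?_
  cases h₁ : n.query [-v] with
  | none =>
    simp [h₁, encBracket] at hΦ ⊢
    exact hΦ _ (by omega)
  | some e =>
    cases h₂ : p.query [v, 1] with
    | none =>
      simp [h₁, h₂, encBracket] at hΦ ⊢
      exact hΦ _ (by omega)
    | some e' =>
      simp [h₁, h₂, encBracket, encodePoint] at hΦ ⊢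
      exact hΦ _ (by omega)

end

/-! ### Unit squares -/

/-- The record of a point for a view of the crossing of the lines `m` and `l`. -/
noncomputable def squareRec (bx bv : Bool) (m l : ℝ) (a : Point) : Rec where
  grp := [sg bx, sg bv, m, l]
  c := sg bx * a.1 + 1 / 2
  h := sg bv * a.2 + 1 / 2
  a := a

/-- The probe of a unit square for a view of a crossing of its lines. -/
noncomputable def squareProbe (bx bv : Bool) (m l : ℝ × ℝ) (y : ℝ) : Probe where
  pos := bx
  grp := [sg bx, sg bv, if bx then m.1 else m.2, if bv then l.1 else l.2]
  y := sg bv * y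

/-- The description of a unit square, when the lines around its center are known. -/
noncomputable def squareElem (m l : Option (ℝ × ℝ)) (d : Point) : Elem :=
  match m, l with
  | some m, some l =>
    { cell := [m.1, m.2, l.1, l.2]
      x := d.1
      id := [d.1, d.2]
      probes := [squareProbe true true m l d.2, squareProbe true false m l d.2,
        squareProbe false true m l d.2, squareProbe false false m l d.2] }
  | _, _ =>
    { cell := []
      x := d.1
      id := [d.1, d.2]
      probes := [] }

theorem mem_probes_squareElem {m l : Option (ℝ × ℝ)} {d : Point} {p : Probe} :
    p ∈ (squareElem m l d).probes ↔ ∃ m' l', m = some m' ∧ l = some l' ∧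
      ∃ bx bv, p = squareProbe bx bv m' l' d.2 := by
  cases m with
  | none => simp [squareElem]
  | some m => cases l with
    | none => simp [squareElem]
    | some l =>
      simp only [squareElem, List.mem_cons, List.not_mem_nil, or_false, Option.some.injEq,
        exists_eq_left', Bool.exists_bool, exists_and_left]
      tauto

theorem squareElem_id {m l : Option (ℝ × ℝ)} {d : Point} :
    (squareElem m l d).id = [d.1, d.2] := by
  cases m <;> cases l <;> rfl

theorem squareElem_x {m l : Option (ℝ × ℝ)} {d : Point} : (squareElem m l d).x = d.1 := by
  cases m <;> cases l <;> rfl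

/-- All views of all crossings. -/
noncomputable def views : Fin 16 ≃ Bool × Bool × Bool × Bool :=
  (Fintype.equivFinOfCardEq (by simp)).symm

/-- The lines for the static points. -/
structure Grid : Type where
  px : Tr ℝ
  nx : Tr ℝ
  py : Tr ℝ
  ny : Tr ℝ

/-- Machine representation of the lines. -/
noncomputable def encGrid (g : Grid) : Val := .cell (encAxis g.px g.nx) (encAxis g.py g.ny)

/-- The lines are correct, and they guard all points of `A₀`. -/
structure Grid.Valid (g : Grid) (A₀ : Set Point) (Λ Λ' : Set ℝ) (k : ℕ) : Prop where
  axis : Axis g.px g.nx Λ k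
  axis' : Axis g.py g.ny Λ' k
  guarded : ∀ a ∈ A₀, Guarded Λ a.1
  guarded' : ∀ a ∈ A₀, Guarded Λ' a.2

/-- The description of a unit square. -/
noncomputable def Grid.elem (g : Grid) (d : Point) : Elem :=
  squareElem (bracket g.px g.nx d.1) (bracket g.py g.ny d.2) d

/-- The records of a point. -/
noncomputable def Grid.record (g : Grid) (a : Point) (i : Fin 16) : Rec :=
  squareRec (views i).1 (views i).2.1 (if (views i).2.2.1 then firstEnd g.px a.1 else lastEnd g.nx a.1)
    (if (views i).2.2.2 then firstEnd g.py a.2 else lastEnd g.ny a.2) a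

/-- When the first and the last line near a coordinate coincide, several indices share a group; they
then also share the record. -/
theorem Grid.record_eq_of_grp_eq (g : Grid) (a : Point) (i j : Fin 16)
    (h : (g.record a i).grp = (g.record a j).grp) : g.record a i = g.record a j := by
  simp only [Grid.record, squareRec, List.cons.injEq, and_true] at h ⊢
  simp only [h]

/-- The criterion `abs_sub_le_iff_exists` is applied in both coordinates. Its two signs and the two
common lines form the group, and its two inequalities are the conditions on `c` and `h`. The cell
consists of the four lines around the element. -/
theorem Grid.Valid.model {g : Grid} {A₀ : Finset Point} {Λ Λ' : Set ℝ} {k : ℕ}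
    (hg : g.Valid A₀ Λ Λ' k) {G₁ G₂ : Tr (ℝ × Point)}
    (h : Stores G₁ G₂ {r | ∃ a ∈ A₀, ∃ i, g.record a i = r} 4) {D : Type} {pd : D → Point}
    (hpd : Function.Injective pd) :
    Model A₀ (fun a d => |a.1 - (pd d).1| ≤ 1 / 2 ∧ |a.2 - (pd d).2| ≤ 1 / 2) G₁ G₂
      (fun d => g.elem (pd d)) g.record 4 4 where
  stores := h
  rc_a _ _ := rfl
  grp_length d p hp := by
    obtain ⟨m, l, -, -, bx, bv, rfl⟩ := mem_probes_squareElem.1 hp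
    rfl
  cell_length d hd := by
    obtain ⟨p, hp⟩ := List.exists_mem_of_ne_nil _ hd
    obtain ⟨m, l, hm, hl, -⟩ := mem_probes_squareElem.1 hp
    simp only [Grid.elem, hm, hl, squareElem, List.length_cons, List.length_nil]
  cov_iff d a ha := by
    have hE := hg.axis.ends_spec (hg.guarded a ha)
    have hE' := hg.axis'.ends_spec (hg.guarded' a ha)
    have hits : ∀ m l, bracket g.px g.nx (pd d).1 = some m → bracket g.py g.ny (pd d).2 = some l →
        ((|a.1 - (pd d).1| ≤ 1 / 2 ∧ |a.2 - (pd d).2| ≤ 1 / 2) ↔ ∃ bx bv i,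
          (squareProbe bx bv m l (pd d).2).Hits (pd d).1 (g.record a i)) := by
      rintro ⟨m₁, m₂⟩ ⟨l₁, l₂⟩ hm hl
      rw [abs_sub_le_iff_exists (hg.axis.bracket_spec hm) hE,
        abs_sub_le_iff_exists (hg.axis'.bracket_spec hl) hE']
      have hsgn : ∀ bx bv y, (squareProbe bx bv (m₁, m₂) (l₁, l₂) y).sgn (pd d).1 =
          sg bx * (pd d).1 := by
        intro bx bv y
        cases bx <;> simp [Probe.sgn, squareProbe, sg]
      simp only [Probe.Hits, hsgn]
      simp only [squareProbe, Grid.record, squareRec, List.cons.injEq, and_true]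
      constructor
      · rintro ⟨⟨s, e, h₁, h₂⟩, s', e', h₁', h₂'⟩
        -- The index of the record encodes the side of the line and the choice between first and
        -- last line, in each coordinate.
        refine ⟨s, s', views.symm (s, s', e, e'), ?_⟩
        rw [Equiv.apply_symm_apply]
        exact ⟨⟨rfl, rfl, h₁, h₁'⟩, h₂, h₂'⟩
      · rintro ⟨s, s', i, ⟨h₁, h₁', h₂, h₂'⟩, h₃, h₃'⟩
        rw [h₁] at h₃
        rw [h₁'] at h₃'
        exact ⟨⟨s, _, h₂, h₃⟩, s', _, h₂', h₃'⟩
    rw [Grid.elem, squareElem_x]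
    constructor
    · intro hc
      obtain ⟨m, hm⟩ := Option.ne_none_iff_exists'.1
        (hg.axis.bracket_ne_none (hg.guarded a ha) hc.1)
      obtain ⟨l, hl⟩ := Option.ne_none_iff_exists'.1
        (hg.axis'.bracket_ne_none (hg.guarded' a ha) hc.2)
      obtain ⟨bx, bv, i, hi⟩ := (hits m l hm hl).1 hc
      exact ⟨_, mem_probes_squareElem.2 ⟨m, l, hm, hl, bx, bv, rfl⟩, i, hi⟩
    · rintro ⟨p, hp, i, hi⟩
      obtain ⟨m, l, hm, hl, bx, bv, rfl⟩ := mem_probes_squareElem.1 hp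
      exact (hits m l hm hl).2 ⟨bx, bv, i, hi⟩
  of_grp d d' p hp p' hp' he := by
    obtain ⟨⟨m₁, m₂⟩, ⟨l₁, l₂⟩, hm, hl, bx, bv, rfl⟩ := mem_probes_squareElem.1 hp
    obtain ⟨⟨m₁', m₂'⟩, ⟨l₁', l₂'⟩, hm', hl', bx', bv', rfl⟩ := mem_probes_squareElem.1 hp'
    simp only [squareProbe, List.cons.injEq, and_true, sg_injective.eq_iff] at he
    obtain ⟨rfl, rfl, h₁, h₂⟩ := he
    -- The group names only one line of each bracket, the one selected by the sign; the other line
    -- follows.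
    have hx := (hg.axis.bracket_spec hm).unique (hg.axis.bracket_spec hm')
      (by cases bx <;> simp at h₁ <;> simp [h₁])
    have hy := (hg.axis'.bracket_spec hl).unique (hg.axis'.bracket_spec hl')
      (by cases bv <;> simp at h₂ <;> simp [h₂])
    refine ⟨rfl, ?_⟩
    simp only [Grid.elem, hm, hl, hm', hl', squareElem, hx, hy]
  of_cell d d' he hd' p hp := by
    obtain ⟨q, hq⟩ := List.exists_mem_of_ne_nil _ hd'
    obtain ⟨⟨m₁, m₂⟩, ⟨l₁, l₂⟩, hm, hl, bx, bv, rfl⟩ := mem_probes_squareElem.1 hp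
    obtain ⟨⟨m₁', m₂'⟩, ⟨l₁', l₂'⟩, hm', hl', -⟩ := mem_probes_squareElem.1 hq
    refine ⟨_, mem_probes_squareElem.2 ⟨_, _, hm', hl', bx, bv, rfl⟩, rfl, ?_⟩
    simp only [Grid.elem, hm, hl, hm', hl', squareElem, List.cons.injEq, and_true] at he
    simp only [squareProbe, he]
  id_injective := by
    intro d d' h
    simp only [Grid.elem, squareElem_id, List.cons.injEq, and_true] at h
    exact hpd (Prod.ext h.1 h.2)

/-- The records of a point for a crossing of two lines. -/
noncomputable def crossing (m l : ℝ) (a : Point) : List Rec :=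
  [squareRec true true m l a, squareRec true false m l a, squareRec false true m l a,
    squareRec false false m l a]

set_option maxRecDepth 10000 in
theorem wpc_crossing {m l : ℝ} {a : Point} {rs : List Rec} {Φ : Val → ℕ → Prop}
    (hΦ : ∀ t ≤ 300, Φ (Val.ofList ((crossing m l a ++ rs).map encRec)) t) :
    wpc (coreFuns ++ squareFuns) 37 (.cell (.cell (.num m) (.num l))
      (.cell (encodePoint a) (Val.ofList (rs.map encRec)))) Φ := by
  simp [crossing, encRec, squareRec, sg, Val.ofList, -one_div] at hΦ
  refine wpc_of_ev (body := codeCrossing) rfl ?_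
  simp [codeCrossing, codeSquareRec, encodePoint, -one_div]
  norm_num at hΦ ⊢
  exact hΦ _ (by norm_num)

/-- The list of the records of a point. -/
noncomputable def Grid.recs (g : Grid) (a : Point) : List Rec :=
  crossing (firstEnd g.px a.1) (firstEnd g.py a.2) a ++
    (crossing (firstEnd g.px a.1) (lastEnd g.ny a.2) a ++
      (crossing (lastEnd g.nx a.1) (firstEnd g.py a.2) a ++
        (crossing (lastEnd g.nx a.1) (lastEnd g.ny a.2) a ++ [])))

theorem Grid.mem_recs {g : Grid} {a : Point} {r : Rec} : r ∈ g.recs a ↔ ∃ i, g.record a i = r := by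
  have : (∃ i, g.record a i = r) ↔ ∃ q : Bool × Bool × Bool × Bool, squareRec q.1 q.2.1
      (if q.2.2.1 then firstEnd g.px a.1 else lastEnd g.nx a.1)
      (if q.2.2.2 then firstEnd g.py a.2 else lastEnd g.ny a.2) a = r :=
    views.exists_congr_left.trans (by simp [Grid.record])
  rw [this]
  simp only [Grid.recs, crossing, Prod.exists, Bool.exists_bool, List.mem_append, List.mem_cons,
    List.not_mem_nil, or_false, if_true, Bool.false_eq_true, if_false, eq_comm (b := r)]
  tauto

section
variable {g : Grid} {A₀ : Set Point} {Λ Λ' : Set ℝ} {k : ℕ} (hg : g.Valid A₀ Λ Λ' k) {m : ℕ}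
  (hk : k ≤ 3 * m)
include hg hk

theorem wpc_squareRecs {a : Point} (ha : a ∈ A₀) {Φ : Val → ℕ → Prop}
    (hΦ : ∀ t ≤ 150000 * Nat.log 2 (m + 2), Φ (Val.ofList ((g.recs a).map encRec)) t) :
    wpc (coreFuns ++ squareFuns) 29 (.cell (encGrid g) (encodePoint a)) Φ := by
  have hpos : 0 < Nat.log 2 (m + 2) := Nat.log_pos (by norm_num) (by omega)
  refine wpc_of_ev (body := codeSquareRecs) rfl ?_
  have e : encodePoint a = .cell (.num a.1) (.num a.2) := rfl
  simp [codeSquareRecs, encGrid, e]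
  refine wpc_ends hg.axis hk (hg.guarded a ha) fun t₁ ht₁ => ?_
  refine wpc_ends hg.axis' hk (hg.guarded' a ha) fun t₂ ht₂ => ?_
  simp [encodePoint]
  refine wpc_crossing (rs := []) fun t₃ ht₃ => ?_
  refine wpc_crossing fun t₄ ht₄ => ?_
  refine wpc_crossing fun t₅ ht₅ => ?_
  refine wpc_crossing fun t₆ ht₆ => ?_
  exact hΦ _ (by omega)

set_option maxRecDepth 10000 in
theorem wpc_squareElem {S : Static} (hS : S.aux = encGrid g) {d : Point} {Φ : Val → ℕ → Prop}
    (hΦ : ∀ t ≤ 150000 * Nat.log 2 (m + 2), Φ (encElem (g.elem d)) t) :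
    wpc (coreFuns ++ squareFuns) 23 (.cell (encStatic S) (encodePoint d)) Φ := by
  have hpos : 0 < Nat.log 2 (m + 2) := Nat.log_pos (by norm_num) (by omega)
  refine wpc_of_ev (body := codeSquareElem) rfl ?_
  simp [codeSquareElem, encStatic, hS, encGrid, encodePoint]
  refine wpc_bracket hg.axis hk fun t₁ ht₁ => ?_
  refine wpc_bracket hg.axis' hk fun t₂ ht₂ => ?_
  unfold Grid.elem at hΦ
  cases hx : bracket g.px g.nx d.1 with
  | none =>
    simp [hx, encBracket, squareElem, encElem] at hΦ ⊢
    exact hΦ _ (by omega)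
  | some x =>
    cases hy : bracket g.py g.ny d.2 with
    | none =>
      simp [hx, hy, encBracket, squareElem, encElem, encodePoint] at hΦ ⊢
      exact hΦ _ (by omega)
    | some y =>
      simp [hx, hy, squareElem, encElem, squareProbe, encProbe, sg] at hΦ
      simp [encBracket, encodePoint, codeSquareProbe]
      exact hΦ _ (by omega)

end

/-- Each static coordinate adds at most three lines, whence `3 * l.length`. Which lines arise
depends on the order of the points, so they are taken from the run. -/
theorem wpc_aux (l : List Point) : ∃ (g : Grid) (Λ Λ' : Set ℝ),
    g.Valid {a | a ∈ l} Λ Λ' (3 * l.length) ∧ ∀ Φ : Val → ℕ → Prop,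
      (∀ t ≤ 6000000 * (l.length + 1) * Nat.log 2 (l.length + 2), Φ (encGrid g) t) →
        wpc (coreFuns ++ squareFuns) 30 (Val.ofList (l.map encodePoint)) Φ := by
  have hpos : 0 < Nat.log 2 (l.length + 2) := Nat.log_pos (by norm_num) (by omega)
  suffices wpc (coreFuns ++ squareFuns) 30 (Val.ofList (l.map encodePoint)) fun σ t =>
      ∃ (g : Grid) (Λ Λ' : Set ℝ), σ = encGrid g ∧ g.Valid {a | a ∈ l} Λ Λ' (3 * l.length) ∧
        t ≤ 6000000 * (l.length + 1) * Nat.log 2 (l.length + 2) by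
    obtain ⟨b, hb, v, t, hr, g, Λ, Λ', rfl, h, ht⟩ := this
    exact ⟨g, Λ, Λ', h, fun Φ hΦ => ⟨b, hb, _, t, hr, hΦ t ht⟩⟩
  refine wpc_of_ev (body := codeAux) rfl ?_
  simp [codeAux]
  refine wpc_fold (f := 33) (g := 34) rfl (enc := encodePoint)
    (fun r σ => ∃ (g : Grid) (Λ Λ' : Set ℝ) (B : Set Point) (k : ℕ), σ = encGrid g ∧
      g.Valid B Λ Λ' k ∧ k + 3 * r.length ≤ 3 * l.length ∧ B ∪ {a | a ∈ r} = {a | a ∈ l})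
    (B := 5000100 * Nat.log 2 (l.length + 2)) ?_
    ⟨⟨.nil, .nil, .nil, .nil⟩, ∅, ∅, ∅, 0, rfl, ⟨Axis.nil, Axis.nil, by simp, by simp⟩, by omega,
      by simp⟩ ?_
  · rintro a r σ ⟨g, Λ, Λ', B, k, rfl, hg, hk, hB⟩ Φ hΦ
    rw [List.length_cons] at hk
    refine wpc_of_ev (body := codeLinesPoint) rfl ?_
    simp [codeLinesPoint, encGrid, encodePoint]
    refine wpc_lines hg.axis (m := l.length) (by omega) fun t₁ ht₁ p n Λ₁ h₁ s₁ u₁ => ?_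
    refine wpc_lines hg.axis' (m := l.length) (by omega) fun t₂ ht₂ p' n' Λ₂ h₂ s₂ u₂ => ?_
    refine hΦ _ (by omega) _ ⟨⟨p, n, p', n'⟩, Λ₁, Λ₂, insert a B, k + 3, rfl,
      ⟨h₁, h₂, fun b hb => ?_, fun b hb => ?_⟩, by omega, ?_⟩
    · rcases hb with rfl | hb
      · exact u₁
      · exact (hg.guarded b hb).mono s₁
    · rcases hb with rfl | hb
      · exact u₂
      · exact (hg.guarded' b hb).mono s₂
    · rw [← hB]
      ext b
      simp only [Set.mem_union, Set.mem_insert_iff, Set.mem_ofPred_eq, List.mem_cons]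
      tauto
  · rintro t ht σ ⟨g, Λ, Λ', B, k, rfl, hg, hk, hB⟩
    obtain rfl : B = {a | a ∈ l} := by simpa using hB
    refine ⟨g, rfl, ⟨Λ, Λ', hg.axis.mono (by simpa using hk), hg.axis'.mono (by simpa using hk),
      hg.guarded, hg.guarded'⟩, ?_⟩
    have h₁ : 6000000 * (l.length + 1) * Nat.log 2 (l.length + 2) =
      5000100 * Nat.log 2 (l.length + 2) * (l.length + 1) +
        999900 * ((l.length + 1) * Nat.log 2 (l.length + 2)) := by ring
    have h₂ : l.length + 1 ≤ (l.length + 1) * Nat.log 2 (l.length + 2) :=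
      Nat.le_mul_of_pos_right _ hpos
    rw [add_mul] at ht
    omega

/-- The map `pd` is the identity when points are dynamic and the centre when squares are. The
constant is `2 * 6000000 + 20000000`, from `wpc_aux` and `wpc_static`. -/
theorem square_implements {D : Type} {pd : D → Point} (hpd : Function.Injective pd) :
    Implements squareFuns (fun d => encodePoint (pd d))
      (fun a d => |a.1 - (pd d).1| ≤ 1 / 2 ∧ |a.2 - (pd d).2| ≤ 1 / 2) 32000000 := by
  intro l A₀ hA₀
  obtain ⟨g, Λ, Λ', hg, haux⟩ := wpc_aux l
  have hg' : g.Valid A₀ Λ Λ' (3 * l.length) := ⟨hg.axis, hg.axis',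
    fun a ha => hg.guarded a ((hA₀ a).1 ha), fun a ha => hg.guarded' a ((hA₀ a).1 ha)⟩
  obtain ⟨S, hS, h₁, h₂, h₃, h₄⟩ := wpc_static (rc := g.record) (n := 4) (K := 6000000) hA₀
    (fun _ _ => rfl) (fun _ _ _ => rfl) g.record_eq_of_grp_eq haux
    (fun a ha => ⟨g.recs a, le_rfl, fun r => Grid.mem_recs, fun Φ hΦ =>
      wpc_squareRecs hg' le_rfl ha fun t ht => hΦ t (by omega)⟩)
  exact ⟨S, fun d => g.elem (pd d), ⟨core_square, ⟨_, _, _, hg'.model h₁ hpd⟩, by omega, by omega,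
    fun d Φ hΦ => wpc_squareElem hg' le_rfl hS fun t ht => hΦ t (by omega)⟩, h₄⟩

theorem UnitSquare.center_injective : Function.Injective UnitSquare.center := by
  rintro ⟨a⟩ ⟨b⟩ h
  exact congrArg _ h

theorem hasPartiallyDynamicSetCover_unitSquare :
    HasPartiallyDynamicSetCover UnitSquare.region encodeUnitSquare := by
  refine ⟨_, _, _, _, (square_implements (pd := id) Function.injective_id).isPartiallyDynamic
    UnitSquare.center_injective (fun _ => rfl) fun X B₀ M => ?_⟩
  -- Here the centres are static, so the two arguments of each distance change places.
  simp only [IsSetCover, UnitSquare.region, Set.mem_ofPred_eq, id, abs_sub_comm]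

theorem hasPartiallyDynamicHittingSet_unitSquare :
    HasPartiallyDynamicHittingSet UnitSquare.region encodeUnitSquare :=
  ⟨_, _, _, _, (square_implements UnitSquare.center_injective).isPartiallyDynamic
    (pt := id) Function.injective_id (fun _ => rfl) fun _ _ _ => Iff.rfl⟩

end GeomCover

theorem mainTheorem9 :
    GeomCover.HasPartiallyDynamicSetCover
        GeomCover.UnitSquare.region GeomCover.encodeUnitSquare ∧
      GeomCover.HasPartiallyDynamicHittingSet
        GeomCover.UnitSquare.region GeomCover.encodeUnitSquare ∧
      GeomCover.HasPartiallyDynamicHittingSet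
        GeomCover.Quadrant.region GeomCover.encodeQuadrant := by
  exact ⟨GeomCover.hasPartiallyDynamicSetCover_unitSquare,
    GeomCover.hasPartiallyDynamicHittingSet_unitSquare,
    GeomCover.hasPartiallyDynamicHittingSet_quadrant⟩
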